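/- Let $n\ge 2$, $m\ge 1$, and let $\mathbf V$ be a smooth $(n+m)$-dimensional (Hausdorff, $\sigma$-compact) manifold, locally fibred by coordinates $u=(x^i,y^a)$ with vertical distribution $v\mathbf V=\mathrm{span}(\partial/\partial y^a)$. Let $\mathbf N:T\mathbf V\to v\mathbf V$ be an N-connection, i.e. a smooth projection onto $v\mathbf V$, with $h\mathbf V=\ker\mathbf N$ and $T\mathbf V=h\mathbf V\oplus v\mathbf V$, and let $\mathbf g={}^hg\oplus{}^vh$ be a d-metric, i.e. a Riemannian metric for which $h\mathbf V\perp v\mathbf V$. Write $\mathbf N(\partial/\partial x^i)=N_i^a\,\partial/\partial y^a$, $\mathbf e_i=\partial/\partial x^i-N_i^a\,\partial/\partial y^a$, $e_a=\partial/\partial y^a$, $g_{ij}=\mathbf g(\mathbf e_i,\mathbf e_j)$, $h_{ab}=\mathbf g(e_a,e_b)$. Let $E$ be one of $T\mathbf V$, $h\mathbf V$, $v\mathbf V$, let $P_E:T\mathbf V\to E$ be the corresponding projection of the splitting, and let $\mathcal Cl(E)$ be the bundle of Clifford algebras of $(E,\mathbf g|_E)$, $uv+vu=2\mathbf g(u,v)$.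 Let $S$ be a spinor bundle for $E$: a smooth complex vector bundle of finite rank with a smooth, fibrewise irreducible action $c$ of $\mathcal Cl(E)$, a smooth Hermitian inner product $(\cdot|\cdot)$ for which $c(u)$ is self-adjoint for $u\in E$, and a smooth antilinear fibrewise bijection $J$ with $(J\phi|J\psi)=(\psi|\phi)$ and $J(c(a)\psi)=c(\chi(a))J\psi$, where $\chi$ is the grading automorphism and $a\in\mathcal Cl(E)$ (only $a$ even, if $E$ has odd rank). Thus $(\mathbf V,\mathbf S,\mathbf J)$, $(h\mathbf V,{}^hS,{}^hJ)$, $(v\mathbf V,{}^vS,{}^vJ)$ are the cases $E=T\mathbf V,h\mathbf V,v\mathbf V$. Then: 1. There is a unique linear connection $\widehat{\mathbf D}$ on $\mathbf V$ (the canonical d-connection) with $\widehat{\mathbf D}_{\mathbf e_k}\mathbf e_j=\widehat L^i_{jk}\mathbf e_i$, $\widehat{\mathbf D}_{\mathbf e_k}e_b=\widehat L^a_{bk}e_a$, $\widehat{\mathbf D}_{e_c}\mathbf e_j=\widehat C^i_{jc}\mathbf e_i$, $\widehat{\mathbf D}_{e_c}e_b=\widehat C^a_{bc}e_a$ in all adapted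 coordinates, where $$\widehat L^i_{jk}=\tfrac12g^{ir}(\mathbf e_kg_{jr}+\mathbf e_jg_{kr}-\mathbf e_rg_{jk}),\quad \widehat L^a_{bk}=e_bN^a_k+\tfrac12h^{ac}(\mathbf e_kh_{bc}-h_{dc}\,e_bN^d_k-h_{db}\,e_cN^d_k),$$ $$\widehat C^i_{jc}=\tfrac12g^{ik}e_cg_{jk},\quad \widehat C^a_{bc}=\tfrac12h^{ad}(e_ch_{bd}+e_bh_{cd}-e_dh_{bc}).$$ It preserves the splitting and is compatible with $\mathbf g$. Let $\nabla$ be the (unique) Levi-Civita connection of $\mathbf g$ and $Z_w=\nabla_w-\widehat{\mathbf D}_w$; so $Z$ is determined by $\mathbf g$ and $\mathbf N$. 2. There is a unique connection ${}_S\widehat\nabla:\Gamma^\infty(S)\to\Gamma^\infty(S)\otimes\Omega^1(\mathbf V)$ (the canonical spin d-connection) that commutes with $J$ and satisfies, for all $a\in\Gamma^\infty(\mathcal Cl(E))$, $$({}_S\widehat\nabla\psi|\phi)+(\psi|{}_S\widehat\nabla\phi)=d(\psi|\phi),\qquad {}_S\widehat\nabla(c(a)\psi)=c(\widehat{\mathbf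 D}a)\psi+c(a)\,{}_S\widehat\nabla\psi,$$ where $\widehat{\mathbf D}$ acts on $\mathcal Cl(E)$ as a derivation. The same existence and uniqueness hold for partial connections $\Gamma^\infty(S)\to\Gamma^\infty(S)\otimes\Gamma^\infty(Q^*)$ that differentiate only along $Q=h\mathbf V$ or $Q=v\mathbf V$ (for $E=Q=h\mathbf V$ this is the spin h-operator ${}^h_S\widehat\nabla$ on ${}^hS$, and similarly for $v$); they are the restrictions of ${}_S\widehat\nabla$. In local orthonormal frames $e_\alpha$ of $E$ and $s_A$ of $S$ in which $\gamma_\alpha=c(e_\alpha)$ and $J$ have constant matrices, $${}_S\widehat\nabla_w=d_w+\tfrac14\sum_{\alpha,\beta}\mathbf g(\widehat{\mathbf D}_we_\beta,e_\alpha)\,\gamma_\alpha\gamma_\beta .$$ 3. The canonical Dirac operators $\widehat{\mathbb D}_Q=-i\sum_\alpha c(P_E b_\alpha)\,{}_S\widehat\nabla_{b_\alpha}$, for $Q=T\mathbf V,h\mathbf V,v\mathbf V$ and $(b_\alpha)$ an orthonormal basis of $Q$, do not depend on the basis, map smooth sections to smooth sections, and satisfy $\widehat{\mathbb D}_{T\mathbf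 V}=\widehat{\mathbb D}_{h\mathbf V}+\widehat{\mathbb D}_{v\mathbf V}$, i.e. $\widehat{\mathbb D}=({}^h\widehat{\mathbb D},{}^v\widehat{\mathbb D})$. 4. Statement 2 also holds with $\nabla$ in place of $\widehat{\mathbf D}$ (with $P_E\circ\nabla$ as the connection on $E$), giving a spin connection ${}_S\nabla$ with Dirac operators ${}_S\mathbb D_Q$. With the endomorphism ${}_Z\widehat\nabla_w=\frac14\sum_{\alpha,\beta}\mathbf g(Z_we_\beta,e_\alpha)c(e_\alpha)c(e_\beta)$ of $S$ ($e_\alpha$ an orthonormal basis of $E$), $${}_S\nabla_w={}_S\widehat\nabla_w+{}_Z\widehat\nabla_w,\qquad {}_S\mathbb D_Q=\widehat{\mathbb D}_Q+{}_Z\mathbb D_Q,\qquad {}_Z\mathbb D_Q=-i\sum_\alpha c(P_Eb_\alpha)\,{}_Z\widehat\nabla_{b_\alpha}.$$ -/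

import Mathlib

open Bundle
open scoped Manifold ContDiff Topology

noncomputable section

namespace NSpin

/-- The model space of an `(n+m)`-dimensional manifold with local coordinates `u = (x, y)`. -/
abbrev Model (n m : ℕ) : Type := EuclideanSpace ℝ (Fin n) × EuclideanSpace ℝ (Fin m)

section

variable (n m : ℕ) {V : Type*} [TopologicalSpace V] [ChartedSpace (Model n m) V]
  (F : Type*) [NormedAddCommGroup F] [NormedSpace ℝ F]
  {S : V → Type*} [TopologicalSpace (TotalSpace F S)]
  [∀ x, TopologicalSpace (S x)] [FiberBundle F S]

/-- A section of a bundle is smooth at a point. -/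
abbrev SmoothAt (ψ : Π x : V, S x) (x : V) : Prop :=
  ContMDiffAt 𝓘(ℝ, Model n m) (𝓘(ℝ, Model n m).prod 𝓘(ℝ, F)) ∞
    (fun y => TotalSpace.mk' F y (ψ y)) x

/-- A section of a bundle is differentiable at a point. -/
abbrev DiffAt (ψ : Π x : V, S x) (x : V) : Prop :=
  MDifferentiableAt 𝓘(ℝ, Model n m) (𝓘(ℝ, Model n m).prod 𝓘(ℝ, F))
    (fun y => TotalSpace.mk' F y (ψ y)) x

end

section

variable {n m : ℕ} {V : Type*} [TopologicalSpace V] [ChartedSpace (Model n m) V]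

instance (x : V) : FiniteDimensional ℝ (TangentSpace 𝓘(ℝ, Model n m) x) :=
  inferInstanceAs (FiniteDimensional ℝ (Model n m))

/-- The three bundles `TV`, `hV`, `vV` in the Whitney sum `TV = hV ⊕ vV`. -/
inductive Part
  | total
  | hor
  | ver

variable (n m V) in
/-- An N-connection: a smooth field of projections `N : TV → vV`, where the vertical distribution
`vV = {w | N w = w}` is, locally, the kernel of the differential of the projection
`(x, y) ↦ x` in suitable charts of the manifold (a fibred structure). -/
structure NConnection [IsManifold 𝓘(ℝ, Model n m) ∞ V] where
  /-- The projection on the vertical distribution. -/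
  proj (x : V) : TangentSpace 𝓘(ℝ, Model n m) x →L[ℝ] TangentSpace 𝓘(ℝ, Model n m) x
  idem (x : V) (w : TangentSpace 𝓘(ℝ, Model n m) x) : proj x (proj x w) = proj x w
  smooth (X : Π x : V, TangentSpace 𝓘(ℝ, Model n m) x) (x : V) :
    SmoothAt n m (Model n m) X x → SmoothAt n m (Model n m) (fun y : V => proj y (X y)) x
  fibred (x₀ : V) : ∃ φ ∈ IsManifold.maximalAtlas 𝓘(ℝ, Model n m) ∞ V, x₀ ∈ φ.source ∧
    ∀ x ∈ φ.source, ∀ w : TangentSpace 𝓘(ℝ, Model n m) x,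
      proj x w = w ↔
        (show Model n m from mfderiv 𝓘(ℝ, Model n m) 𝓘(ℝ, Model n m) φ x w).1 = 0

/-- A smooth Riemannian metric on `V`. -/
abbrev Metric (n m : ℕ) (V : Type*) [TopologicalSpace V] [ChartedSpace (Model n m) V]
    [IsManifold 𝓘(ℝ, Model n m) ∞ V] : Type _ :=
  ContMDiffRiemannianMetric 𝓘(ℝ, Model n m) ∞ (Model n m)
    (fun x : V => TangentSpace 𝓘(ℝ, Model n m) x)

variable [IsManifold 𝓘(ℝ, Model n m) ∞ V]

namespace NConnection

variable (N : NConnection n m V)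

/-- The projections of `TV` on `TV`, `hV` and `vV`. -/
def toPart : Part → (x : V) →
    TangentSpace 𝓘(ℝ, Model n m) x →ₗ[ℝ] TangentSpace 𝓘(ℝ, Model n m) x
  | .total, _ => LinearMap.id
  | .hor, x => LinearMap.id - (N.proj x).toLinearMap
  | .ver, x => (N.proj x).toLinearMap

/-- The fibres at `x` of `TV`, `hV` and `vV`. -/
def sub (p : Part) (x : V) : Submodule ℝ (TangentSpace 𝓘(ℝ, Model n m) x) :=
  LinearMap.range (N.toPart p x)

/-- The projection of a tangent vector, as an element of the subspace. -/
def toSub (p : Part) (x : V) : TangentSpace 𝓘(ℝ, Model n m) x →ₗ[ℝ] N.sub p x :=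
  (N.toPart p x).rangeRestrict

/-- `g` is a d-metric `ʰg ⊕ ᵛh` for the splitting: `hV` and `vV` are orthogonal. -/
def IsDMetric (g : Metric n m V) : Prop :=
  ∀ (x : V) (u w : TangentSpace 𝓘(ℝ, Model n m) x),
    N.proj x u = 0 → N.proj x w = w → g.inner x u w = 0

/-- Charts `u = (x, y)` adapted to the fibred structure: `vV` is spanned by the `∂/∂yᵃ`. -/
def IsAdapted (φ : OpenPartialHomeomorph V (Model n m)) : Prop :=
  φ ∈ IsManifold.maximalAtlas 𝓘(ℝ, Model n m) ∞ V ∧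
    ∀ x ∈ φ.source, ∀ w : TangentSpace 𝓘(ℝ, Model n m) x,
      N.proj x w = w ↔
        (show Model n m from mfderiv 𝓘(ℝ, Model n m) 𝓘(ℝ, Model n m) φ x w).1 = 0

end NConnection

/-! ### N-adapted frames and the canonical d-connection in adapted charts -/

/-- The standard basis of the model space. -/
def stdVec : Fin n ⊕ Fin m → Model n m
  | .inl i => (EuclideanSpace.single i 1, 0)
  | .inr a => (0, EuclideanSpace.single a 1)

/-- The coordinate vector fields `∂/∂u^α` of a chart (meaningful on its source). -/
def coordField (φ : OpenPartialHomeomorph V (Model n m)) (α : Fin n ⊕ Fin m) :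
    Π x : V, TangentSpace 𝓘(ℝ, Model n m) x :=
  VectorField.mpullback 𝓘(ℝ, Model n m) 𝓘(ℝ, Model n m) φ (fun _ => stdVec α)

namespace Coeff

variable (N : NConnection n m V) (g : Metric n m V)
  (φ : OpenPartialHomeomorph V (Model n m))

/-- The N-adapted frame `e_i = ∂/∂xⁱ - N_iᵃ ∂/∂yᵃ`, `e_a = ∂/∂yᵃ`; here `N(∂/∂xⁱ) = N_iᵃ ∂/∂yᵃ`. -/
def frame : Fin n ⊕ Fin m → Π x : V, TangentSpace 𝓘(ℝ, Model n m) x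
  | .inl i => fun x => coordField φ (.inl i) x - N.proj x (coordField φ (.inl i) x)
  | .inr a => coordField φ (.inr a)

/-- The N-connection coefficients `N_kᵃ`. -/
def nCoeff (k : Fin n) (a : Fin m) (x : V) : ℝ :=
  (show Model n m from mfderiv 𝓘(ℝ, Model n m) 𝓘(ℝ, Model n m) φ x
    (N.proj x (coordField φ (.inl k) x))).2 a

/-- The derivative `e_α f` of a function along the N-adapted frame. -/
def along (α : Fin n ⊕ Fin m) (f : V → ℝ) (x : V) : ℝ :=
  mvfderiv 𝓘(ℝ, Model n m) f x (frame N φ α x)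

/-- The coefficients `g_{ij}` of the d-metric. -/
def hMet (i j : Fin n) (x : V) : ℝ :=
  g.inner x (frame N φ (.inl i) x) (frame N φ (.inl j) x)

/-- The coefficients `h_{ab}` of the d-metric. -/
def vMet (a b : Fin m) (x : V) : ℝ :=
  g.inner x (frame N φ (.inr a) x) (frame N φ (.inr b) x)

/-- The inverse matrix `g^{ij}`. -/
def hInv (i j : Fin n) (x : V) : ℝ := (Matrix.of fun i j => hMet N g φ i j x)⁻¹ i j

/-- The inverse matrix `h^{ab}`. -/
def vInv (a b : Fin m) (x : V) : ℝ := (Matrix.of fun a b => vMet N g φ a b x)⁻¹ a b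

/-- `Lⁱ_{jk} = ½ gⁱʳ (e_k g_{jr} + e_j g_{kr} - e_r g_{jk})`. -/
def Lh (i j k : Fin n) (x : V) : ℝ :=
  (1 / 2) * ∑ r, hInv N g φ i r x *
    (along N φ (.inl k) (hMet N g φ j r) x + along N φ (.inl j) (hMet N g φ k r) x
      - along N φ (.inl r) (hMet N g φ j k) x)

/-- `Lᵃ_{bk} = e_b(N_kᵃ) + ½ hᵃᶜ (e_k h_{bc} - h_{dc} e_b N_kᵈ - h_{db} e_c N_kᵈ)`. -/
def Lv (a b : Fin m) (k : Fin n) (x : V) : ℝ :=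
  along N φ (.inr b) (nCoeff N φ k a) x
    + (1 / 2) * ∑ c, vInv N g φ a c x *
      (along N φ (.inl k) (vMet N g φ b c) x
        - ∑ d, vMet N g φ d c x * along N φ (.inr b) (nCoeff N φ k d) x
        - ∑ d, vMet N g φ d b x * along N φ (.inr c) (nCoeff N φ k d) x)

/-- `Cⁱ_{jc} = ½ gⁱᵏ e_c g_{jk}`. -/
def Ch (i j : Fin n) (c : Fin m) (x : V) : ℝ :=
  (1 / 2) * ∑ k, hInv N g φ i k x * along N φ (.inr c) (hMet N g φ j k) x

/-- `Cᵃ_{bc} = ½ hᵃᵈ (e_c h_{bd} + e_b h_{cd} - e_d h_{bc})`. -/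
def Cv (a b c : Fin m) (x : V) : ℝ :=
  (1 / 2) * ∑ d, vInv N g φ a d x *
    (along N φ (.inr c) (vMet N g φ b d) x + along N φ (.inr b) (vMet N g φ c d) x
      - along N φ (.inr d) (vMet N g φ b c) x)

end Coeff

/-- Linear connections on `V`. `D Y x w` is the value at `x` of the derivative of `Y` along `w`. -/
abbrev Conn (n m : ℕ) (V : Type*) [TopologicalSpace V] [ChartedSpace (Model n m) V]
    [IsManifold 𝓘(ℝ, Model n m) ∞ V] : Type _ :=
  CovariantDerivative 𝓘(ℝ, Model n m) (Model n m)
    (fun x : V => TangentSpace 𝓘(ℝ, Model n m) x)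

namespace Conn

variable (D : Conn n m V) (N : NConnection n m V) (g : Metric n m V)

/-- `D` is the canonical d-connection of `(g, N)`: in every adapted chart, its coefficients with
respect to the N-adapted frame are `(Lⁱ_{jk}, Lᵃ_{bk}, Cⁱ_{jc}, Cᵃ_{bc})`. -/
structure IsCanonical : Prop where
  hh (φ) (_ : N.IsAdapted φ) (x : V) (_ : x ∈ φ.source) (j k : Fin n) :
    D (Coeff.frame N φ (.inl j)) x (Coeff.frame N φ (.inl k) x) =
      ∑ i, Coeff.Lh N g φ i j k x • Coeff.frame N φ (.inl i) x
  hv (φ) (_ : N.IsAdapted φ) (x : V) (_ : x ∈ φ.source) (b : Fin m) (k : Fin n) :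
    D (Coeff.frame N φ (.inr b)) x (Coeff.frame N φ (.inl k) x) =
      ∑ a, Coeff.Lv N g φ a b k x • Coeff.frame N φ (.inr a) x
  vh (φ) (_ : N.IsAdapted φ) (x : V) (_ : x ∈ φ.source) (j : Fin n) (c : Fin m) :
    D (Coeff.frame N φ (.inl j)) x (Coeff.frame N φ (.inr c) x) =
      ∑ i, Coeff.Ch N g φ i j c x • Coeff.frame N φ (.inl i) x
  vv (φ) (_ : N.IsAdapted φ) (x : V) (_ : x ∈ φ.source) (b c : Fin m) :
    D (Coeff.frame N φ (.inr b)) x (Coeff.frame N φ (.inr c) x) =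
      ∑ a, Coeff.Cv N g φ a b c x • Coeff.frame N φ (.inr a) x

/-- `D` is a d-connection: it preserves the splitting `TV = hV ⊕ vV`. -/
def IsDConnection : Prop :=
  ∀ (Y : Π x : V, TangentSpace 𝓘(ℝ, Model n m) x) (x : V), DiffAt n m (Model n m) Y x →
    ∀ w : TangentSpace 𝓘(ℝ, Model n m) x,
      D (fun y => N.proj y (Y y)) x w = N.proj x (D Y x w)

/-- `D` is compatible with the metric. -/
def IsMetric : Prop :=
  ∀ (Y Z : Π x : V, TangentSpace 𝓘(ℝ, Model n m) x) (x : V),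
    DiffAt n m (Model n m) Y x → DiffAt n m (Model n m) Z x → ∀ w : TangentSpace 𝓘(ℝ, Model n m) x,
      mvfderiv 𝓘(ℝ, Model n m) (fun y => g.inner y (Y y) (Z y)) x w =
        g.inner x (D Y x w) (Z x) + g.inner x (Y x) (D Z x w)

/-- `D` is torsion free. -/
def IsTorsionFree : Prop :=
  ∀ (X Y : Π x : V, TangentSpace 𝓘(ℝ, Model n m) x) (x : V),
    DiffAt n m (Model n m) X x → DiffAt n m (Model n m) Y x →
      D Y x (X x) - D X x (Y x) = VectorField.mlieBracket 𝓘(ℝ, Model n m) X Y x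

/-- `D` is the Levi-Civita connection of `g`. -/
def IsLeviCivita : Prop := D.IsMetric g ∧ D.IsTorsionFree

/-- Two linear connections agree (on the vector fields that can be differentiated). -/
def Agree (D D' : Conn n m V) : Prop :=
  ∀ (Y : Π x : V, TangentSpace 𝓘(ℝ, Model n m) x) (x : V), DiffAt n m (Model n m) Y x → D' Y x = D Y x

/-- The distortion tensor `Z(w) Y = D_w Y - D'_w Y` of two linear connections. -/
def distortion (D D' : Conn n m V) (x : V) (w : TangentSpace 𝓘(ℝ, Model n m) x) :
    TangentSpace 𝓘(ℝ, Model n m) x →ₗ[ℝ] TangentSpace 𝓘(ℝ, Model n m) x :=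
  { toFun := fun Y => D.difference D' x Y w
    map_add' := fun Y Z => by simp
    map_smul' := fun a Y => by simp }

end Conn

/-! ### Clifford algebras and spin structures -/

variable (N : NConnection n m V) (g : Metric n m V)

/-- The metric at a point as a bilinear form. -/
def bilin (x : V) : LinearMap.BilinForm ℝ (TangentSpace 𝓘(ℝ, Model n m) x) :=
  (ContinuousLinearMap.coeLM ℝ).comp (g.inner x).toLinearMap

/-- The quadratic form `v ↦ g(v, v)` on `TV`, `hV` or `vV`. -/
def quad (p : Part) (x : V) : QuadraticForm ℝ (N.sub p x) :=
  (LinearMap.BilinMap.toQuadraticMap (bilin g x)).comp (N.sub p x).subtype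

/-- The fibres of the Clifford bundles of `TV`, `hV`, `vV`: `uv + vu = 2 g(u, v)`. -/
abbrev Cl (p : Part) (x : V) : Type _ := CliffordAlgebra (quad N g p x)

/-- A tangent vector, projected to `TV`, `hV` or `vV`, as an element of the Clifford algebra. -/
def clVec (p : Part) (x : V) : TangentSpace 𝓘(ℝ, Model n m) x →ₗ[ℝ] Cl N g p x :=
  (CliffordAlgebra.ι (quad N g p x)).comp (N.toSub p x)

/-- `CliffDeriv N g p D a δ`: `a` is a smooth section of the Clifford bundle (a finite sum of
products of smooth functions and smooth vector fields) and `δ x w` is its derivative along `w`,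
for the extension of the linear connection `D` to the Clifford bundle as a derivation (when `D`
does not preserve the part `p`, its projection to this part is taken). -/
inductive CliffDeriv (p : Part) (D : Conn n m V) :
    (Π x : V, Cl N g p x) →
    (Π x : V, TangentSpace 𝓘(ℝ, Model n m) x → Cl N g p x) → Prop
  | scalar (f : V → ℝ) (hf : ContMDiff 𝓘(ℝ, Model n m) 𝓘(ℝ, ℝ) ∞ f) :
      CliffDeriv p D (fun x => algebraMap ℝ (Cl N g p x) (f x))
        (fun x w => algebraMap ℝ (Cl N g p x) (mvfderiv 𝓘(ℝ, Model n m) f x w))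
  | vector (Y : Π x : V, TangentSpace 𝓘(ℝ, Model n m) x) (hY : ∀ x, SmoothAt n m (Model n m) Y x) :
      CliffDeriv p D (fun x => clVec N g p x (Y x))
        (fun x w => clVec N g p x (D (fun y => N.toPart p y (Y y)) x w))
  | add (a b : Π x : V, Cl N g p x)
      (δ ε : Π x : V, TangentSpace 𝓘(ℝ, Model n m) x → Cl N g p x) :
      CliffDeriv p D a δ → CliffDeriv p D b ε →
      CliffDeriv p D (fun x => a x + b x) (fun x w => δ x w + ε x w)
  | mul (a b : Π x : V, Cl N g p x)
      (δ ε : Π x : V, TangentSpace 𝓘(ℝ, Model n m) x → Cl N g p x) :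
      CliffDeriv p D a δ → CliffDeriv p D b ε →
      CliffDeriv p D (fun x => a x * b x) (fun x w => δ x w * b x + a x * ε x w)

/-- Contraction `g^{αβ} B(b_α, b_β)` of a bilinear expression over `TV`, `hV` or `vV` at `x`. -/
def contraction {W : Type*} [AddCommGroup W] [Module ℝ W] (p : Part) (x : V)
    (B : N.sub p x → N.sub p x → W) : W :=
  ∑ i, ∑ j, (Matrix.of fun k l => g.inner x (Module.finBasis ℝ (N.sub p x) k : N.sub p x)
      (Module.finBasis ℝ (N.sub p x) l : N.sub p x))⁻¹ i j •
    B (Module.finBasis ℝ (N.sub p x) i) (Module.finBasis ℝ (N.sub p x) j)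

end

section

variable {n m : ℕ} {V : Type*} [TopologicalSpace V] [ChartedSpace (Model n m) V]
  [IsManifold 𝓘(ℝ, Model n m) ∞ V]
  (N : NConnection n m V) (g : Metric n m V) (p : Part)
  (F : Type*) [NormedAddCommGroup F] [NormedSpace ℂ F]
  (S : V → Type*) [TopologicalSpace (TotalSpace F S)]
  [∀ x, AddCommGroup (S x)] [∀ x, Module ℂ (S x)] [∀ x, TopologicalSpace (S x)]
  [∀ x, IsTopologicalAddGroup (S x)] [∀ x, ContinuousSMul ℝ (S x)] [FiberBundle F S]

/-- The structure of a spinor bundle of `TV` (d-spinors), `hV` (h-spinors) or `vV` (v-spinors) on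
a complex vector bundle `S`: an irreducible action of the Clifford algebras by which vectors act
self-adjointly, a Hermitian inner product, and an antiunitary `J` on the fibres with
`J (a ψ) = χ(a) J ψ`, where `χ` is the grading automorphism and `a` runs over the Clifford algebra
(over its even subalgebra if the rank is odd). All data are smooth. -/
structure SpinStructure where
  cliff (x : V) : Cl N g p x →ₐ[ℝ] Module.End ℂ (S x)
  herm (x : V) : S x →ₗ⋆[ℂ] S x →ₗ[ℂ] ℂ
  J (x : V) : S x ≃ₛₗ[starRingEnd ℂ] S x
  nontrivial (x : V) : Nontrivial (S x)
  irreducible (x : V) (W : Submodule ℂ (S x)) :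
    (∀ a : Cl N g p x, ∀ ψ ∈ W, cliff x a ψ ∈ W) → W = ⊥ ∨ W = ⊤
  herm_symm (x : V) (φ ψ : S x) : herm x ψ φ = starRingEnd ℂ (herm x φ ψ)
  herm_pos (x : V) (ψ : S x) : ψ ≠ 0 → 0 < (herm x ψ ψ).re
  herm_cliff (x : V) (w : TangentSpace 𝓘(ℝ, Model n m) x) (φ ψ : S x) :
    herm x (cliff x (clVec N g p x w) φ) ψ = herm x φ (cliff x (clVec N g p x w) ψ)
  J_cliff (x : V) (a : Cl N g p x) (ψ : S x) :
    Even (Module.finrank ℝ (N.sub p x)) ∨ a ∈ CliffordAlgebra.even (quad N g p x) →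
    J x (cliff x a ψ) = cliff x (CliffordAlgebra.involute a) (J x ψ)
  J_herm (x : V) (φ ψ : S x) : herm x (J x φ) (J x ψ) = herm x ψ φ
  smooth_cliff (Y : Π x : V, TangentSpace 𝓘(ℝ, Model n m) x) (ψ : Π x : V, S x) (x : V) :
    SmoothAt n m (Model n m) Y x → SmoothAt n m F ψ x →
    SmoothAt n m F (fun y => cliff y (clVec N g p y (Y y)) (ψ y)) x
  smooth_herm (φ ψ : Π x : V, S x) (x : V) :
    SmoothAt n m F φ x → SmoothAt n m F ψ x →
    ContMDiffAt 𝓘(ℝ, Model n m) 𝓘(ℝ, ℂ) ∞ (fun y => herm y (φ y) (ψ y)) x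
  smooth_J (ψ : Π x : V, S x) (x : V) :
    SmoothAt n m F ψ x → SmoothAt n m F (fun y => J y (ψ y)) x

/-- Operators `Γ(S) → Γ(S) ⊗ Ω¹(q)`, for the part `q` of the tangent bundle. -/
abbrev PartOp (q : Part) : Type _ :=
  (Π x : V, S x) → Π x : V, N.sub q x →ₗ[ℝ] S x

variable {F S}

/-- The restriction of a connection to the directions in `TV`, `hV` or `vV`. -/
def restrict (q : Part) (nab : CovariantDerivative 𝓘(ℝ, Model n m) F S) : PartOp N S q :=
  fun ψ x => (nab ψ x).toLinearMap.comp (N.sub q x).subtype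

namespace SpinStructure

variable {N g p} (𝒮 : SpinStructure N g p F S)

/-- Clifford multiplication by (the part in `TV`, `hV` or `vV` of) a tangent vector. -/
def c (x : V) (w : TangentSpace 𝓘(ℝ, Model n m) x) : Module.End ℂ (S x) :=
  𝒮.cliff x (clVec N g p x w)

/-- `nab` is a spin connection, in the directions of the part `q`, over the linear connection `D`:
a smooth connection on the complex vector bundle `S` that commutes with `J`, is compatible with
the inner product of spinors, and satisfies the Leibniz rule for Clifford multiplication. -/
structure IsSpin (D : Conn n m V) (q : Part) (nab : PartOp N S q) : Prop where
  add (φ ψ : Π x : V, S x) (x : V) : DiffAt n m F φ x → DiffAt n m F ψ x →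
    nab (fun y => φ y + ψ y) x = nab φ x + nab ψ x
  leibniz (f : V → ℂ) (ψ : Π x : V, S x) (x : V) : MDifferentiableAt 𝓘(ℝ, Model n m) 𝓘(ℝ, ℂ) f x → DiffAt n m F ψ x →
    ∀ w : N.sub q x, nab (fun y => f y • ψ y) x w =
      f x • nab ψ x w + mvfderiv 𝓘(ℝ, Model n m) f x w • ψ x
  smooth (ψ : Π x : V, S x) (Y : Π x : V, TangentSpace 𝓘(ℝ, Model n m) x) (x : V) :
    SmoothAt n m F ψ x → SmoothAt n m (Model n m) Y x →
    SmoothAt n m F (fun y => nab ψ y (N.toSub q y (Y y))) x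
  comm_J (ψ : Π x : V, S x) (x : V) : DiffAt n m F ψ x →
    ∀ w : N.sub q x, nab (fun y => 𝒮.J y (ψ y)) x w = 𝒮.J x (nab ψ x w)
  metric (ψ φ : Π x : V, S x) (x : V) : DiffAt n m F ψ x → DiffAt n m F φ x →
    ∀ w : N.sub q x, 𝒮.herm x (nab ψ x w) (φ x) + 𝒮.herm x (ψ x) (nab φ x w) =
      mvfderiv 𝓘(ℝ, Model n m) (fun y => 𝒮.herm y (ψ y) (φ y)) x w
  clifford (a : Π x : V, Cl N g p x)
    (δ : Π x : V, TangentSpace 𝓘(ℝ, Model n m) x → Cl N g p x) :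
    CliffDeriv N g p D a δ → ∀ (ψ : Π x : V, S x) (x : V), DiffAt n m F ψ x →
    ∀ w : N.sub q x, nab (fun y => 𝒮.cliff y (a y) (ψ y)) x w =
      𝒮.cliff x (δ x w) (ψ x) + 𝒮.cliff x (a x) (nab ψ x w)

/-- The Dirac operator `-i ĉ ∘ ∇ = -i γ^α ∇_α`, contracted over the part `q`. -/
def dirac (q : Part) (nab : PartOp N S q) (ψ : Π x : V, S x) (x : V) : S x :=
  (-Complex.I) • contraction N g q x (fun u w => 𝒮.c x u (nab ψ x w))

/-- The action `¼ A^α_β γ_α γ^β` on spinors of an endomorphism `A` of a tangent space. -/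
def lift (x : V) (A : TangentSpace 𝓘(ℝ, Model n m) x →ₗ[ℝ] TangentSpace 𝓘(ℝ, Model n m) x)
    (ψ : S x) : S x :=
  (1 / 4 : ℝ) • contraction N g p x (fun u w => 𝒮.c x (A u) (𝒮.c x w ψ))

/-- A local spin gauge on an open set `U`: an orthonormal frame `e` of `TV`, `hV` or `vV` and
an orthonormal frame `s` of spinors for which the matrices of the `γ_α = c(e_α)` and of `J` are
constant. -/
structure IsGauge (U : Set V) {r k : ℕ}
    (e : Fin r → Π x : V, TangentSpace 𝓘(ℝ, Model n m) x) (s : Fin k → Π x : V, S x) : Prop where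
  isOpen : IsOpen U
  smooth_e (α : Fin r) (x : V) : x ∈ U → SmoothAt n m (Model n m) (e α) x
  smooth_s (A : Fin k) (x : V) : x ∈ U → SmoothAt n m F (s A) x
  orthonormal_e (x : V) : x ∈ U → ∀ α β, g.inner x (e α x) (e β x) = if α = β then 1 else 0
  span_e (x : V) : x ∈ U → Submodule.span ℝ (Set.range fun α => e α x) = N.sub p x
  orthonormal_s (x : V) : x ∈ U → ∀ A B, 𝒮.herm x (s A x) (s B x) = if A = B then 1 else 0
  span_s (x : V) : x ∈ U → Submodule.span ℂ (Set.range fun A => s A x) = ⊤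
  gamma_const : ∃ γ : Fin r → Matrix (Fin k) (Fin k) ℂ, ∀ x ∈ U, ∀ α A,
    𝒮.c x (e α x) (s A x) = ∑ B, γ α B A • s B x
  J_const : ∃ K : Matrix (Fin k) (Fin k) ℂ, ∀ x ∈ U, ∀ A,
    𝒮.J x (s A x) = ∑ B, K B A • s B x

/-- In every local spin gauge, `nab = d + ¼ Γ^α_{βμ} γ_α γ^β δu^μ`, where
`Γ^α_β(w) = g(D_w e_β, e_α)` and `d` acts on the components of spinors. -/
def HasGaugeFormula (D : Conn n m V) (nab : CovariantDerivative 𝓘(ℝ, Model n m) F S) : Prop :=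
  ∀ (U : Set V) (r k : ℕ) (e : Fin r → Π x : V, TangentSpace 𝓘(ℝ, Model n m) x)
    (s : Fin k → Π x : V, S x), 𝒮.IsGauge U e s →
    ∀ (ψ : Π x : V, S x) (f : Fin k → V → ℂ), (∀ x ∈ U, ψ x = ∑ A, f A x • s A x) →
    ∀ x ∈ U, (∀ A, MDifferentiableAt 𝓘(ℝ, Model n m) 𝓘(ℝ, ℂ) (f A) x) → ∀ w : TangentSpace 𝓘(ℝ, Model n m) x,
      nab ψ x w = (∑ A, mvfderiv 𝓘(ℝ, Model n m) (f A) x w • s A x)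
        + (1 / 4 : ℝ) • ∑ α, ∑ β, g.inner x (D (e β) x w) (e α x) •
            𝒮.c x (e α x) (𝒮.c x (e β x) (ψ x))

end SpinStructure

end

end NSpin

end

/-! Spin connections. For an endomorphism A of a tangent space that is skew on E, the operator ¼ Σ
c(A e_α) c(e_α) over an orthonormal basis of E is skew-Hermitian, commutes with J, and has
commutator c(A u) with c(u) for u in E (`lift_skew`, `lift_J`, `lift_c`). This is the infinitesimal
spin representation, and it carries both existence and the comparison of two spin connections.

Uniqueness is pointwise. Two spin derivations at x along the same vector differ by an endomorphism
of S x that commutes with all c(u). By Schur's lemma it is a complex scalar; it is imaginary because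
both derivations are Hermitian, and real because both commute with the antilinear J, hence zero
(`eq_zero_of_commute`, `SpinAt.agree`). The argument concerns one vector at a time, so it covers
partial connections as well as full ones.

Existence does not presuppose a gauge with constant matrices. Near a point, start with a connection
compatible with the real part of the inner product and replace it by ½(d + T⁻¹ d T), successively
for T = i, for the Clifford actions γ_α of an orthonormal frame of E, and for J. The result makes i,
all γ_α and J parallel (`exists_flatConn`). Adding ¼ Σ c(D e_α) γ_α gives a spin derivation over any
metric connection D (`FlatAt.spinAt`). By uniqueness the local constructions agree on overlaps, so
they glue without a partition of unity (`exists_isSpinConn`).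

Linear connections. Both come from a Koszul form κ(X, Y, Z) = 2 g(D_X Y, Z)
(`IsKoszul.exists_conn`). For the canonical d-connection, κ(X, Y, Z) = 2 g(∇_X hY, hZ) + 2 g(∇_X vY,
vZ) + g([hY, hZ], vX). The first two terms are the Levi-Civita connection projected to the two
distributions; the third, skew in Y and Z, removes the curvature of N from the derivative of
horizontal fields along vertical ones. The coefficients follow from the brackets of the N-adapted
frame: [e_a, e_b] = 0, [e_k, e_b] = (e_b N_k^a) e_a, and [e_i, e_j] is vertical
(`Conn.HasKoszul.isCanonical`).

The remaining claims are consequences. Differentiating components in a spin gauge makes γ_α and J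
parallel, so uniqueness gives the gauge formula. The canonical spin connection plus the lift of the
distortion is a spin derivation over ∇, so it is the Levi-Civita spin connection. Dirac operators
become sums over one orthonormal frame adapted to the splitting, which yields smoothness and
additivity. -/

noncomputable section

set_option linter.unusedSectionVars false

namespace NSpin

/-! ### Smooth and differentiable sections -/

section

variable {n m : ℕ} {V : Type*} [TopologicalSpace V] [ChartedSpace (Model n m) V]
  {F : Type*} [NormedAddCommGroup F] [NormedSpace ℝ F]
  {S : V → Type*} [TopologicalSpace (TotalSpace F S)]
  [∀ x, AddCommGroup (S x)] [∀ x, Module ℝ (S x)] [∀ x, TopologicalSpace (S x)]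
  [FiberBundle F S]

/-- A real function is smooth at a point. -/
abbrev FnSmoothAt (n m : ℕ) {V : Type*} [TopologicalSpace V] [ChartedSpace (Model n m) V]
    {W : Type*} [NormedAddCommGroup W] [NormedSpace ℝ W] (f : V → W) (x : V) : Prop :=
  ContMDiffAt 𝓘(ℝ, Model n m) 𝓘(ℝ, W) ∞ f x

/-- A real function is differentiable at a point. -/
abbrev FnDiffAt (n m : ℕ) {V : Type*} [TopologicalSpace V] [ChartedSpace (Model n m) V]
    {W : Type*} [NormedAddCommGroup W] [NormedSpace ℝ W] (f : V → W) (x : V) : Prop :=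
  MDifferentiableAt 𝓘(ℝ, Model n m) 𝓘(ℝ, W) f x

theorem FnSmoothAt.diffAt {W : Type*} [NormedAddCommGroup W] [NormedSpace ℝ W] {f : V → W} {x : V}
    (h : FnSmoothAt n m f x) : FnDiffAt n m f x :=
  ContMDiffAt.mdifferentiableAt h (by simp)

theorem FnDiffAt.smul {W : Type*} [NormedAddCommGroup W] [NormedSpace ℝ W] {f : V → ℝ}
    {g : V → W} {x : V} (h : FnDiffAt n m f x) (h' : FnDiffAt n m g x) :
    FnDiffAt n m (fun y => f y • g y) x :=
  MDifferentiableAt.smul h h'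

theorem FnDiffAt.sum {W : Type*} [NormedAddCommGroup W] [NormedSpace ℝ W] {ι : Type*}
    {s : Finset ι} {f : ι → V → W} {x : V} (h : ∀ i ∈ s, FnDiffAt n m (f i) x) :
    FnDiffAt n m (fun y => ∑ i ∈ s, f i y) x := by
  classical
  induction s using Finset.induction_on with
  | empty => simpa using mdifferentiableAt_const
  | insert i s hi ih =>
    simp only [Finset.sum_insert hi]
    exact MDifferentiableAt.add (h i (Finset.mem_insert_self i s))
      (ih fun j hj => h j (Finset.mem_insert_of_mem hj))

theorem SmoothAt.diffAt {ψ : Π x : V, S x} {x : V} (h : SmoothAt n m F ψ x) :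
    DiffAt n m F ψ x :=
  ContMDiffAt.mdifferentiableAt h (by simp)

theorem SmoothAt.congr {φ ψ : Π x : V, S x} {x : V} (h : SmoothAt n m F φ x)
    (e : ∀ᶠ y in 𝓝 x, ψ y = φ y) : SmoothAt n m F ψ x :=
  ContMDiffAt.congr_of_eventuallyEq h (e.mono fun y hy => by simp [hy])

theorem DiffAt.congr {φ ψ : Π x : V, S x} {x : V} (h : DiffAt n m F φ x)
    (e : ∀ᶠ y in 𝓝 x, ψ y = φ y) : DiffAt n m F ψ x :=
  MDifferentiableAt.congr_of_eventuallyEq h (e.mono fun y hy => by simp [hy])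

variable [VectorBundle ℝ F S]

theorem SmoothAt.add {φ ψ : Π x : V, S x} {x : V} (h : SmoothAt n m F φ x)
    (h' : SmoothAt n m F ψ x) : SmoothAt n m F (fun y => φ y + ψ y) x :=
  ContMDiffAt.add_section h h'

theorem SmoothAt.sub {φ ψ : Π x : V, S x} {x : V} (h : SmoothAt n m F φ x)
    (h' : SmoothAt n m F ψ x) : SmoothAt n m F (fun y => φ y - ψ y) x :=
  ContMDiffAt.sub_section h h'

theorem SmoothAt.smul {f : V → ℝ} {ψ : Π x : V, S x} {x : V} (h : FnSmoothAt n m f x)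
    (h' : SmoothAt n m F ψ x) : SmoothAt n m F (fun y => f y • ψ y) x :=
  ContMDiffAt.smul_section h h'

theorem SmoothAt.const_smul (a : ℝ) {ψ : Π x : V, S x} {x : V}
    (h' : SmoothAt n m F ψ x) : SmoothAt n m F (fun y => a • ψ y) x :=
  SmoothAt.smul (f := fun _ => a) contMDiffAt_const h'

theorem SmoothAt.sum {ι : Type*} {s : Finset ι} {ψ : ι → Π x : V, S x} {x : V}
    (h : ∀ i ∈ s, SmoothAt n m F (ψ i) x) : SmoothAt n m F (fun y => ∑ i ∈ s, ψ i y) x :=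
  ContMDiffAt.sum_section h

theorem DiffAt.add {φ ψ : Π x : V, S x} {x : V} (h : DiffAt n m F φ x)
    (h' : DiffAt n m F ψ x) : DiffAt n m F (fun y => φ y + ψ y) x :=
  mdifferentiableAt_add_section h h'

theorem DiffAt.smul {f : V → ℝ} {ψ : Π x : V, S x} {x : V} (h : FnDiffAt n m f x)
    (h' : DiffAt n m F ψ x) : DiffAt n m F (fun y => f y • ψ y) x :=
  MDifferentiableAt.smul_section h h'

theorem DiffAt.sum {ι : Type*} {s : Finset ι} {ψ : ι → Π x : V, S x} {x : V}
    (h : ∀ i ∈ s, DiffAt n m F (ψ i) x) : DiffAt n m F (fun y => ∑ i ∈ s, ψ i y) x :=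
  MDifferentiableAt.sum_section h

variable [ContMDiffVectorBundle ∞ F S 𝓘(ℝ, Model n m)]

/-- Regularity of the finite order 1 at a point persists on a neighbourhood. This makes identities
that hold for differentiable sections available near a point where a section is smooth. -/
theorem SmoothAt.eventually_diffAt [IsManifold 𝓘(ℝ, Model n m) ∞ V]
    {ψ : Π x : V, S x} {x : V} (h : SmoothAt n m F ψ x) :
    ∀ᶠ y in 𝓝 x, DiffAt n m F ψ y := by
  have : IsManifold 𝓘(ℝ, Model n m) 1 V :=
    IsManifold.of_le (n := ∞) (by simp)
  have : ContMDiffVectorBundle 1 F S 𝓘(ℝ, Model n m) :=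
    ContMDiffVectorBundle.of_le (n := ∞) (by simp)
  have h1 : ContMDiffAt 𝓘(ℝ, Model n m) (𝓘(ℝ, Model n m).prod 𝓘(ℝ, F)) 1
    (fun y => TotalSpace.mk' F y (ψ y)) x := ContMDiffAt.of_le h (by simp)
  exact ((contMDiffAt_iff_contMDiffAt_nhds (by simp)).1 h1).mono
    fun y hy => hy.mdifferentiableAt (by simp)

theorem smoothAt_extend {x : V} (v : S x) : SmoothAt n m F (FiberBundle.extend F v) x :=
  FiberBundle.contMDiffAt_extend _ F v

end

/-- One frame serves for all sections, and the components inherit both differentiability and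
smoothness at each point of U. -/
theorem exists_localFrame (n m : ℕ) {V : Type*} [TopologicalSpace V]
    [ChartedSpace (Model n m) V] (F : Type*) [NormedAddCommGroup F] [NormedSpace ℝ F]
    [FiniteDimensional ℝ F]
    {S : V → Type*} [TopologicalSpace (TotalSpace F S)]
    [∀ x, AddCommGroup (S x)] [∀ x, Module ℝ (S x)] [∀ x, TopologicalSpace (S x)]
    [FiberBundle F S] [VectorBundle ℝ F S] [ContMDiffVectorBundle ∞ F S 𝓘(ℝ, Model n m)]
    (x₀ : V) :
    ∃ (U : Set V) (b : Fin (Module.finrank ℝ F) → Π x, S x), IsOpen U ∧ x₀ ∈ U ∧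
      (∀ i, ∀ y ∈ U, SmoothAt n m F (b i) y) ∧
      (∀ y ∈ U, LinearIndependent ℝ (fun i => b i y)) ∧
      ∀ ψ : Π x, S x, ∃ f : Fin (Module.finrank ℝ F) → V → ℝ,
        (∀ y ∈ U, ψ y = ∑ i, f i y • b i y) ∧
        ∀ y ∈ U, (DiffAt n m F ψ y → ∀ i, FnDiffAt n m (f i) y) ∧
          (SmoothAt n m F ψ y → ∀ i, FnSmoothAt n m (f i) y) := by
  have : ContMDiffVectorBundle 1 F S 𝓘(ℝ, Model n m) :=
    ContMDiffVectorBundle.of_le (n := ∞) (by simp)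
  let t := trivializationAt F S x₀
  let b := Module.finBasis ℝ F
  have hfr := t.isLocalFrameOn_localFrame_baseSet 𝓘(ℝ, Model n m) ∞ b
  refine ⟨t.baseSet, t.localFrame b, t.open_baseSet, FiberBundle.mem_baseSet_trivializationAt' x₀,
    fun i y hy => contMDiffAt_localFrame_of_mem ∞ t b i hy, fun y hy => hfr.linearIndependent hy,
    fun ψ => ⟨fun i y => t.localFrameCoeff 𝓘(ℝ, Model n m) b i y (ψ y), fun y hy => ?_,
      fun y hy => ⟨fun h i => ?_, fun h i => ?_⟩⟩⟩
  · exact t.eq_sum_localFrameCoeff_smul hy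
  · exact mdifferentiableAt_localFrameCoeff b hy h i
  · exact contMDiffAt_localFrameCoeff b hy h i

/-! ### Smooth fibrewise operations act on differentiable sections -/

section

variable {n m : ℕ} {V : Type*} [TopologicalSpace V] [ChartedSpace (Model n m) V]
  {F₁ : Type*} [NormedAddCommGroup F₁] [NormedSpace ℝ F₁] [FiniteDimensional ℝ F₁]
  {S₁ : V → Type*} [TopologicalSpace (TotalSpace F₁ S₁)]
  [∀ x, AddCommGroup (S₁ x)] [∀ x, Module ℝ (S₁ x)] [∀ x, TopologicalSpace (S₁ x)]
  [FiberBundle F₁ S₁] [VectorBundle ℝ F₁ S₁] [ContMDiffVectorBundle ∞ F₁ S₁ 𝓘(ℝ, Model n m)]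
  {F₂ : Type*} [NormedAddCommGroup F₂] [NormedSpace ℝ F₂] [FiniteDimensional ℝ F₂]
  {S₂ : V → Type*} [TopologicalSpace (TotalSpace F₂ S₂)]
  [∀ x, AddCommGroup (S₂ x)] [∀ x, Module ℝ (S₂ x)] [∀ x, TopologicalSpace (S₂ x)]
  [FiberBundle F₂ S₂] [VectorBundle ℝ F₂ S₂] [ContMDiffVectorBundle ∞ F₂ S₂ 𝓘(ℝ, Model n m)]
  {F₃ : Type*} [NormedAddCommGroup F₃] [NormedSpace ℝ F₃]
  {S₃ : V → Type*} [TopologicalSpace (TotalSpace F₃ S₃)]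
  [∀ x, AddCommGroup (S₃ x)] [∀ x, Module ℝ (S₃ x)] [∀ x, TopologicalSpace (S₃ x)]
  [FiberBundle F₃ S₃] [VectorBundle ℝ F₃ S₃]

/-- The structures `NConnection` and `SpinStructure` only require that smooth sections go to smooth
sections, while connections act on sections that are merely differentiable. Expansion in a smooth
frame bridges the gap: the coefficients are differentiable and the images of the frame are smooth.
-/
theorem diffAt_linear (Φ : Π x, S₁ x →ₗ[ℝ] S₃ x)
    (hΦ : ∀ (φ : Π x, S₁ x) (x : V), SmoothAt n m F₁ φ x → SmoothAt n m F₃ (fun y => Φ y (φ y)) x)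
    {φ : Π x, S₁ x} {x : V} (h : DiffAt n m F₁ φ x) :
    DiffAt n m F₃ (fun y => Φ y (φ y)) x := by
  obtain ⟨U, b, hU, hx, hb, -, hc⟩ := exists_localFrame n m F₁ (S := S₁) x
  obtain ⟨f, hf, hf'⟩ := hc φ
  have h1 : DiffAt n m F₃ (fun y => ∑ i, f i y • Φ y (b i y)) x :=
    DiffAt.sum fun i _ => DiffAt.smul ((hf' x hx).1 h i) (hΦ _ x (hb i x hx)).diffAt
  refine h1.congr ?_
  filter_upwards [hU.mem_nhds hx] with y hy
  rw [hf y hy, map_sum]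
  simp

theorem diffAt_bilinear (Φ : Π x, S₁ x →ₗ[ℝ] S₂ x →ₗ[ℝ] S₃ x)
    (hΦ : ∀ (φ : Π x, S₁ x) (ψ : Π x, S₂ x) (x : V), SmoothAt n m F₁ φ x → SmoothAt n m F₂ ψ x →
      SmoothAt n m F₃ (fun y => Φ y (φ y) (ψ y)) x)
    {φ : Π x, S₁ x} {ψ : Π x, S₂ x} {x : V} (h : DiffAt n m F₁ φ x) (h' : DiffAt n m F₂ ψ x) :
    DiffAt n m F₃ (fun y => Φ y (φ y) (ψ y)) x := by
  obtain ⟨U, b, hU, hx, hb, -, hc⟩ := exists_localFrame n m F₁ (S := S₁) x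
  obtain ⟨f, hf, hf'⟩ := hc φ
  obtain ⟨U', b', hU', hx', hb', -, hc'⟩ := exists_localFrame n m F₂ (S := S₂) x
  obtain ⟨g, hg, hg'⟩ := hc' ψ
  have h1 : DiffAt n m F₃ (fun y => ∑ i, f i y • ∑ j, g j y • Φ y (b i y) (b' j y)) x :=
    DiffAt.sum fun i _ => DiffAt.smul ((hf' x hx).1 h i) <| DiffAt.sum fun j _ =>
      DiffAt.smul ((hg' x hx').1 h' j) (hΦ _ _ x (hb i x hx) (hb' j x hx')).diffAt
  refine h1.congr ?_
  filter_upwards [hU.mem_nhds hx, hU'.mem_nhds hx'] with y hy hy'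
  rw [hf y hy, hg y hy']
  rw [map_sum (Φ y), LinearMap.sum_apply]
  refine Finset.sum_congr rfl fun i _ => ?_
  rw [map_smul, LinearMap.smul_apply, map_sum]
  simp only [map_smul]

theorem fnDiffAt_bilinear {W : Type*} [NormedAddCommGroup W] [NormedSpace ℝ W]
    (Φ : Π x, S₁ x →ₗ[ℝ] S₂ x →ₗ[ℝ] W)
    (hΦ : ∀ (φ : Π x, S₁ x) (ψ : Π x, S₂ x) (x : V), SmoothAt n m F₁ φ x → SmoothAt n m F₂ ψ x →
      FnSmoothAt n m (fun y => Φ y (φ y) (ψ y)) x)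
    {φ : Π x, S₁ x} {ψ : Π x, S₂ x} {x : V} (h : DiffAt n m F₁ φ x) (h' : DiffAt n m F₂ ψ x) :
    FnDiffAt n m (fun y => Φ y (φ y) (ψ y)) x := by
  obtain ⟨U, b, hU, hx, hb, -, hc⟩ := exists_localFrame n m F₁ (S := S₁) x
  obtain ⟨f, hf, hf'⟩ := hc φ
  obtain ⟨U', b', hU', hx', hb', -, hc'⟩ := exists_localFrame n m F₂ (S := S₂) x
  obtain ⟨g, hg, hg'⟩ := hc' ψ
  have h1 : FnDiffAt n m (fun y => ∑ i, f i y • ∑ j, g j y • Φ y (b i y) (b' j y)) x :=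
    FnDiffAt.sum fun i _ => FnDiffAt.smul ((hf' x hx).1 h i) <| FnDiffAt.sum fun j _ =>
      FnDiffAt.smul ((hg' x hx').1 h' j) (hΦ _ _ x (hb i x hx) (hb' j x hx')).diffAt
  refine h1.congr_of_eventuallyEq ?_
  filter_upwards [hU.mem_nhds hx, hU'.mem_nhds hx'] with y hy hy'
  rw [hf y hy, hg y hy']
  rw [map_sum (Φ y), LinearMap.sum_apply]
  refine Finset.sum_congr rfl fun i _ => ?_
  rw [map_smul, LinearMap.smul_apply, map_sum]
  simp only [map_smul]

end

/-! ### Smooth fibre metrics and orthonormal frames -/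

section

variable {n m : ℕ} {V : Type*} [TopologicalSpace V] [ChartedSpace (Model n m) V]
  {F : Type*} [NormedAddCommGroup F] [NormedSpace ℝ F]
  {S : V → Type*} [TopologicalSpace (TotalSpace F S)]
  [∀ x, AddCommGroup (S x)] [∀ x, Module ℝ (S x)] [∀ x, TopologicalSpace (S x)]
  [FiberBundle F S]

variable (n m F) in
/-- A smooth family of real inner products on the fibres of a bundle. -/
structure FiberMetric (B : Π x : V, S x →ₗ[ℝ] S x →ₗ[ℝ] ℝ) : Prop where
  symm (x : V) (φ ψ : S x) : B x φ ψ = B x ψ φ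
  pos (x : V) (ψ : S x) : ψ ≠ 0 → 0 < B x ψ ψ
  smooth (φ ψ : Π x, S x) (x : V) : SmoothAt n m F φ x → SmoothAt n m F ψ x →
    FnSmoothAt n m (fun y => B y (φ y) (ψ y)) x

theorem sum_smul_of_mem_span {W : Type*} [AddCommGroup W] [Module ℝ W]
    (B : W →ₗ[ℝ] W →ₗ[ℝ] ℝ) {ι : Type*} [Fintype ι] [DecidableEq ι] {e : ι → W}
    (he : ∀ i j, B (e i) (e j) = if i = j then 1 else 0) {v : W}
    (hv : v ∈ Submodule.span ℝ (Set.range e)) : v = ∑ i, B (e i) v • e i := by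
  induction hv using Submodule.span_induction with
  | mem x hx => obtain ⟨j, rfl⟩ := hx; simp [he]
  | zero => simp
  | add x y _ _ h h' =>
    simp only [map_add, add_smul, Finset.sum_add_distrib]
    rw [← h, ← h']
  | smul a x _ h =>
    simp only [map_smul, smul_assoc]
    rw [← Finset.smul_sum, ← h]

theorem linearIndependent_of_orthonormal {W : Type*} [AddCommGroup W] [Module ℝ W]
    (B : W →ₗ[ℝ] W →ₗ[ℝ] ℝ) {ι : Type*} [Fintype ι] [DecidableEq ι] {e : ι → W}
    (he : ∀ i j, B (e i) (e j) = if i = j then 1 else 0) : LinearIndependent ℝ e := by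
  rw [Fintype.linearIndependent_iff]
  intro a ha i
  have := congrArg (B (e i)) ha
  simpa [he] using this

variable [VectorBundle ℝ F S]

/-- Gram–Schmidt with smooth dependence on the base point, by induction on the length. Equality of
the spans is part of the induction: it shows that the new orthogonal component u is nowhere zero, so
that its normalisation is smooth. -/
theorem FiberMetric.exists_orthonormal {B : Π x : V, S x →ₗ[ℝ] S x →ₗ[ℝ] ℝ}
    (hB : FiberMetric n m F B) (k : ℕ) {U : Set V} (v : Fin k → Π x, S x)
    (hv : ∀ i, ∀ y ∈ U, SmoothAt n m F (v i) y)
    (hli : ∀ y ∈ U, LinearIndependent ℝ (fun i => v i y)) :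
    ∃ e : Fin k → Π x, S x, (∀ i, ∀ y ∈ U, SmoothAt n m F (e i) y) ∧
      (∀ y ∈ U, ∀ i j, B y (e i y) (e j y) = if i = j then 1 else 0) ∧
      ∀ y ∈ U, Submodule.span ℝ (Set.range fun i => e i y) =
        Submodule.span ℝ (Set.range fun i => v i y) := by
  induction k with
  | zero => exact ⟨v, hv, fun y _ i => i.elim0, fun y _ => rfl⟩
  | succ k ih =>
    obtain ⟨e, he, ho, hs⟩ := ih (fun i => v i.castSucc) (fun i => hv _)
      (fun y hy => (hli y hy).comp _ (Fin.castSucc_injective k))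
    let u : Π x, S x := fun y => v (Fin.last k) y - ∑ i, B y (e i y) (v (Fin.last k) y) • e i y
    have hu : ∀ y ∈ U, SmoothAt n m F u y := fun y hy =>
      (hv _ y hy).sub (SmoothAt.sum fun i _ =>
        SmoothAt.smul (hB.smooth _ _ y (he i y hy) (hv _ y hy)) (he i y hy))
    have hsum : ∀ y ∈ U, ∑ i, B y (e i y) (v (Fin.last k) y) • e i y ∈
        Submodule.span ℝ (Set.range fun i : Fin k => e i y) := fun y hy =>
      Submodule.sum_mem _ fun i _ => Submodule.smul_mem _ _ (Submodule.subset_span ⟨i, rfl⟩)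
    have hu0 : ∀ y ∈ U, u y ≠ 0 := by
      intro y hy h0
      have h1 : v (Fin.last k) y ∈ Submodule.span ℝ (Set.range fun i : Fin k => v i.castSucc y) := by
        rw [← hs y hy, sub_eq_zero.1 h0]
        exact hsum y hy
      have h2 := (linearIndependent_finSucc'.1 (hli y hy)).2
      exact h2 h1
    have huo : ∀ y ∈ U, ∀ i, B y (e i y) (u y) = 0 := by
      intro y hy i
      simp [u, map_sub, map_sum, ho y hy]
    let w : Π x, S x := fun y => (√(B y (u y) (u y)))⁻¹ • u y
    have hpos : ∀ y ∈ U, 0 < √(B y (u y) (u y)) := fun y hy =>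
      Real.sqrt_pos.2 (hB.pos y _ (hu0 y hy))
    have hw : ∀ y ∈ U, SmoothAt n m F w y := by
      intro y hy
      refine SmoothAt.smul ?_ (hu y hy)
      have h1 := hB.smooth _ _ y (hu y hy) (hu y hy)
      have h2 : ContDiffAt ℝ ∞ (fun t : ℝ => (√t)⁻¹) (B y (u y) (u y)) :=
        (Real.contDiffAt_sqrt (hB.pos y _ (hu0 y hy)).ne').inv (hpos y hy).ne'
      exact ContMDiffAt.comp (I' := 𝓘(ℝ, ℝ)) (g := fun t : ℝ => (√t)⁻¹) y h2.contMDiffAt h1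
    have hwo : ∀ y ∈ U, ∀ i, B y (e i y) (w y) = 0 := by
      intro y hy i
      simp [w, huo y hy i]
    have hww : ∀ y ∈ U, B y (w y) (w y) = 1 := by
      intro y hy
      have h1 := hpos y hy
      have h2 := Real.mul_self_sqrt (hB.pos y _ (hu0 y hy)).le
      simp only [w, map_smul, LinearMap.smul_apply, smul_eq_mul]
      rw [← mul_assoc, ← mul_inv, h2, inv_mul_cancel₀ (hB.pos y _ (hu0 y hy)).ne']
    refine ⟨Fin.snoc (α := fun _ => Π x, S x) e w, fun i => ?_, fun y hy i j => ?_, fun y hy => ?_⟩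
    · refine Fin.lastCases ?_ (fun i => ?_) i
      · simpa using hw
      · simpa using he i
    · refine Fin.lastCases ?_ (fun i => ?_) i <;> refine Fin.lastCases ?_ (fun j => ?_) j
      · simp [hww y hy]
      · simp [hB.symm y (w y), hwo y hy, (Fin.castSucc_lt_last j).ne']
      · simp [hwo y hy, (Fin.castSucc_lt_last i).ne]
      · simp [ho y hy]
    · have h1 : Set.range (fun i => (Fin.snoc (α := fun _ => Π x, S x) e w : Fin (k + 1) → Π x, S x) i y)
          = insert (w y) (Set.range fun i => e i y) := by
        ext z
        simp [Fin.exists_fin_succ', eq_comm, or_comm]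
      have h2 : Set.range (fun i => v i y)
          = insert (v (Fin.last k) y) (Set.range fun i : Fin k => v i.castSucc y) := by
        ext z
        simp [Fin.exists_fin_succ', eq_comm, or_comm]
      rw [h1, h2, Submodule.span_insert, Submodule.span_insert, ← hs y hy]
      apply le_antisymm
      · refine sup_le ?_ le_sup_right
        rw [Submodule.span_singleton_le_iff_mem]
        refine Submodule.smul_mem _ _ (Submodule.sub_mem _ ?_ ?_)
        · exact Submodule.mem_sup_left (Submodule.mem_span_singleton_self _)
        · exact Submodule.mem_sup_right (hsum y hy)
      · refine sup_le ?_ le_sup_right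
        rw [Submodule.span_singleton_le_iff_mem]
        have h3 : v (Fin.last k) y = √(B y (u y) (u y)) • w y
            + ∑ i, B y (e i y) (v (Fin.last k) y) • e i y := by
          simp only [w, smul_smul, mul_inv_cancel₀ (hpos y hy).ne', one_smul]
          simp [u]
        rw [h3]
        exact Submodule.add_mem _ (Submodule.mem_sup_left
          (Submodule.smul_mem _ _ (Submodule.mem_span_singleton_self _)))
          (Submodule.mem_sup_right (hsum y hy))

theorem FiberMetric.exists_frame [FiniteDimensional ℝ F]
    [ContMDiffVectorBundle ∞ F S 𝓘(ℝ, Model n m)] {B : Π x : V, S x →ₗ[ℝ] S x →ₗ[ℝ] ℝ}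
    (hB : FiberMetric n m F B) (x₀ : V) :
    ∃ (U : Set V) (e : Fin (Module.finrank ℝ F) → Π x, S x), IsOpen U ∧ x₀ ∈ U ∧
      (∀ i, ∀ y ∈ U, SmoothAt n m F (e i) y) ∧
      (∀ y ∈ U, ∀ i j, B y (e i y) (e j y) = if i = j then 1 else 0) ∧
      ∀ y ∈ U, ∀ ψ : S y, ψ = ∑ i, B y (e i y) ψ • e i y := by
  obtain ⟨U, b, hU, hx, hb, hli, hc⟩ := exists_localFrame n m F (S := S) x₀
  obtain ⟨e, he, ho, hs⟩ := hB.exists_orthonormal _ b hb hli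
  refine ⟨U, e, hU, hx, he, ho, fun y hy ψ => sum_smul_of_mem_span (B y) (ho y hy) ?_⟩
  obtain ⟨f, hf, -⟩ := hc (FiberBundle.extend F ψ)
  have h1 := hf y hy
  rw [hs y hy, ← FiberBundle.extend_apply_self F ψ, h1]
  exact Submodule.sum_mem _ fun i _ => Submodule.smul_mem _ _ (Submodule.subset_span ⟨i, rfl⟩)

theorem FiberMetric.diffAt [FiniteDimensional ℝ F]
    [ContMDiffVectorBundle ∞ F S 𝓘(ℝ, Model n m)] {B : Π x : V, S x →ₗ[ℝ] S x →ₗ[ℝ] ℝ}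
    (hB : FiberMetric n m F B) {φ ψ : Π x, S x} {x : V} (h : DiffAt n m F φ x)
    (h' : DiffAt n m F ψ x) : FnDiffAt n m (fun y => B y (φ y) (ψ y)) x :=
  fnDiffAt_bilinear B hB.smooth h h'

end

/-! ### Vector fields, the metric, and projections -/

section

variable {n m : ℕ} {V : Type*} [TopologicalSpace V] [ChartedSpace (Model n m) V]
  [IsManifold 𝓘(ℝ, Model n m) ∞ V]

/-- Vector fields on `V`. -/
abbrev Field (n m : ℕ) (V : Type*) [TopologicalSpace V] [ChartedSpace (Model n m) V] : Type _ :=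
  Π x : V, TangentSpace 𝓘(ℝ, Model n m) x

theorem fiberMetric_bilin (g : Metric n m V) :
    FiberMetric n m (Model n m) (fun x => (bilin g x :
      TangentSpace 𝓘(ℝ, Model n m) x →ₗ[ℝ] TangentSpace 𝓘(ℝ, Model n m) x →ₗ[ℝ] ℝ)) where
  symm x u w := g.symm x u w
  pos x u hu := g.pos x u hu
  smooth X Y x hX hY := by
    have h := ContMDiffAt.clm_bundle_apply₂ (F₃ := ℝ) (E₃ := Bundle.Trivial V ℝ)
      (g.contMDiff.contMDiffAt (x := x)) hX hY
    exact (Bundle.contMDiffAt_totalSpace.1 h).2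

theorem metric_smooth (g : Metric n m V) {X Y : Field n m V} {x : V}
    (hX : SmoothAt n m (Model n m) X x) (hY : SmoothAt n m (Model n m) Y x) :
    FnSmoothAt n m (fun y => g.inner y (X y) (Y y)) x :=
  (fiberMetric_bilin g).smooth X Y x hX hY

theorem metric_diff (g : Metric n m V) {X Y : Field n m V} {x : V}
    (hX : DiffAt n m (Model n m) X x) (hY : DiffAt n m (Model n m) Y x) :
    FnDiffAt n m (fun y => g.inner y (X y) (Y y)) x :=
  (fiberMetric_bilin g).diffAt hX hY

theorem FnSmoothAt.along {f : V → ℝ} {X : Field n m V} {x : V} (hf : FnSmoothAt n m f x)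
    (hX : SmoothAt n m (Model n m) X x) :
    FnSmoothAt n m (fun y => mvfderiv 𝓘(ℝ, Model n m) f y (X y)) x := by
  have : IsManifold 𝓘(ℝ, Model n m) 1 V := IsManifold.of_le (n := ∞) (by simp)
  have h1 := ContMDiffAt.mfderiv_const (m := ∞) hf (by simp)
  have h2 := ContMDiffAt.clm_apply_of_inCoordinates h1 hX hf
  exact ((contMDiff_snd_tangentBundle_modelSpace ℝ 𝓘(ℝ, ℝ)).contMDiffAt).comp x h2

/-- A local extension is cut off by a bump function, which needs the Hausdorff property. Global
smoothness is wanted because the generators `CliffDeriv.vector` are globally smooth fields. -/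
theorem exists_field [T2Space V] {x : V} (w : TangentSpace 𝓘(ℝ, Model n m) x) :
    ∃ Y : Field n m V, (∀ y, SmoothAt n m (Model n m) Y y) ∧ Y x = w := by
  obtain ⟨s, hs, hY⟩ := FiberBundle.exists_contMDiffOn_extend (k := ∞) 𝓘(ℝ, Model n m)
    (Model n m) w
  obtain ⟨f, -, hf⟩ := (SmoothBumpFunction.nhds_basis_tsupport (I := 𝓘(ℝ, Model n m)) x).mem_iff.1
    (interior_mem_nhds.2 hs)
  refine ⟨fun y => f y • FiberBundle.extend (Model n m) w y, fun y => ?_, ?_⟩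
  · exact ContMDiffOn.smul_section_of_tsupport f.contMDiff.contMDiffOn isOpen_interior hf
      (hY.mono interior_subset) y
  · simp

namespace NConnection

variable (N : NConnection n m V)

theorem toPart_idem (p : Part) (x : V) (w : TangentSpace 𝓘(ℝ, Model n m) x) :
    N.toPart p x (N.toPart p x w) = N.toPart p x w := by
  cases p <;> simp [toPart, N.idem]

theorem toPart_smooth (p : Part) {Y : Field n m V} {x : V} (h : SmoothAt n m (Model n m) Y x) :
    SmoothAt n m (Model n m) (fun y => N.toPart p y (Y y)) x := by
  cases p
  · exact h
  · exact h.sub (N.smooth Y x h)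
  · exact N.smooth Y x h

theorem toPart_diff (p : Part) {Y : Field n m V} {x : V} (h : DiffAt n m (Model n m) Y x) :
    DiffAt n m (Model n m) (fun y => N.toPart p y (Y y)) x :=
  diffAt_linear (N.toPart p) (fun _ _ h => N.toPart_smooth p h) h

theorem toSub_coe (p : Part) (x : V) (w : TangentSpace 𝓘(ℝ, Model n m) x) :
    (N.toSub p x w : TangentSpace 𝓘(ℝ, Model n m) x) = N.toPart p x w := rfl

theorem toSub_self (p : Part) (x : V) (w : N.sub p x) : N.toSub p x (w : _) = w := by
  obtain ⟨w, u, rfl⟩ := w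
  exact Subtype.ext (N.toPart_idem p x u)

theorem mem_sub_iff (p : Part) (x : V) (w : TangentSpace 𝓘(ℝ, Model n m) x) :
    w ∈ N.sub p x ↔ N.toPart p x w = w := by
  constructor
  · rintro ⟨u, rfl⟩
    exact N.toPart_idem p x u
  · exact fun h => ⟨w, h⟩

end NConnection

/-! ### Coordinate fields -/

/-- The differential of a chart, with values in the model space. -/
def chartDeriv (φ : OpenPartialHomeomorph V (Model n m)) (x : V) :
    TangentSpace 𝓘(ℝ, Model n m) x →L[ℝ] Model n m :=
  mfderiv 𝓘(ℝ, Model n m) 𝓘(ℝ, Model n m) φ x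

section

variable {φ : OpenPartialHomeomorph V (Model n m)}
  (hφ : φ ∈ IsManifold.maximalAtlas 𝓘(ℝ, Model n m) ∞ V) {x : V} (hx : x ∈ φ.source)

include hφ hx

theorem mfderiv_isInvertible :
    (mfderiv 𝓘(ℝ, Model n m) 𝓘(ℝ, Model n m) φ x).IsInvertible := by
  have h : φ.MDifferentiable 𝓘(ℝ, Model n m) 𝓘(ℝ, Model n m) :=
    ⟨(contMDiffOn_of_mem_maximalAtlas hφ).mdifferentiableOn (by simp),
      (contMDiffOn_symm_of_mem_maximalAtlas hφ).mdifferentiableOn (by simp)⟩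
  exact ⟨h.mfderiv hx, rfl⟩

theorem chartDeriv_coordField (α : Fin n ⊕ Fin m) :
    chartDeriv φ x (coordField φ α x) = stdVec α :=
  (mfderiv_isInvertible hφ hx).self_apply_inverse _

theorem chartDeriv_injective : Function.Injective (chartDeriv φ x) :=
  (mfderiv_isInvertible hφ hx).bijective.1

theorem coordField_smooth (α : Fin n ⊕ Fin m) :
    SmoothAt n m (Model n m) (coordField φ α) x := by
  refine ContMDiffAt.mpullback_vectorField_preimage (n := ∞) ?_
    (contMDiffAt_of_mem_maximalAtlas hφ hx) (mfderiv_isInvertible hφ hx) (by simp)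
  exact contMDiffAt_vectorSpace_iff_contDiffAt.2 contDiffAt_const

/-- The coordinate fields are pullbacks of constant fields, and the bracket is natural under
pullback. -/
theorem mlieBracket_coordField (α β : Fin n ⊕ Fin m) :
    VectorField.mlieBracket 𝓘(ℝ, Model n m) (coordField φ α) (coordField φ β) x = 0 := by
  have hc : ∀ γ : Fin n ⊕ Fin m, MDifferentiableAt 𝓘(ℝ, Model n m) 𝓘(ℝ, Model n m).tangent
      (fun y => (⟨y, stdVec γ⟩ : TangentBundle 𝓘(ℝ, Model n m) (Model n m))) (φ x) := fun γ =>
    ((contMDiffAt_vectorSpace_iff_contDiffAt (n := ∞)).2 contDiffAt_const).mdifferentiableAt (by simp)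
  have : IsManifold 𝓘(ℝ, Model n m) (minSmoothness ℝ 2) V :=
    IsManifold.of_le (n := ∞) (by simpa using ENat.LEInfty.out)
  have : IsManifold 𝓘(ℝ, Model n m) (minSmoothness ℝ 3) V :=
    IsManifold.of_le (n := ∞) (by simpa using ENat.LEInfty.out)
  have h := VectorField.mpullback_mlieBracket (I := 𝓘(ℝ, Model n m)) (n := ∞) (hc α) (hc β)
    (contMDiffAt_of_mem_maximalAtlas hφ hx) (by simpa using ENat.LEInfty.out)
  rw [coordField, coordField, ← h, VectorField.mpullback_apply]
  have h0 : VectorField.mlieBracket 𝓘(ℝ, Model n m) (M := Model n m) (fun _ => stdVec α)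
      (fun _ => stdVec β) (φ x) = 0 := by
    have h1 := congrFun (VectorField.mlieBracketWithin_eq_lieBracketWithin (𝕜 := ℝ)
      (E := Model n m) (V := fun _ => stdVec α) (W := fun _ => stdVec β) (s := Set.univ)) (φ x)
    refine Eq.trans h1 ?_
    rw [VectorField.lieBracketWithin_univ]
    simp [VectorField.lieBracket]
    rfl
  exact (congrArg _ h0).trans (map_zero _)

theorem sum_coordField (w : TangentSpace 𝓘(ℝ, Model n m) x) :
    w = ∑ i, (chartDeriv φ x w).1 i • coordField φ (.inl i) x
      + ∑ a, (chartDeriv φ x w).2 a • coordField φ (.inr a) x := by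
  apply chartDeriv_injective hφ hx
  simp only [map_add, map_sum, map_smul, chartDeriv_coordField hφ hx, stdVec]
  ext j <;> simp [Prod.fst_sum, Prod.snd_sum, Pi.single_apply]

end

/-! ### N-adapted frames -/

namespace Coeff

variable (N : NConnection n m V)

theorem proj_frame_inl (φ : OpenPartialHomeomorph V (Model n m)) (i : Fin n) (x : V) :
    N.proj x (frame N φ (.inl i) x) = 0 := by
  simp [frame, N.idem]

variable {N} {φ : OpenPartialHomeomorph V (Model n m)} (hφ : N.IsAdapted φ) {x : V}
  (hx : x ∈ φ.source)

include hφ hx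

theorem proj_frame_inr (a : Fin m) :
    N.proj x (frame N φ (.inr a) x) = frame N φ (.inr a) x := by
  refine (hφ.2 x hx _).2 ?_
  have h := chartDeriv_coordField hφ.1 hx (.inr a)
  exact congrArg Prod.fst h

theorem frame_smooth (α : Fin n ⊕ Fin m) : SmoothAt n m (Model n m) (frame N φ α) x := by
  have h := coordField_smooth hφ.1 hx α
  cases α
  · exact h.sub (N.smooth _ x h)
  · exact h

theorem proj_coordField (k : Fin n) :
    N.proj x (coordField φ (.inl k) x) = ∑ a, nCoeff N φ k a x • coordField φ (.inr a) x := by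
  have h := sum_coordField hφ.1 hx (N.proj x (coordField φ (.inl k) x))
  have h0 : (chartDeriv φ x (N.proj x (coordField φ (.inl k) x))).1 = 0 :=
    (hφ.2 x hx _).1 (N.idem x _)
  rw [h0] at h
  simp only [PiLp.zero_apply, zero_smul, Finset.sum_const_zero, zero_add] at h
  exact h

/-- Subtracting the vertical vector N(∂/∂xⁱ) does not change the x-components, so these give the
vanishing of the horizontal coefficients; the y-components then give the rest. -/
theorem frame_linearIndependent : LinearIndependent ℝ (fun α => frame N φ α x) := by
  rw [Fintype.linearIndependent_iff]
  intro a ha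
  have h1 : ∀ i, a (.inl i) = 0 := by
    intro i
    have h2 := congrArg (fun w => (chartDeriv φ x w).1 i) ha
    have h3 : ∀ j, (chartDeriv φ x (N.proj x (coordField φ (.inl j) x))).1 = 0 := fun j =>
      (hφ.2 x hx _).1 (N.idem x _)
    simpa [frame, chartDeriv_coordField hφ.1 hx, stdVec, h3, Prod.fst_sum,
      Pi.single_apply] using h2
  have h4 := ha
  simp only [Fintype.sum_sum_type, h1, zero_smul, Finset.sum_const_zero, zero_add] at h4
  rintro (i | b)
  · exact h1 i
  · have h2 := congrArg (fun w => (chartDeriv φ x w).2 b) h4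
    simpa [frame, chartDeriv_coordField hφ.1 hx, stdVec, Prod.snd_sum, Pi.single_apply] using h2

theorem frame_linearIndependent_inl :
    LinearIndependent ℝ (fun i => frame N φ (.inl i) x) := by
  have h := (frame_linearIndependent hφ hx).comp (Sum.inl : Fin n → Fin n ⊕ Fin m)
    Sum.inl_injective
  exact h

theorem frame_linearIndependent_inr :
    LinearIndependent ℝ (fun a => frame N φ (.inr a) x) := by
  have h := (frame_linearIndependent hφ hx).comp (Sum.inr : Fin m → Fin n ⊕ Fin m)
    Sum.inr_injective
  exact h

theorem frame_span : Submodule.span ℝ (Set.range fun α => frame N φ α x) = ⊤ := by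
  refine (frame_linearIndependent hφ hx).span_eq_top_of_card_eq_finrank' ?_
  have : Module.finrank ℝ (TangentSpace 𝓘(ℝ, Model n m) x) = Module.finrank ℝ (Model n m) := rfl
  rw [this]
  simp

end Coeff

/-- A local orthonormal frame of `TV`, smooth on an open set, that is a union of frames of `hV`
and of `vV`. -/
structure IsDFrame (N : NConnection n m V) (g : Metric n m V) (U : Set V)
    (E : Fin n ⊕ Fin m → Field n m V) : Prop where
  isOpen : IsOpen U
  smooth (α) (y : V) : y ∈ U → SmoothAt n m (Model n m) (E α) y
  ortho (y : V) : y ∈ U → ∀ α β, g.inner y (E α y) (E β y) = if α = β then 1 else 0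
  proj_inl (y : V) : y ∈ U → ∀ i, N.proj y (E (.inl i) y) = 0
  proj_inr (y : V) : y ∈ U → ∀ a, N.proj y (E (.inr a) y) = E (.inr a) y

theorem exists_orthonormal_fields (g : Metric n m V) {k : ℕ} {U : Set V} (v : Fin k → Field n m V)
    (hv : ∀ i, ∀ y ∈ U, SmoothAt n m (Model n m) (v i) y)
    (hli : ∀ y ∈ U, LinearIndependent ℝ (fun i => v i y)) :
    ∃ e : Fin k → Field n m V, (∀ i, ∀ y ∈ U, SmoothAt n m (Model n m) (e i) y) ∧
      (∀ y ∈ U, ∀ i j, g.inner y (e i y) (e j y) = if i = j then 1 else 0) ∧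
      ∀ y ∈ U, Submodule.span ℝ (Set.range fun i => e i y) =
        Submodule.span ℝ (Set.range fun i => v i y) :=
  (fiberMetric_bilin g).exists_orthonormal k v hv hli

theorem isDFrame_elim {N : NConnection n m V} {g : Metric n m V} (hg : N.IsDMetric g) {U : Set V}
    (hU : IsOpen U) {e : Fin n → Field n m V} {f : Fin m → Field n m V}
    (he : ∀ i, ∀ y ∈ U, SmoothAt n m (Model n m) (e i) y)
    (hf : ∀ i, ∀ y ∈ U, SmoothAt n m (Model n m) (f i) y)
    (heo : ∀ y ∈ U, ∀ i j, g.inner y (e i y) (e j y) = if i = j then 1 else 0)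
    (hfo : ∀ y ∈ U, ∀ i j, g.inner y (f i y) (f j y) = if i = j then 1 else 0)
    (h1 : ∀ y ∈ U, ∀ i, N.proj y (e i y) = 0)
    (h2 : ∀ y ∈ U, ∀ a, N.proj y (f a y) = f a y) :
    IsDFrame N g U (Sum.elim e f) where
  isOpen := hU
  smooth := by
    rintro (i | a) y hy
    · exact he i y hy
    · exact hf a y hy
  ortho := by
    rintro y hy (i | a) (j | b)
    · simp only [Sum.elim_inl, Sum.inl.injEq]
      exact heo y hy i j
    · simp only [Sum.elim_inl, Sum.elim_inr, reduceCtorEq, if_false]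
      exact hg y _ _ (h1 y hy i) (h2 y hy b)
    · simp only [Sum.elim_inl, Sum.elim_inr, reduceCtorEq, if_false]
      exact (g.symm y _ _).trans (hg y _ _ (h1 y hy j) (h2 y hy a))
    · simp only [Sum.elim_inr, Sum.inr.injEq]
      exact hfo y hy a b
  proj_inl := h1
  proj_inr := h2

theorem map_eq_zero_of_span_eq {W W' ι : Type*} [AddCommGroup W] [Module ℝ W] [AddCommGroup W']
    [Module ℝ W'] (L : W →ₗ[ℝ] W') {e v : ι → W}
    (h : Submodule.span ℝ (Set.range e) = Submodule.span ℝ (Set.range v))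
    (hv : ∀ i, L (v i) = 0) (i : ι) : L (e i) = 0 := by
  have h2 : e i ∈ Submodule.span ℝ (Set.range e) := Submodule.subset_span ⟨i, rfl⟩
  rw [h] at h2
  have h3 : Submodule.span ℝ (Set.range v) ≤ LinearMap.ker L := by
    rw [Submodule.span_le]
    rintro _ ⟨j, rfl⟩
    exact hv j
  exact h3 h2

/-- Gram–Schmidt is applied separately to the horizontal and the vertical half of an N-adapted
frame. Spans are preserved, so each half stays in its distribution, and the d-metric condition makes
the halves orthogonal to each other. -/
theorem exists_dFrame {N : NConnection n m V} {g : Metric n m V} (hg : N.IsDMetric g) (x₀ : V) :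
    ∃ (U : Set V) (E : Fin n ⊕ Fin m → Field n m V), x₀ ∈ U ∧ IsDFrame N g U E := by
  obtain ⟨φ, hφ, hx, hv⟩ := N.fibred x₀
  have hA : N.IsAdapted φ := ⟨hφ, hv⟩
  obtain ⟨e, he, heo, hes⟩ := exists_orthonormal_fields g (U := φ.source)
    (fun i => Coeff.frame N φ (.inl i)) (fun i y hy => Coeff.frame_smooth hA hy _)
    (fun y hy => Coeff.frame_linearIndependent_inl hA hy)
  obtain ⟨f, hf, hfo, hfs⟩ := exists_orthonormal_fields g (U := φ.source)
    (fun a => Coeff.frame N φ (.inr a)) (fun i y hy => Coeff.frame_smooth hA hy _)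
    (fun y hy => Coeff.frame_linearIndependent_inr hA hy)
  have h1 : ∀ y ∈ φ.source, ∀ i, N.proj y (e i y) = 0 := fun y hy =>
    map_eq_zero_of_span_eq (N.proj y).toLinearMap (hes y hy)
      fun j => Coeff.proj_frame_inl N φ j y
  have h2 : ∀ y ∈ φ.source, ∀ a, N.proj y (f a y) = f a y := fun y hy a =>
    (sub_eq_zero.1 (map_eq_zero_of_span_eq (LinearMap.id - (N.proj y).toLinearMap) (hfs y hy)
      (fun j => sub_eq_zero.2 (Coeff.proj_frame_inr hA hy j).symm) a)).symm
  exact ⟨φ.source, _, hx, isDFrame_elim hg φ.open_source he hf heo hfo h1 h2⟩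

namespace IsDFrame

variable {N : NConnection n m V} {g : Metric n m V} {U : Set V} {E : Fin n ⊕ Fin m → Field n m V}
  (hE : IsDFrame N g U E) {y : V} (hy : y ∈ U)

include hE hy

theorem expand (w : TangentSpace 𝓘(ℝ, Model n m) y) : w = ∑ α, g.inner y (E α y) w • E α y := by
  have h1 : LinearIndependent ℝ (fun α => E α y) :=
    linearIndependent_of_orthonormal (bilin g y) (hE.ortho y hy)
  refine sum_smul_of_mem_span (bilin g y) (hE.ortho y hy) ?_
  rw [h1.span_eq_top_of_card_eq_finrank']
  · trivial
  · have : Module.finrank ℝ (TangentSpace 𝓘(ℝ, Model n m) y) = Module.finrank ℝ (Model n m) := rfl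
    rw [this]
    simp

theorem mem_nhds : U ∈ 𝓝 y := hE.isOpen.mem_nhds hy

end IsDFrame

theorem metric_ext (g : Metric n m V) {x : V} {u w : TangentSpace 𝓘(ℝ, Model n m) x}
    (h : ∀ z, g.inner x u z = g.inner x w z) : u = w := by
  by_contra hne
  have h1 := g.pos x (u - w) (sub_ne_zero.2 hne)
  have h2 := h (u - w)
  have h3 : g.inner x (u - w) (u - w) = g.inner x u (u - w) - g.inner x w (u - w) := by
    rw [map_sub (g.inner x) u w]
    rfl
  rw [h3, h2, sub_self] at h1
  exact lt_irrefl _ h1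

end

/-! ### Derivatives of inner products and inner products with brackets -/

section

variable {n m : ℕ} {V : Type*} [TopologicalSpace V] [ChartedSpace (Model n m) V]
  [IsManifold 𝓘(ℝ, Model n m) ∞ V] (g : Metric n m V)

theorem diffAt_extend {x : V} (w : TangentSpace 𝓘(ℝ, Model n m) x) :
    DiffAt n m (Model n m) (FiberBundle.extend (Model n m) w) x :=
  (smoothAt_extend w).diffAt

/-- The derivative of `g(Y, Z)` along `X`. -/
def dInner (X Y Z : Field n m V) (x : V) : ℝ :=
  mvfderiv 𝓘(ℝ, Model n m) (fun y => g.inner y (Y y) (Z y)) x (X x)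

/-- The function `g([X, Y], Z)`. -/
def brInner (X Y Z : Field n m V) (x : V) : ℝ :=
  g.inner x (VectorField.mlieBracket 𝓘(ℝ, Model n m) X Y x) (Z x)

section

variable {X X' Y Y' Z Z' : Field n m V} {f : V → ℝ} {x : V}

theorem dInner_symm : dInner g X Y Z x = dInner g X Z Y x := by
  have : (fun y => g.inner y (Y y) (Z y)) = fun y => g.inner y (Z y) (Y y) :=
    funext fun y => g.symm y _ _
  simp only [dInner, this]

theorem dInner_add_left : dInner g (X + X') Y Z x = dInner g X Y Z x + dInner g X' Y Z x :=
  map_add _ _ _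

theorem dInner_smul_left : dInner g (f • X) Y Z x = f x * dInner g X Y Z x :=
  map_smul (mvfderiv 𝓘(ℝ, Model n m) (fun y => g.inner y (Y y) (Z y)) x) (f x) (X x)

theorem dInner_add_mid (hY : DiffAt n m (Model n m) Y x) (hY' : DiffAt n m (Model n m) Y' x)
    (hZ : DiffAt n m (Model n m) Z x) :
    dInner g X (Y + Y') Z x = dInner g X Y Z x + dInner g X Y' Z x := by
  have h : (fun y => g.inner y ((Y + Y') y) (Z y)) =
      (fun y => g.inner y (Y y) (Z y)) + fun y => g.inner y (Y' y) (Z y) := by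
    funext y
    exact congrArg (fun l => l (Z y)) (map_add (g.inner y) (Y y) (Y' y))
  rw [dInner, h, mvfderiv_add (metric_diff g hY hZ) (metric_diff g hY' hZ)]
  rfl

theorem dInner_smul_mid (hf : FnDiffAt n m f x) (hY : DiffAt n m (Model n m) Y x)
    (hZ : DiffAt n m (Model n m) Z x) :
    dInner g X (f • Y) Z x = f x * dInner g X Y Z x +
      mvfderiv 𝓘(ℝ, Model n m) f x (X x) * g.inner x (Y x) (Z x) := by
  have h : (fun y => g.inner y ((f • Y) y) (Z y)) = f * fun y => g.inner y (Y y) (Z y) := by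
    funext y
    exact congrArg (fun l => l (Z y)) (map_smul (g.inner y) (f y) (Y y))
  rw [dInner, h, mvfderiv_mul hf (metric_diff g hY hZ)]
  change f x * dInner g X Y Z x + g.inner x (Y x) (Z x) * mvfderiv 𝓘(ℝ, Model n m) f x (X x) = _
  ring

theorem dInner_add_right (hY : DiffAt n m (Model n m) Y x) (hZ : DiffAt n m (Model n m) Z x)
    (hZ' : DiffAt n m (Model n m) Z' x) :
    dInner g X Y (Z + Z') x = dInner g X Y Z x + dInner g X Y Z' x := by
  rw [dInner_symm, dInner_add_mid g hZ hZ' hY, dInner_symm, dInner_symm g (Z := Y) (Y := Z')]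

theorem dInner_smul_right (hf : FnDiffAt n m f x) (hY : DiffAt n m (Model n m) Y x)
    (hZ : DiffAt n m (Model n m) Z x) :
    dInner g X Y (f • Z) x = f x * dInner g X Y Z x +
      mvfderiv 𝓘(ℝ, Model n m) f x (X x) * g.inner x (Y x) (Z x) := by
  rw [dInner_symm, dInner_smul_mid g hf hZ hY, dInner_symm, g.symm]

theorem brInner_swap : brInner g X Y Z x = - brInner g Y X Z x := by
  rw [brInner, VectorField.mlieBracket_swap_apply, map_neg]
  rfl

theorem brInner_add_right : brInner g X Y (Z + Z') x = brInner g X Y Z x + brInner g X Y Z' x :=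
  map_add _ _ _

theorem brInner_smul_right : brInner g X Y (f • Z) x = f x * brInner g X Y Z x :=
  map_smul (g.inner x (VectorField.mlieBracket 𝓘(ℝ, Model n m) X Y x)) (f x) (Z x)

variable (X Y Z) in
theorem brInner_add_left (hX : DiffAt n m (Model n m) X x) (hX' : DiffAt n m (Model n m) X' x) :
    brInner g (X + X') Y Z x = brInner g X Y Z x + brInner g X' Y Z x := by
  have : IsManifold 𝓘(ℝ, Model n m) 2 V := IsManifold.of_le (n := ∞) (by simpa using ENat.LEInfty.out)
  rw [brInner, VectorField.mlieBracket_add_left hX hX', map_add]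
  rfl

theorem brInner_smul_left (hf : FnDiffAt n m f x) (hX : DiffAt n m (Model n m) X x) :
    brInner g (f • X) Y Z x = f x * brInner g X Y Z x -
      mvfderiv 𝓘(ℝ, Model n m) f x (Y x) * g.inner x (X x) (Z x) := by
  have : IsManifold 𝓘(ℝ, Model n m) 2 V := IsManifold.of_le (n := ∞) (by simpa using ENat.LEInfty.out)
  rw [brInner, VectorField.mlieBracket_smul_left hf hX, map_add, map_smul, map_smul]
  change - mvfderiv 𝓘(ℝ, Model n m) f x (Y x) * g.inner x (X x) (Z x)
    + f x * brInner g X Y Z x = _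
  ring

theorem brInner_add_mid (hY : DiffAt n m (Model n m) Y x) (hY' : DiffAt n m (Model n m) Y' x) :
    brInner g X (Y + Y') Z x = brInner g X Y Z x + brInner g X Y' Z x := by
  rw [brInner_swap, brInner_add_left g _ _ _ hY hY', brInner_swap g (X := X),
    brInner_swap g (X := X)]
  ring

theorem brInner_smul_mid (hf : FnDiffAt n m f x) (hY : DiffAt n m (Model n m) Y x) :
    brInner g X (f • Y) Z x = f x * brInner g X Y Z x +
      mvfderiv 𝓘(ℝ, Model n m) f x (X x) * g.inner x (Y x) (Z x) := by
  rw [brInner_swap, brInner_smul_left g hf hY, brInner_swap g (X := X)]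
  ring

theorem dInner_smooth (hX : SmoothAt n m (Model n m) X x) (hY : SmoothAt n m (Model n m) Y x)
    (hZ : SmoothAt n m (Model n m) Z x) : FnSmoothAt n m (dInner g X Y Z) x :=
  (metric_smooth g hY hZ).along hX

theorem mlieBracket_smooth (hX : SmoothAt n m (Model n m) X x)
    (hY : SmoothAt n m (Model n m) Y x) :
    SmoothAt n m (Model n m) (VectorField.mlieBracket 𝓘(ℝ, Model n m) X Y) x := by
  have : IsManifold 𝓘(ℝ, Model n m) (((⊤ : ℕ∞) : WithTop ℕ∞) + 1) V := by
    simpa using ‹IsManifold 𝓘(ℝ, Model n m) ∞ V›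
  have : IsManifold 𝓘(ℝ, Model n m) (minSmoothness ℝ 2) V :=
    IsManifold.of_le (n := ∞) (by simpa using ENat.LEInfty.out)
  exact ContMDiffAt.mlieBracket_vectorField (m := (⊤ : ℕ∞)) (n := (⊤ : ℕ∞)) hX hY (by simp)

theorem brInner_smooth (hX : SmoothAt n m (Model n m) X x) (hY : SmoothAt n m (Model n m) Y x)
    (hZ : SmoothAt n m (Model n m) Z x) : FnSmoothAt n m (brInner g X Y Z) x :=
  metric_smooth g (mlieBracket_smooth hX hY) hZ

end

/-! ### Linear connections from Koszul forms -/

/-- `κ(X, Y, Z)` is a Koszul form: it is tensorial in `X` and `Z`, and a derivation in `Y`, such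
that `κ(X, Y, Z) = 2 g(D_X Y, Z)` defines a smooth linear connection `D`. -/
structure IsKoszul (κ : Field n m V → Field n m V → Field n m V → V → ℝ) : Prop where
  tensorial_left {Y Z : Field n m V} {x : V} : DiffAt n m (Model n m) Y x →
    DiffAt n m (Model n m) Z x → TensorialAt 𝓘(ℝ, Model n m) (Model n m) (fun X => κ X Y Z x) x
  tensorial_right {X Y : Field n m V} {x : V} : DiffAt n m (Model n m) X x →
    DiffAt n m (Model n m) Y x → TensorialAt 𝓘(ℝ, Model n m) (Model n m) (fun Z => κ X Y Z x) x
  add {X Y Y' Z : Field n m V} {x : V} : DiffAt n m (Model n m) X x →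
    DiffAt n m (Model n m) Y x → DiffAt n m (Model n m) Y' x → DiffAt n m (Model n m) Z x →
    κ X (Y + Y') Z x = κ X Y Z x + κ X Y' Z x
  leibniz {X Y Z : Field n m V} {f : V → ℝ} {x : V} : DiffAt n m (Model n m) X x →
    DiffAt n m (Model n m) Y x → FnDiffAt n m f x → DiffAt n m (Model n m) Z x →
    κ X (f • Y) Z x = f x * κ X Y Z x +
      2 * mvfderiv 𝓘(ℝ, Model n m) f x (X x) * g.inner x (Y x) (Z x)
  smooth {X Y Z : Field n m V} {x : V} : SmoothAt n m (Model n m) X x →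
    SmoothAt n m (Model n m) Y x → SmoothAt n m (Model n m) Z x → FnSmoothAt n m (κ X Y Z) x

/-- `D` is the connection with Koszul form `κ`. -/
def Conn.HasKoszul (D : Conn n m V) (κ : Field n m V → Field n m V → Field n m V → V → ℝ) : Prop :=
  ∀ (X Y Z : Field n m V) (x : V), DiffAt n m (Model n m) X x → DiffAt n m (Model n m) Y x →
    DiffAt n m (Model n m) Z x → 2 * g.inner x (D Y x (X x)) (Z x) = κ X Y Z x

/-- `D` maps smooth vector fields to smooth vector fields. -/
def Conn.IsSmooth (D : Conn n m V) : Prop :=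
  ∀ (X Y : Field n m V) (x : V), SmoothAt n m (Model n m) X x → SmoothAt n m (Model n m) Y x →
    SmoothAt n m (Model n m) (fun y => D Y y (X y)) x

variable {g}

theorem bilin_nondegenerate (g : Metric n m V) (x : V) : (bilin g x).Nondegenerate := by
  constructor
  · intro u hu
    exact metric_ext g fun z => (hu z).trans (by simp)
  · intro u hu
    exact metric_ext g fun z => ((g.symm x u z).trans (hu z)).trans (by simp)

/-- A bilinear form on the tangent space, as an endomorphism. -/
theorem exists_riesz (g : Metric n m V) (x : V)
    (B : TangentSpace 𝓘(ℝ, Model n m) x →L[ℝ] TangentSpace 𝓘(ℝ, Model n m) x →L[ℝ] ℝ) :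
    ∃ A : TangentSpace 𝓘(ℝ, Model n m) x →L[ℝ] TangentSpace 𝓘(ℝ, Model n m) x,
      ∀ u w, g.inner x (A u) w = B u w := by
  let b : TangentSpace 𝓘(ℝ, Model n m) x →ₗ[ℝ] Module.Dual ℝ (TangentSpace 𝓘(ℝ, Model n m) x) :=
    (ContinuousLinearMap.coeLM ℝ).comp B.toLinearMap
  let e := LinearMap.BilinForm.toDual (bilin g x) (bilin_nondegenerate g x)
  have : T2Space (TangentSpace 𝓘(ℝ, Model n m) x) := inferInstanceAs (T2Space (Model n m))
  refine ⟨LinearMap.toContinuousLinearMap (e.symm.toLinearMap.comp b), fun u w => ?_⟩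
  have h := LinearMap.BilinForm.apply_toDual_symm_apply (hB := bilin_nondegenerate g x) (b u) w
  exact h

/-- Tensoriality in X and Z makes κ(·, Y, ·) at x a bilinear form on the tangent space, and the
metric turns half of it into the endomorphism X ↦ D_X Y. The axioms for D in Y are those of κ,
tested against all vectors. -/
theorem IsKoszul.exists_conn {κ : Field n m V → Field n m V → Field n m V → V → ℝ}
    (hκ : IsKoszul g κ) : ∃ D : Conn n m V, D.HasKoszul g κ := by
  classical
  have : IsManifold 𝓘(ℝ, Model n m) 1 V := IsManifold.of_le (n := ∞) (by simp)
  have : ContMDiffVectorBundle 1 (Model n m) (TangentSpace 𝓘(ℝ, Model n m) : V → Type _) 𝓘(ℝ, Model n m) :=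
    ContMDiffVectorBundle.of_le (n := ∞) (by simp)
  have key : ∀ (Y : Field n m V) (x : V),
      ∃ A : TangentSpace 𝓘(ℝ, Model n m) x →L[ℝ] TangentSpace 𝓘(ℝ, Model n m) x,
        DiffAt n m (Model n m) Y x → ∀ X Z : Field n m V, DiffAt n m (Model n m) X x →
          DiffAt n m (Model n m) Z x → 2 * g.inner x (A (X x)) (Z x) = κ X Y Z x := by
    intro Y x
    by_cases hY : DiffAt n m (Model n m) Y x
    · obtain ⟨A, hA⟩ := exists_riesz g x (TensorialAt.mkHom₂ (fun X Z => κ X Y Z x) x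
        (fun Z hZ => hκ.tensorial_left hY hZ) (fun X hX => hκ.tensorial_right hX hY))
      refine ⟨(1 / 2 : ℝ) • A, fun _ X Z hX hZ => ?_⟩
      have h1 := TensorialAt.mkHom₂_apply (Φ := fun X Z => κ X Y Z x)
        (fun Z hZ => hκ.tensorial_left hY hZ) (fun X hX => hκ.tensorial_right hX hY) hX hZ
      have h2 : g.inner x (((1 / 2 : ℝ) • A) (X x)) (Z x) = (1 / 2) * g.inner x (A (X x)) (Z x) :=
        congrArg (fun l => l (Z x)) (map_smul (g.inner x) (1 / 2 : ℝ) (A (X x)))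
      rw [h2, hA, h1]
      ring
    -- Where Y is not differentiable any value will do: the axioms of a connection say nothing
    -- there.
    · exact ⟨0, fun h => absurd h hY⟩
  choose A hA using key
  refine ⟨⟨A, ?_, ?_⟩, fun X Y Z x hX hY hZ => hA Y x hY X Z hX hZ⟩
  · intro Y Y' x hY hY' _
    ext w
    refine metric_ext g fun z => ?_
    have hw := diffAt_extend w
    have hz := diffAt_extend z
    have h1 := hA (Y + Y') x (DiffAt.add hY hY') _ _ hw hz
    have h2 := hA _ x hY _ _ hw hz
    have h3 := hA _ x hY' _ _ hw hz
    have h4 := hκ.add hw hY hY' hz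
    simp only [FiberBundle.extend_apply_self] at h1 h2 h3
    have h5 : g.inner x (A Y x w + A Y' x w) z = g.inner x (A Y x w) z + g.inner x (A Y' x w) z :=
      congrArg (fun l => l z) (map_add (g.inner x) (A Y x w) (A Y' x w))
    refine Eq.trans ?_ h5.symm
    change 2 * g.inner x (A (Y + Y') x w) z = _ at h1
    linarith
  · intro Y f x hY hf _
    ext w
    refine metric_ext g fun z => ?_
    have hw := diffAt_extend w
    have hz := diffAt_extend z
    have h1 := hA _ x (DiffAt.smul hf hY) _ _ hw hz
    have h2 := hA _ x hY _ _ hw hz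
    have h4 := hκ.leibniz hw hY hf hz
    simp only [FiberBundle.extend_apply_self] at h1 h2 h4
    have h5 : g.inner x (f x • A Y x w + mvfderiv 𝓘(ℝ, Model n m) f x w • Y x) z =
        f x * g.inner x (A Y x w) z + mvfderiv 𝓘(ℝ, Model n m) f x w * g.inner x (Y x) z := by
      rw [map_add, map_smul, map_smul]
      rfl
    refine Eq.trans ?_ h5.symm
    change 2 * g.inner x (A (f • Y) x w) z = κ _ (f • Y) _ _ at h1
    linear_combination (1 / 2) * h1 + (1 / 2) * h4 - (1 / 2) * f x * h2

namespace Conn.HasKoszul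

variable {D : Conn n m V} {κ : Field n m V → Field n m V → Field n m V → V → ℝ}
  (hD : D.HasKoszul g κ)

include hD

/-- In a smooth orthonormal frame the components of D_X Y are ½ κ(X, Y, E_α). The Koszul identity
must hold on a whole neighbourhood, hence the differentiability of X and Y near x. -/
theorem isSmooth {N : NConnection n m V} (hg : N.IsDMetric g) (hκ : IsKoszul g κ) : D.IsSmooth := by
  intro X Y x hX hY
  obtain ⟨U, E, hx, hE⟩ := exists_dFrame hg x
  have h : SmoothAt n m (Model n m) (fun y => ∑ α, (1 / 2 * κ X Y (E α) y) • E α y) x :=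
    SmoothAt.sum fun α _ => SmoothAt.smul
      (contMDiffAt_const.mul (hκ.smooth hX hY (hE.smooth α x hx))) (hE.smooth α x hx)
  refine h.congr ?_
  filter_upwards [hX.eventually_diffAt, hY.eventually_diffAt, hE.mem_nhds hx] with y hX hY hy
  rw [hE.expand hy (D Y y (X y))]
  refine Finset.sum_congr rfl fun α _ => ?_
  rw [← hD X Y (E α) y hX hY (hE.smooth α y hy).diffAt, g.symm]
  congr 1
  ring

/-- Metric compatibility is a condition on the part of κ symmetric in Y and Z. -/
theorem isMetric (h : ∀ (X Y Z : Field n m V) (x : V), DiffAt n m (Model n m) X x →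
    DiffAt n m (Model n m) Y x → DiffAt n m (Model n m) Z x →
    κ X Y Z x + κ X Z Y x = 2 * dInner g X Y Z x) : D.IsMetric g := by
  intro Y Z x hY hZ w
  have hw := diffAt_extend w
  have h1 := h _ Y Z x hw hY hZ
  have h2 := hD _ Y Z x hw hY hZ
  have h3 := hD _ Z Y x hw hZ hY
  simp only [dInner, FiberBundle.extend_apply_self] at h1 h2 h3
  rw [g.symm x (Y x)]
  linarith

end Conn.HasKoszul

/-! ### The Levi-Civita connection -/

variable (g) in
/-- The Koszul form of the Levi-Civita connection. -/
def koszulLC (X Y Z : Field n m V) (x : V) : ℝ :=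
  dInner g X Y Z x + dInner g Y X Z x - dInner g Z X Y x
    + brInner g X Y Z x - brInner g X Z Y x - brInner g Y Z X x

variable (g) in
-- A scalar factor is differentiated both in the derivative terms and in the bracket terms. For X
-- and Z these contributions cancel in pairs; for Y exactly the Leibniz term survives.
theorem isKoszul_koszulLC : IsKoszul g (koszulLC g) where
  tensorial_left {Y Z x} hY hZ := by
    constructor
    · intro f X hf hX
      simp only [koszulLC, smul_eq_mul, dInner_smul_left, dInner_smul_mid g hf hX hZ,
        dInner_smul_mid g hf hX hY, brInner_smul_left g hf hX, brInner_smul_right]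
      ring
    · intro X X' hX hX'
      simp only [koszulLC, dInner_add_left, dInner_add_mid g hX hX' hZ,
        dInner_add_mid g hX hX' hY, brInner_add_left g _ _ _ hX hX', brInner_add_right]
      ring
  tensorial_right {X Y x} hX hY := by
    constructor
    · intro f Z hf hZ
      simp only [koszulLC, smul_eq_mul, dInner_smul_left, dInner_smul_right g hf hX hZ,
        dInner_smul_right g hf hY hZ, brInner_smul_mid g hf hZ, brInner_smul_right, g.symm x (Z x)]
      ring
    · intro Z Z' hZ hZ'
      simp only [koszulLC, dInner_add_left, dInner_add_right g hX hZ hZ',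
        dInner_add_right g hY hZ hZ', brInner_add_mid g hZ hZ', brInner_add_right]
      ring
  add {X Y Y' Z x} hX hY hY' hZ := by
    simp only [koszulLC, dInner_add_left, dInner_add_mid g hY hY' hZ,
      dInner_add_right g hX hY hY', brInner_add_mid g hY hY', brInner_add_left g _ _ _ hY hY',
      brInner_add_right]
    ring
  leibniz {X Y Z f x} hX hY hf hZ := by
    simp only [koszulLC, dInner_smul_left, dInner_smul_mid g hf hY hZ,
      dInner_smul_right g hf hX hY, brInner_smul_mid g hf hY, brInner_smul_left g hf hY,
      brInner_smul_right, g.symm x (X x) (Y x)]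
    ring
  smooth {X Y Z x} hX hY hZ :=
    (((((dInner_smooth g hX hY hZ).add (dInner_smooth g hY hX hZ)).sub
      (dInner_smooth g hZ hX hY)).add (brInner_smooth g hX hY hZ)).sub
      (brInner_smooth g hX hZ hY)).sub (brInner_smooth g hY hZ hX)

theorem koszulLC_add_swap (X Y Z : Field n m V) (x : V) :
    koszulLC g X Y Z x + koszulLC g X Z Y x = 2 * dInner g X Y Z x := by
  simp only [koszulLC, dInner_symm g (X := X) (Y := Z), brInner_swap g (X := Z) (Y := Y)]
  ring

theorem koszulLC_sub_swap (X Y Z : Field n m V) (x : V) :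
    koszulLC g X Y Z x - koszulLC g Y X Z x = 2 * brInner g X Y Z x := by
  simp only [koszulLC, dInner_symm g (X := Z) (Y := X), brInner_swap g (X := Y) (Y := X)]
  ring

theorem Conn.HasKoszul.isLeviCivita {D : Conn n m V} (hD : D.HasKoszul g (koszulLC g)) :
    D.IsLeviCivita g := by
  refine ⟨hD.isMetric fun X Y Z x _ _ _ => koszulLC_add_swap X Y Z x, ?_⟩
  intro X Y x hX hY
  refine metric_ext g fun z => ?_
  have hz := diffAt_extend z
  have h1 := hD X Y _ x hX hY hz
  have h2 := hD Y X _ x hY hX hz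
  have h3 := koszulLC_sub_swap (g := g) X Y (FiberBundle.extend (Model n m) z) x
  simp only [brInner, FiberBundle.extend_apply_self] at h1 h2 h3
  have h4 : g.inner x (D Y x (X x) - D X x (Y x)) z =
      g.inner x (D Y x (X x)) z - g.inner x (D X x (Y x)) z :=
    congrArg (fun l => l z) (map_sub (g.inner x) (D Y x (X x)) (D X x (Y x)))
  linarith

/-- The classical derivation of the Koszul formula: all derivatives of the metric are expanded by
compatibility and all brackets by vanishing torsion. With `Conn.HasKoszul.agree` it gives
uniqueness. -/
theorem Conn.IsLeviCivita.hasKoszul {D : Conn n m V} (hD : D.IsLeviCivita g) :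
    D.HasKoszul g (koszulLC g) := by
  intro X Y Z x hX hY hZ
  have m1 := hD.1 Y Z x hY hZ (X x)
  have m2 := hD.1 X Z x hX hZ (Y x)
  have m3 := hD.1 X Y x hX hY (Z x)
  have t : ∀ {A B : Field n m V} (C : Field n m V), DiffAt n m (Model n m) A x →
      DiffAt n m (Model n m) B x →
      brInner g A B C x = g.inner x (D B x (A x)) (C x) - g.inner x (D A x (B x)) (C x) := by
    intro A B C hA hB
    rw [brInner, ← hD.2 A B x hA hB, map_sub]
    rfl
  rw [koszulLC, t Z hX hY, t Y hX hZ, t X hY hZ]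
  simp only [dInner, m1, m2, m3]
  rw [g.symm x (D Z x (X x)), g.symm x (D Z x (Y x)), g.symm x (D X x (Z x)),
    g.symm x (D Y x (Z x))]
  ring

theorem Conn.HasKoszul.agree {D D' : Conn n m V}
    {κ : Field n m V → Field n m V → Field n m V → V → ℝ}
    (hD : D.HasKoszul g κ) (hD' : D'.HasKoszul g κ) : D.Agree D' := by
  intro Y x hY
  ext w
  refine metric_ext g fun z => ?_
  have hw := diffAt_extend w
  have hz := diffAt_extend z
  have h1 := hD _ Y _ x hw hY hz
  have h2 := hD' _ Y _ x hw hY hz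
  simp only [FiberBundle.extend_apply_self] at h1 h2
  linarith

/-! ### The canonical d-connection -/

namespace NConnection

variable (N : NConnection n m V)

/-- The part of a vector field in `TV`, `hV` or `vV`. -/
def part (p : Part) (X : Field n m V) : Field n m V := fun y => N.toPart p y (X y)

theorem part_add (p : Part) (X Y : Field n m V) : N.part p (X + Y) = N.part p X + N.part p Y :=
  funext fun _ => map_add _ _ _

theorem part_smul (p : Part) (f : V → ℝ) (X : Field n m V) :
    N.part p (f • X) = f • N.part p X :=
  funext fun y => map_smul (N.toPart p y) (f y) (X y)

theorem part_diff (p : Part) {Y : Field n m V} {x : V} (h : DiffAt n m (Model n m) Y x) :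
    DiffAt n m (Model n m) (N.part p Y) x :=
  N.toPart_diff p h

theorem part_smooth (p : Part) {Y : Field n m V} {x : V} (h : SmoothAt n m (Model n m) Y x) :
    SmoothAt n m (Model n m) (N.part p Y) x :=
  N.toPart_smooth p h

end NConnection

variable {N : NConnection n m V} (hg : N.IsDMetric g)

include hg

theorem inner_hor_ver (x : V) (u w : TangentSpace 𝓘(ℝ, Model n m) x) :
    g.inner x (N.toPart .hor x u) (N.toPart .ver x w) = 0 :=
  hg x _ _ (by simp [NConnection.toPart, N.idem]) (N.idem x w)

theorem inner_parts (x : V) (u w : TangentSpace 𝓘(ℝ, Model n m) x) :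
    g.inner x u w = g.inner x (N.toPart .hor x u) (N.toPart .hor x w) +
      g.inner x (N.toPart .ver x u) (N.toPart .ver x w) := by
  have h : ∀ v : TangentSpace 𝓘(ℝ, Model n m) x, v = N.toPart .hor x v + N.toPart .ver x v :=
    fun v => by simp [NConnection.toPart]
  have h1 := inner_hor_ver hg x u w
  have h2 := (g.symm x _ _).trans (inner_hor_ver hg x w u)
  calc g.inner x u w = g.inner x (N.toPart .hor x u + N.toPart .ver x u)
        (N.toPart .hor x w + N.toPart .ver x w) := by rw [← h, ← h]
    _ = _ := by
      rw [map_add (g.inner x), add_apply, map_add, map_add, h1, h2]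
      ring

/-- `N` is self-adjoint for a d-metric. -/
theorem inner_proj (x : V) (u w : TangentSpace 𝓘(ℝ, Model n m) x) :
    g.inner x (N.proj x u) w = g.inner x u (N.proj x w) := by
  rw [inner_parts hg, inner_parts hg x u]
  simp [NConnection.toPart, N.idem]

omit hg in
variable (N g) in
/-- The Koszul form of the canonical d-connection. -/
def koszulHat (X Y Z : Field n m V) (x : V) : ℝ :=
  koszulLC g X (N.part .hor Y) (N.part .hor Z) x + koszulLC g X (N.part .ver Y) (N.part .ver Z) x
    + brInner g (N.part .hor Y) (N.part .hor Z) (N.part .ver X) x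

/-- Compared with the projected Levi-Civita forms, only the bracket term is new. Differentiating a
scalar factor in Y or Z there produces a multiple of g(hZ, vX) or g(hY, vX), which vanishes for a
d-metric. The two Leibniz terms add up to that of g(Y, Z), since the metric is the sum of its
horizontal and vertical parts. -/
theorem isKoszul_koszulHat : IsKoszul g (koszulHat g N) where
  tensorial_left {Y Z x} hY hZ := by
    have t1 := (isKoszul_koszulLC g).tensorial_left (N.part_diff .hor hY) (N.part_diff .hor hZ)
    have t2 := (isKoszul_koszulLC g).tensorial_left (N.part_diff .ver hY) (N.part_diff .ver hZ)
    constructor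
    · intro f X hf hX
      have h1 := t1.smul hf hX
      have h2 := t2.smul hf hX
      simp only [smul_eq_mul] at h1 h2 ⊢
      simp only [koszulHat, NConnection.part_smul, brInner_smul_right]
      linear_combination h1 + h2
    · intro X X' hX hX'
      have h1 := t1.add hX hX'
      have h2 := t2.add hX hX'
      simp only [koszulHat, NConnection.part_add, brInner_add_right]
      linear_combination h1 + h2
  tensorial_right {X Y x} hX hY := by
    have t1 := (isKoszul_koszulLC g).tensorial_right hX (N.part_diff .hor hY)
    have t2 := (isKoszul_koszulLC g).tensorial_right hX (N.part_diff .ver hY)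
    constructor
    · intro f Z hf hZ
      have h1 := t1.smul hf (N.part_diff .hor hZ)
      have h2 := t2.smul hf (N.part_diff .ver hZ)
      have h3 : g.inner x (N.part .hor Z x) (N.part .ver X x) = 0 := inner_hor_ver hg x _ _
      have h4 := brInner_smul_mid g (X := N.part .hor Y) (Z := N.part .ver X) hf
        (N.part_diff .hor hZ)
      simp only [smul_eq_mul] at h1 h2 ⊢
      simp only [koszulHat, NConnection.part_smul]
      linear_combination h1 + h2 + h4 + mvfderiv 𝓘(ℝ, Model n m) f x (N.part .hor Y x) * h3
    · intro Z Z' hZ hZ'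
      have h1 := t1.add (N.part_diff .hor hZ) (N.part_diff .hor hZ')
      have h2 := t2.add (N.part_diff .ver hZ) (N.part_diff .ver hZ')
      have h4 := brInner_add_mid g (X := N.part .hor Y) (Z := N.part .ver X)
        (N.part_diff .hor hZ) (N.part_diff .hor hZ')
      simp only [koszulHat, NConnection.part_add]
      linear_combination h1 + h2 + h4
  add {X Y Y' Z x} hX hY hY' hZ := by
    have h1 := (isKoszul_koszulLC g).add hX (N.part_diff .hor hY) (N.part_diff .hor hY')
      (N.part_diff .hor hZ)
    have h2 := (isKoszul_koszulLC g).add hX (N.part_diff .ver hY) (N.part_diff .ver hY')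
      (N.part_diff .ver hZ)
    have h4 := brInner_add_left g _ (N.part .hor Z) (N.part .ver X)
      (N.part_diff .hor hY) (N.part_diff .hor hY')
    simp only [koszulHat, NConnection.part_add]
    linear_combination h1 + h2 + h4
  leibniz {X Y Z f x} hX hY hf hZ := by
    have h1 := (isKoszul_koszulLC g).leibniz hX (N.part_diff .hor hY) hf (N.part_diff .hor hZ)
    have h2 := (isKoszul_koszulLC g).leibniz hX (N.part_diff .ver hY) hf (N.part_diff .ver hZ)
    have h4 := brInner_smul_left g (Y := N.part .hor Z) (Z := N.part .ver X) hf
      (N.part_diff .hor hY)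
    have h3 : g.inner x (N.part .hor Y x) (N.part .ver X x) = 0 := inner_hor_ver hg x _ _
    have h5 : g.inner x (Y x) (Z x) = g.inner x (N.part .hor Y x) (N.part .hor Z x) +
      g.inner x (N.part .ver Y x) (N.part .ver Z x) := inner_parts hg x (Y x) (Z x)
    simp only [koszulHat, NConnection.part_smul]
    linear_combination h1 + h2 + h4 - mvfderiv 𝓘(ℝ, Model n m) f x (N.part .hor Z x) * h3
      - 2 * mvfderiv 𝓘(ℝ, Model n m) f x (X x) * h5
  smooth {X Y Z x} hX hY hZ :=
    (((isKoszul_koszulLC g).smooth hX (N.part_smooth .hor hY) (N.part_smooth .hor hZ)).add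
      ((isKoszul_koszulLC g).smooth hX (N.part_smooth .ver hY) (N.part_smooth .ver hZ))).add
      (brInner_smooth g (N.part_smooth .hor hY) (N.part_smooth .hor hZ)
        (N.part_smooth .ver hX))

/-- The projected Levi-Civita forms give the derivative of the two blocks of the metric, and the
correction g([hY, hZ], vX) is skew in Y and Z. -/
theorem koszulHat_add_swap {X Y Z : Field n m V} {x : V} (hY : DiffAt n m (Model n m) Y x)
    (hZ : DiffAt n m (Model n m) Z x) :
    koszulHat g N X Y Z x + koszulHat g N X Z Y x = 2 * dInner g X Y Z x := by
  have h1 := koszulLC_add_swap (g := g) X (N.part .hor Y) (N.part .hor Z) x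
  have h2 := koszulLC_add_swap (g := g) X (N.part .ver Y) (N.part .ver Z) x
  have h3 := brInner_swap g (X := N.part .hor Y) (Y := N.part .hor Z) (Z := N.part .ver X) (x := x)
  have h4 : dInner g X Y Z x = dInner g X (N.part .hor Y) (N.part .hor Z) x
      + dInner g X (N.part .ver Y) (N.part .ver Z) x := by
    have h : (fun y => g.inner y (Y y) (Z y)) =
        (fun y => g.inner y (N.part .hor Y y) (N.part .hor Z y)) +
          fun y => g.inner y (N.part .ver Y y) (N.part .ver Z y) :=
      funext fun y => inner_parts hg y _ _
    rw [dInner, h, mvfderiv_add (metric_diff g (N.part_diff .hor hY) (N.part_diff .hor hZ))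
      (metric_diff g (N.part_diff .ver hY) (N.part_diff .ver hZ))]
    rfl
  simp only [koszulHat]
  linear_combination h1 + h2 + h3 - 2 * h4

/-- κ(W, vY, Z) and κ(W, Y, vZ) both reduce to the Levi-Civita form at (W, vY, vZ). Since N is
self-adjoint, their equality says that D commutes with N. -/
theorem Conn.HasKoszul.isDConnection {D : Conn n m V} (hD : D.HasKoszul g (koszulHat g N)) :
    D.IsDConnection N := by
  intro Y x hY w
  refine metric_ext g fun z => ?_
  have hw := diffAt_extend w
  have hz := diffAt_extend z
  set W := FiberBundle.extend (Model n m) w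
  set Z := FiberBundle.extend (Model n m) z
  have h1 := hD W (N.part .ver Y) Z x hw (N.part_diff .ver hY) hz
  have h2 := hD W Y (N.part .ver Z) x hw hY (N.part_diff .ver hz)
  have e1 : ∀ A : Field n m V, N.part .hor (N.part .ver A) = 0 := fun A =>
    funext fun y => by simp [NConnection.part, NConnection.toPart, N.idem]
  have e2 : ∀ A : Field n m V, N.part .ver (N.part .ver A) = N.part .ver A := fun A =>
    funext fun y => N.idem _ _
  -- The terms with a zero entry vanish by homogeneity: the scalar rules are applied with the factor
  -- f = 0.
  have h0 : FnDiffAt n m (0 : V → ℝ) x := mdifferentiableAt_const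
  have h3 := ((isKoszul_koszulLC g).tensorial_right hw (N.part_diff .hor hY)).smul h0 hz
  have h4 := (isKoszul_koszulLC g).leibniz (f := 0) hw hY h0 (N.part_diff .hor hz)
  have h5 := brInner_smul_left g (f := 0) (Y := N.part .hor Z) (Z := N.part .ver W) h0 hY
  have h6 := brInner_smul_mid g (f := 0) (X := N.part .hor Y) (Z := N.part .ver W) h0 hz
  have h7 : mvfderiv 𝓘(ℝ, Model n m) (0 : V → ℝ) x = 0 := mvfderiv_zero
  simp only [h7, Pi.zero_apply, zero_mul, zero_smul, mul_zero, zero_apply, add_zero, sub_zero]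
    at h3 h4 h5 h6
  have h8 : 2 * g.inner x (D (N.part .ver Y) x (W x)) (Z x) =
      2 * g.inner x (D Y x (W x)) (N.part .ver Z x) := by
    rw [h1, h2]
    simp only [koszulHat, e1, e2]
    linear_combination h4 + h5 - h3 - h6
  simp only [W, Z, FiberBundle.extend_apply_self, NConnection.part] at h8
  rw [inner_proj hg]
  exact mul_left_cancel₀ two_ne_zero h8

end

/-- The Gram matrix of a linearly independent family is invertible. -/
theorem isUnit_gram {W : Type*} [AddCommGroup W] [Module ℝ W] (B : W →ₗ[ℝ] W →ₗ[ℝ] ℝ)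
    (hB : ∀ v, v ≠ 0 → 0 < B v v) {ι : Type*} [Fintype ι] [DecidableEq ι] {v : ι → W}
    (hv : LinearIndependent ℝ v) : IsUnit (Matrix.of fun i j => B (v i) (v j)).det := by
  rw [← Matrix.isUnit_iff_isUnit_det, ← Matrix.mulVec_injective_iff_isUnit]
  rw [← Matrix.coe_mulVecLin, ← LinearMap.ker_eq_bot, LinearMap.ker_eq_bot']
  intro a ha
  have h1 : ∀ i, B (v i) (∑ j, a j • v j) = 0 := by
    intro i
    have := congrFun ha i
    simpa [Matrix.mulVec, dotProduct, mul_comm] using this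
  have h2 : B (∑ j, a j • v j) (∑ j, a j • v j) = 0 := by
    have h3 := map_sum (B.flip (∑ j, a j • v j)) (fun i => a i • v i) Finset.univ
    refine h3.trans (Finset.sum_eq_zero fun i _ => ?_)
    rw [map_smul]
    simp only [LinearMap.flip_apply, h1, smul_zero]
  have h3 : ∑ j, a j • v j = 0 := by
    by_contra h
    exact (hB _ h).ne' h2
  exact funext (Fintype.linearIndependent_iff.1 hv a h3)

/-! ### Brackets of N-adapted frames and the coefficients of the canonical d-connection -/

section

variable {n m : ℕ} {V : Type*} [TopologicalSpace V] [ChartedSpace (Model n m) V]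
  [IsManifold 𝓘(ℝ, Model n m) ∞ V]

theorem mvfderiv_congr {W : Type*} [NormedAddCommGroup W] [NormedSpace ℝ W] {f f' : V → W} {x : V}
    (h : ∀ᶠ y in 𝓝 x, f y = f' y) :
    mvfderiv 𝓘(ℝ, Model n m) f x = mvfderiv 𝓘(ℝ, Model n m) f' x := by
  have h1 := Filter.EventuallyEq.mfderiv_eq (I := 𝓘(ℝ, Model n m)) (I' := 𝓘(ℝ, W)) h
  exact h1

theorem dInner_congr (g : Metric n m V) {X X' Y Y' Z Z' : Field n m V} {x : V}
    (hX : ∀ᶠ y in 𝓝 x, X y = X' y) (hY : ∀ᶠ y in 𝓝 x, Y y = Y' y)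
    (hZ : ∀ᶠ y in 𝓝 x, Z y = Z' y) : dInner g X Y Z x = dInner g X' Y' Z' x := by
  rw [dInner, mvfderiv_congr (f' := fun y => g.inner y (Y' y) (Z' y)), hX.self_of_nhds]
  · rfl
  · filter_upwards [hY, hZ] with y h1 h2
    rw [h1, h2]

theorem brInner_congr (g : Metric n m V) {X X' Y Y' Z Z' : Field n m V} {x : V}
    (hX : ∀ᶠ y in 𝓝 x, X y = X' y) (hY : ∀ᶠ y in 𝓝 x, Y y = Y' y)
    (hZ : ∀ᶠ y in 𝓝 x, Z y = Z' y) : brInner g X Y Z x = brInner g X' Y' Z' x := by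
  rw [brInner, Filter.EventuallyEq.mlieBracket_vectorField_eq (V := X') (W := Y') hX hY,
    hZ.self_of_nhds]
  rfl

theorem koszulLC_congr (g : Metric n m V) {X X' Y Y' Z Z' : Field n m V} {x : V}
    (hX : ∀ᶠ y in 𝓝 x, X y = X' y) (hY : ∀ᶠ y in 𝓝 x, Y y = Y' y)
    (hZ : ∀ᶠ y in 𝓝 x, Z y = Z' y) : koszulLC g X Y Z x = koszulLC g X' Y' Z' x := by
  simp only [koszulLC, dInner_congr g hX hY hZ, dInner_congr g hY hX hZ, dInner_congr g hZ hX hY,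
    brInner_congr g hX hY hZ, brInner_congr g hX hZ hY, brInner_congr g hY hZ hX]

theorem koszulLC_zero (g : Metric n m V) (X : Field n m V) (x : V) : koszulLC g X 0 0 x = 0 := by
  have h1 : ∀ A B : Field n m V, dInner g A B 0 x = 0 := by
    intro A B
    have h : (fun y => g.inner y (B y) ((0 : Field n m V) y)) = (0 : V → ℝ) :=
      funext fun y => map_zero _
    rw [dInner, h, mvfderiv_zero]
    rfl
  have h2 : ∀ A B : Field n m V, brInner g A B 0 x = 0 := fun A B => map_zero _
  have h3 : brInner g 0 0 X x = 0 := by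
    rw [brInner, VectorField.mlieBracket_zero_left]
    exact congrArg (fun l => l (X x)) (map_zero (g.inner x))
  simp [koszulLC, h1, h2, h3]

/-- Koszul forms depend only on germs, so the horizontal part of Y may be replaced by Y as soon as Y
is horizontal near x. The bracket correction survives here, in contrast to the vertical case. -/
theorem koszulHat_hor {N : NConnection n m V} {g : Metric n m V} (X : Field n m V)
    {Y Z : Field n m V} {x : V} (hY : ∀ᶠ y in 𝓝 x, N.proj y (Y y) = 0)
    (hZ : ∀ᶠ y in 𝓝 x, N.proj y (Z y) = 0) :
    koszulHat g N X Y Z x = koszulLC g X Y Z x + brInner g Y Z (N.part .ver X) x := by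
  have h : ∀ {A : Field n m V}, (∀ᶠ y in 𝓝 x, N.proj y (A y) = 0) →
      (∀ᶠ y in 𝓝 x, N.part .hor A y = A y) ∧ ∀ᶠ y in 𝓝 x, N.part .ver A y = (0 : Field n m V) y :=
    fun hA => ⟨hA.mono fun y hy => by simp [NConnection.part, NConnection.toPart, hy], hA⟩
  have hX : ∀ {A : Field n m V}, ∀ᶠ y in 𝓝 x, A y = A y := Filter.Eventually.of_forall fun _ => rfl
  rw [koszulHat, koszulLC_congr g hX (h hY).1 (h hZ).1, koszulLC_congr g hX (h hY).2 (h hZ).2,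
    brInner_congr g (h hY).1 (h hZ).1 hX, koszulLC_zero, add_zero]

theorem koszulHat_ver {N : NConnection n m V} {g : Metric n m V} (X : Field n m V)
    {Y Z : Field n m V} {x : V} (hY : ∀ᶠ y in 𝓝 x, N.proj y (Y y) = Y y)
    (hZ : ∀ᶠ y in 𝓝 x, N.proj y (Z y) = Z y) :
    koszulHat g N X Y Z x = koszulLC g X Y Z x := by
  have h : ∀ {A : Field n m V}, (∀ᶠ y in 𝓝 x, N.proj y (A y) = A y) →
      (∀ᶠ y in 𝓝 x, N.part .hor A y = (0 : Field n m V) y) ∧ ∀ᶠ y in 𝓝 x, N.part .ver A y = A y :=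
    fun hA => ⟨hA.mono fun y hy => by simp [NConnection.part, NConnection.toPart, hy], hA⟩
  have hX : ∀ {A : Field n m V}, ∀ᶠ y in 𝓝 x, A y = A y := Filter.Eventually.of_forall fun _ => rfl
  rw [koszulHat, koszulLC_congr g hX (h hY).1 (h hZ).1, koszulLC_congr g hX (h hY).2 (h hZ).2,
    brInner_congr g (h hY).1 (h hZ).1 hX, koszulLC_zero, zero_add]
  have : brInner g 0 0 (N.part .ver X) x = 0 := by
    rw [brInner, VectorField.mlieBracket_zero_left]
    exact congrArg (fun l => l (N.part .ver X x)) (map_zero (g.inner x))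
  rw [this, add_zero]

theorem mlieBracket_sum_smul_right {ι : Type*} (s : Finset ι) (X : Field n m V)
    {Y : ι → Field n m V} {f : ι → V → ℝ} {x : V}
    (hY : ∀ i, DiffAt n m (Model n m) (Y i) x) (hf : ∀ i, FnDiffAt n m (f i) x) :
    VectorField.mlieBracket 𝓘(ℝ, Model n m) X (fun y => ∑ i ∈ s, f i y • Y i y) x =
      ∑ i ∈ s, (mvfderiv 𝓘(ℝ, Model n m) (f i) x (X x) • Y i x +
        f i x • VectorField.mlieBracket 𝓘(ℝ, Model n m) X (Y i) x) := by
  classical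
  have : IsManifold 𝓘(ℝ, Model n m) 2 V :=
    IsManifold.of_le (n := ∞) (by simpa using ENat.LEInfty.out)
  induction s using Finset.induction_on with
  | empty =>
    simp only [Finset.sum_empty]
    exact congrFun VectorField.mlieBracket_zero_right x
  | insert i s hi ih =>
    simp only [Finset.sum_insert hi]
    rw [← ih, ← VectorField.mlieBracket_smul_right (hf i) (hY i)]
    exact VectorField.mlieBracket_add_right (W := f i • Y i) (DiffAt.smul (hf i) (hY i))
      (DiffAt.sum fun j _ => DiffAt.smul (hf j) (hY j))

namespace Coeff

variable {N : NConnection n m V} {φ : OpenPartialHomeomorph V (Model n m)} (hφ : N.IsAdapted φ)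
  {x : V} (hx : x ∈ φ.source)

include hφ hx

theorem eventually_mem_source : ∀ᶠ y in 𝓝 x, y ∈ φ.source := φ.open_source.mem_nhds hx

theorem nCoeff_smooth (k : Fin n) (a : Fin m) : FnSmoothAt n m (nCoeff N φ k a) x := by
  have h1 : SmoothAt n m (Model n m) (fun y => N.proj y (coordField φ (.inl k) y)) x :=
    N.smooth _ x (coordField_smooth hφ.1 hx _)
  have h0 : FnSmoothAt n m φ x := contMDiffAt_of_mem_maximalAtlas hφ.1 hx
  have h2 := ContMDiffAt.mfderiv_const (m := ∞) h0 (by simp)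
  have h3 := ContMDiffAt.clm_apply_of_inCoordinates h2 h1 h0
  have h4 := ((contMDiff_snd_tangentBundle_modelSpace (Model n m)
    𝓘(ℝ, Model n m)).contMDiffAt).comp x h3
  let L : Model n m →L[ℝ] ℝ :=
    (EuclideanSpace.proj a).comp (ContinuousLinearMap.snd ℝ _ _)
  exact (L.contMDiff.contMDiffAt).comp x h4

theorem frame_inl_eventuallyEq (k : Fin n) : ∀ᶠ y in 𝓝 x, frame N φ (.inl k) y =
    (coordField φ (.inl k) + fun y => ∑ a, (- nCoeff N φ k a) y • coordField φ (.inr a) y) y := by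
  filter_upwards [eventually_mem_source hφ hx] with y hy
  have h := proj_coordField hφ hy k
  simp only [frame, h, Pi.add_apply, Pi.neg_apply, neg_smul, Finset.sum_neg_distrib,
    sub_eq_add_neg]

theorem mlieBracket_inr_inr (a b : Fin m) :
    VectorField.mlieBracket 𝓘(ℝ, Model n m) (frame N φ (.inr a)) (frame N φ (.inr b)) x = 0 :=
  mlieBracket_coordField hφ.1 hx _ _

/-- Expansion of e_k = ∂_k − N_kᵃ ∂_a in the second argument. Since coordinate fields commute, the
remaining brackets of the adapted frame reduce to derivatives of the N_kᵃ. -/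
theorem mlieBracket_inl (X : Field n m V) (k : Fin n) :
    VectorField.mlieBracket 𝓘(ℝ, Model n m) X (frame N φ (.inl k)) x =
      VectorField.mlieBracket 𝓘(ℝ, Model n m) X (coordField φ (.inl k)) x +
      ∑ a, (- mvfderiv 𝓘(ℝ, Model n m) (nCoeff N φ k a) x (X x) • coordField φ (.inr a) x +
        - nCoeff N φ k a x •
          VectorField.mlieBracket 𝓘(ℝ, Model n m) X (coordField φ (.inr a)) x) := by
  have : IsManifold 𝓘(ℝ, Model n m) 2 V :=
    IsManifold.of_le (n := ∞) (by simpa using ENat.LEInfty.out)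
  have hc : ∀ α, DiffAt n m (Model n m) (coordField φ α) x := fun α =>
    (coordField_smooth hφ.1 hx α).diffAt
  have hn : ∀ a, FnDiffAt n m (- nCoeff N φ k a) x := fun a =>
    FnSmoothAt.diffAt (nCoeff_smooth hφ hx k a).neg
  rw [Filter.EventuallyEq.mlieBracket_vectorField_eq (Filter.EventuallyEq.refl _ X)
    (frame_inl_eventuallyEq hφ hx k), VectorField.mlieBracket_add_right (hc _)
    (DiffAt.sum fun a _ => DiffAt.smul (hn a) (hc _)),
    mlieBracket_sum_smul_right _ X (fun a => hc (.inr a)) hn]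
  congr 1
  refine Finset.sum_congr rfl fun a _ => ?_
  rw [mvfderiv_neg]
  rfl

theorem mlieBracket_coordField_inl (α : Fin n ⊕ Fin m) (k : Fin n) :
    VectorField.mlieBracket 𝓘(ℝ, Model n m) (coordField φ α) (frame N φ (.inl k)) x =
      ∑ a, - mvfderiv 𝓘(ℝ, Model n m) (nCoeff N φ k a) x (coordField φ α x) •
        frame N φ (.inr a) x := by
  rw [mlieBracket_inl hφ hx, mlieBracket_coordField hφ.1 hx]
  simp only [mlieBracket_coordField hφ.1 hx, smul_zero, add_zero, zero_add]
  rfl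

theorem mlieBracket_inl_inr (k : Fin n) (b : Fin m) :
    VectorField.mlieBracket 𝓘(ℝ, Model n m) (frame N φ (.inl k)) (frame N φ (.inr b)) x =
      ∑ a, along N φ (.inr b) (nCoeff N φ k a) x • frame N φ (.inr a) x := by
  rw [VectorField.mlieBracket_swap_apply]
  refine (congrArg Neg.neg (mlieBracket_coordField_inl hφ hx (.inr b) k)).trans ?_
  rw [← Finset.sum_neg_distrib]
  refine Finset.sum_congr rfl fun a _ => ?_
  rw [neg_smul, neg_neg]
  rfl

/-- The coefficients are the curvature of the N-connection. Their values are not needed: it is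
enough that the bracket is vertical, hence orthogonal to every e_i. -/
theorem exists_mlieBracket_inl_inl (j k : Fin n) : ∃ c : Fin m → ℝ,
    VectorField.mlieBracket 𝓘(ℝ, Model n m) (frame N φ (.inl j)) (frame N φ (.inl k)) x =
      ∑ a, c a • frame N φ (.inr a) x := by
  have h : N.proj x (VectorField.mlieBracket 𝓘(ℝ, Model n m) (frame N φ (.inl j))
      (frame N φ (.inl k)) x) = VectorField.mlieBracket 𝓘(ℝ, Model n m) (frame N φ (.inl j))
      (frame N φ (.inl k)) x := by
    have hv : ∀ a, N.proj x (coordField φ (.inr a) x) = coordField φ (.inr a) x := fun a =>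
      proj_frame_inr hφ hx a
    rw [mlieBracket_inl hφ hx, VectorField.mlieBracket_swap_apply,
      mlieBracket_coordField_inl hφ hx]
    simp only [VectorField.mlieBracket_swap_apply (V := frame N φ (.inl j)),
      mlieBracket_coordField_inl hφ hx, map_add, map_sum, map_neg, map_smul, hv,
      proj_frame_inr hφ hx]
  have h2 := sum_coordField hφ.1 hx (VectorField.mlieBracket 𝓘(ℝ, Model n m) (frame N φ (.inl j))
      (frame N φ (.inl k)) x)
  have h0 := (hφ.2 x hx _).1 h
  refine ⟨fun a => (chartDeriv φ x (VectorField.mlieBracket 𝓘(ℝ, Model n m) (frame N φ (.inl j))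
    (frame N φ (.inl k)) x)).2 a, h2.trans ?_⟩
  have h3 : (chartDeriv φ x (VectorField.mlieBracket 𝓘(ℝ, Model n m) (frame N φ (.inl j))
      (frame N φ (.inl k)) x)).1 = 0 := h0
  simp only [h3, PiLp.zero_apply, zero_smul, Finset.sum_const_zero, zero_add]
  rfl

theorem eventually_proj_inl (k : Fin n) : ∀ᶠ y in 𝓝 x, N.proj y (frame N φ (.inl k) y) = 0 :=
  Filter.Eventually.of_forall fun y => proj_frame_inl N φ k y

theorem eventually_proj_inr (a : Fin m) :
    ∀ᶠ y in 𝓝 x, N.proj y (frame N φ (.inr a) y) = frame N φ (.inr a) y :=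
  (eventually_mem_source hφ hx).mono fun _ hy => proj_frame_inr hφ hy a

variable {g : Metric n m V} (hg : N.IsDMetric g)

include hg

theorem inner_inl_inr (i : Fin n) (a : Fin m) :
    g.inner x (frame N φ (.inl i) x) (frame N φ (.inr a) x) = 0 :=
  hg x _ _ (proj_frame_inl N φ i x) (proj_frame_inr hφ hx a)

theorem inner_inr_inl (i : Fin n) (a : Fin m) :
    g.inner x (frame N φ (.inr a) x) (frame N φ (.inl i) x) = 0 :=
  (g.symm x _ _).trans (inner_inl_inr hφ hx hg i a)

theorem dInner_inl_inr (X : Field n m V) (i : Fin n) (a : Fin m) :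
    dInner g X (frame N φ (.inl i)) (frame N φ (.inr a)) x = 0 := by
  rw [dInner, mvfderiv_congr (f' := (0 : V → ℝ)), mvfderiv_zero]
  · rfl
  · filter_upwards [eventually_mem_source hφ hx] with y hy
    exact inner_inl_inr hφ hy hg i a

theorem brInner_inl_inr_inl (j k : Fin n) (a : Fin m) :
    brInner g (frame N φ (.inl j)) (frame N φ (.inr a)) (frame N φ (.inl k)) x = 0 := by
  rw [brInner, mlieBracket_inl_inr hφ hx, g.symm, map_sum]
  simp [inner_inl_inr hφ hx hg]

theorem brInner_inl_inl_inl (i j k : Fin n) :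
    brInner g (frame N φ (.inl i)) (frame N φ (.inl j)) (frame N φ (.inl k)) x = 0 := by
  obtain ⟨c, hc⟩ := exists_mlieBracket_inl_inl hφ hx i j
  rw [brInner, hc, g.symm, map_sum]
  simp [inner_inl_inr hφ hx hg]

theorem brInner_inr_inr (a b : Fin m) (Z : Field n m V) :
    brInner g (frame N φ (.inr a)) (frame N φ (.inr b)) Z x = 0 := by
  rw [brInner, mlieBracket_inr_inr hφ hx]
  exact congrArg (fun l => l (Z x)) (map_zero (g.inner x))

theorem brInner_inl_inr_inr (k : Fin n) (b c : Fin m) :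
    brInner g (frame N φ (.inl k)) (frame N φ (.inr b)) (frame N φ (.inr c)) x =
      ∑ d, vMet N g φ d c x * along N φ (.inr b) (nCoeff N φ k d) x := by
  rw [brInner, mlieBracket_inl_inr hφ hx, g.symm, map_sum]
  refine Finset.sum_congr rfl fun d _ => ?_
  rw [map_smul, g.symm, mul_comm]
  rfl

/-- Lowering an index undoes raising it, because the Gram matrix of the independent horizontal frame
is invertible. -/
theorem hInv_mul (T : Fin n → ℝ) (r : Fin n) :
    ∑ i, (∑ s, hInv N g φ i s x * T s) * hMet N g φ i r x = T r := by
  set G : Matrix (Fin n) (Fin n) ℝ := Matrix.of fun i j => hMet N g φ i j x with hG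
  have hu : IsUnit G.det := isUnit_gram (bilin g x) (fun v hv => g.pos x v hv)
    (frame_linearIndependent_inl hφ hx)
  have h1 : G * G⁻¹ = 1 := Matrix.mul_nonsing_inv G hu
  have h2 : ∀ i, hMet N g φ i r x = G r i := fun i => g.symm x _ _
  have h3 : G.mulVec (G⁻¹.mulVec T) r = T r := by
    rw [Matrix.mulVec_mulVec, h1, Matrix.one_mulVec]
  rw [← h3]
  simp only [Matrix.mulVec, dotProduct, h2]
  exact Finset.sum_congr rfl fun i _ => mul_comm _ _

theorem vInv_mul (T : Fin m → ℝ) (r : Fin m) :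
    ∑ i, (∑ s, vInv N g φ i s x * T s) * vMet N g φ i r x = T r := by
  set G : Matrix (Fin m) (Fin m) ℝ := Matrix.of fun i j => vMet N g φ i j x with hG
  have hu : IsUnit G.det := isUnit_gram (bilin g x) (fun v hv => g.pos x v hv)
    (frame_linearIndependent_inr hφ hx)
  have h1 : G * G⁻¹ = 1 := Matrix.mul_nonsing_inv G hu
  have h2 : ∀ i, vMet N g φ i r x = G r i := fun i => g.symm x _ _
  have h3 : G.mulVec (G⁻¹.mulVec T) r = T r := by
    rw [Matrix.mulVec_mulVec, h1, Matrix.one_mulVec]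
  rw [← h3]
  simp only [Matrix.mulVec, dotProduct, h2]
  exact Finset.sum_congr rfl fun i _ => mul_comm _ _

omit hg in
theorem frame_inner_ext {u w : TangentSpace 𝓘(ℝ, Model n m) x}
    (h : ∀ α, g.inner x u (frame N φ α x) = g.inner x w (frame N φ α x)) : u = w := by
  refine metric_ext g fun z => ?_
  have hz : z ∈ Submodule.span ℝ (Set.range fun α => frame N φ α x) := by
    rw [frame_span hφ hx]
    trivial
  induction hz using Submodule.span_induction with
  | mem z hz => obtain ⟨α, rfl⟩ := hz; exact h α
  | zero => simp
  | add z z' _ _ h h' => simp [h, h']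
  | smul a z _ h => simp [h]

/-- A horizontal vector is determined by its inner products with the e_r, the products with the e_b
being zero on both sides. The shape of `ha` is that of the coefficients Lⁱ_{jk} and Cⁱ_{jc}. -/
theorem eq_sum_inl {u : TangentSpace 𝓘(ℝ, Model n m) x} {a T : Fin n → ℝ} (hu : N.proj x u = 0)
    (hT : ∀ r, 2 * g.inner x u (frame N φ (.inl r) x) = T r)
    (ha : ∀ i, a i = (1 / 2) * ∑ s, hInv N g φ i s x * T s) :
    u = ∑ i, a i • frame N φ (.inl i) x := by
  refine frame_inner_ext (g := g) hφ hx fun α => ?_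
  cases α with
  | inl r =>
    have h1 := hInv_mul hφ hx hg T r
    have h2 : g.inner x (∑ i, a i • frame N φ (.inl i) x) (frame N φ (.inl r) x) =
        ∑ i, a i * hMet N g φ i r x := by
      rw [g.symm, map_sum]
      refine Finset.sum_congr rfl fun i _ => ?_
      rw [map_smul, g.symm]
      rfl
    rw [h2]
    simp only [ha, mul_assoc (1 / 2 : ℝ), ← Finset.mul_sum]
    rw [h1, ← hT]
    ring
  | inr b =>
    have h1 : g.inner x u (frame N φ (.inr b) x) = 0 := hg x _ _ hu (proj_frame_inr hφ hx b)
    rw [h1, g.symm, map_sum]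
    simp [inner_inr_inl hφ hx hg]

/-- The condition on the coefficients is stated with a lowered index, because Lᵃ_{bk} contains the
term e_b N_kᵃ outside the contraction with h^{ac}. -/
theorem eq_sum_inr {u : TangentSpace 𝓘(ℝ, Model n m) x} {a T : Fin m → ℝ} (hu : N.proj x u = u)
    (hT : ∀ r, 2 * g.inner x u (frame N φ (.inr r) x) = T r)
    (ha : ∀ r, 2 * ∑ i, a i * vMet N g φ i r x = T r) :
    u = ∑ i, a i • frame N φ (.inr i) x := by
  refine frame_inner_ext (g := g) hφ hx fun α => ?_
  cases α with
  | inr r =>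
    have h2 : g.inner x (∑ i, a i • frame N φ (.inr i) x) (frame N φ (.inr r) x) =
        ∑ i, a i * vMet N g φ i r x := by
      rw [g.symm, map_sum]
      refine Finset.sum_congr rfl fun i _ => ?_
      rw [map_smul, g.symm]
      rfl
    rw [h2]
    have h3 := hT r
    rw [← ha r] at h3
    exact mul_left_cancel₀ two_ne_zero h3
  | inl b =>
    have h1 : g.inner x u (frame N φ (.inl b) x) = 0 :=
      (g.symm x _ _).trans (hg x _ _ (proj_frame_inl N φ b x) hu)
    rw [h1, g.symm, map_sum]
    simp [inner_inl_inr hφ hx hg]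

end Coeff

open Coeff

variable {N : NConnection n m V} {g : Metric n m V}

/-- As D preserves the splitting, each D e_α is horizontal or vertical along with e_α, so it
suffices to evaluate κ on three frame fields. Orthogonality and the frame brackets remove most of
the terms. -/
theorem Conn.HasKoszul.isCanonical {D : Conn n m V} (hg : N.IsDMetric g)
    (hD : D.HasKoszul g (koszulHat g N)) : D.IsCanonical N g := by
  have hproj := hD.isDConnection hg
  have hfd : ∀ {φ : OpenPartialHomeomorph V (Model n m)} (_ : N.IsAdapted φ) {x : V}
      (_ : x ∈ φ.source) (α), DiffAt n m (Model n m) (frame N φ α) x :=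
    fun hφ x hx α => (frame_smooth hφ hx α).diffAt
  have hhor : ∀ {φ : OpenPartialHomeomorph V (Model n m)} (_ : N.IsAdapted φ) {x : V}
      (_ : x ∈ φ.source) (j : Fin n) (w : TangentSpace 𝓘(ℝ, Model n m) x),
      N.proj x (D (frame N φ (.inl j)) x w) = 0 := by
    intro φ hφ x hx j w
    rw [← hproj _ x (hfd hφ hx _) w]
    have h : (fun y => N.proj y (frame N φ (.inl j) y)) = 0 :=
      funext fun y => proj_frame_inl N φ j y
    rw [h, D.zero]
    rfl
  -- N e_b = e_b is known only on the source of the chart, so locality of D is used; N e_j = 0 holds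
  -- everywhere by definition of the frame.
  have hver : ∀ {φ : OpenPartialHomeomorph V (Model n m)} (_ : N.IsAdapted φ) {x : V}
      (_ : x ∈ φ.source) (b : Fin m) (w : TangentSpace 𝓘(ℝ, Model n m) x),
      N.proj x (D (frame N φ (.inr b)) x w) = D (frame N φ (.inr b)) x w := by
    intro φ hφ x hx b w
    rw [← hproj _ x (hfd hφ hx _) w]
    exact congrArg (fun l => l w) (D.isCovariantDerivativeOn.congr_of_eventuallyEq
      (N.toPart_diff .ver (hfd hφ hx _)) (hfd hφ hx _) Filter.univ_mem
      (eventually_proj_inr hφ hx b))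
  have s1 := fun (X Y Z : Field n m V) (x : V) => dInner_symm g (X := X) (Y := Y) (Z := Z) (x := x)
  constructor
  · intro φ hφ x hx j k
    refine eq_sum_inl hφ hx hg (hhor hφ hx j _) (fun r => ?_) (fun i => rfl)
    rw [hD _ _ _ x (hfd hφ hx _) (hfd hφ hx _) (hfd hφ hx _),
      koszulHat_hor _ (eventually_proj_inl hφ hx _) (eventually_proj_inl hφ hx _)]
    have h0 : N.part .ver (frame N φ (.inl k)) x = 0 := proj_frame_inl N φ k x
    have h1 : brInner g (frame N φ (.inl j)) (frame N φ (.inl r))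
        (N.part .ver (frame N φ (.inl k))) x = 0 := by
      rw [brInner, h0, map_zero]
    simp only [koszulLC, h1, brInner_inl_inl_inl hφ hx hg, add_zero, sub_zero]
    rw [s1 (frame N φ (.inl r))]
    rfl
  · intro φ hφ x hx b k
    refine eq_sum_inr hφ hx hg (hver hφ hx b _) (fun r => hD _ _ _ x (hfd hφ hx _) (hfd hφ hx _)
      (hfd hφ hx _)) (fun r => ?_)
    rw [koszulHat_ver _ (eventually_proj_inr hφ hx _) (eventually_proj_inr hφ hx _)]
    simp only [koszulLC, dInner_inl_inr hφ hx hg, brInner_inr_inr hφ hx hg, add_zero, sub_zero,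
      brInner_inl_inr_inr hφ hx hg, Lv, add_mul, Finset.sum_add_distrib, mul_assoc (1 / 2 : ℝ),
      ← Finset.mul_sum]
    rw [vInv_mul hφ hx hg]
    have h1 : ∀ i, vMet N g φ i r x * along N φ (.inr b) (nCoeff N φ k i) x =
        along N φ (.inr b) (nCoeff N φ k i) x * vMet N g φ i r x := fun i => mul_comm _ _
    simp only [h1]
    change _ = along N φ (.inl k) (vMet N g φ b r) x + _ - _
    ring
  · intro φ hφ x hx j c
    refine eq_sum_inl hφ hx hg (hhor hφ hx j _) (fun r => ?_) (fun i => rfl)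
    rw [hD _ _ _ x (hfd hφ hx _) (hfd hφ hx _) (hfd hφ hx _),
      koszulHat_hor _ (eventually_proj_inl hφ hx _) (eventually_proj_inl hφ hx _)]
    have h0 : N.part .ver (frame N φ (.inr c)) x = frame N φ (.inr c) x := proj_frame_inr hφ hx c
    -- This correction cancels −g([e_j, e_r], e_c) in the Levi-Civita form and leaves e_c g_{jr}, as
    -- the coefficient Cⁱ_{jc} requires.
    have h1 : brInner g (frame N φ (.inl j)) (frame N φ (.inl r))
        (N.part .ver (frame N φ (.inr c))) x =
        brInner g (frame N φ (.inl j)) (frame N φ (.inl r)) (frame N φ (.inr c)) x := by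
      rw [brInner, brInner, h0]
    simp only [koszulLC, h1, s1 _ (frame N φ (.inr c)), dInner_inl_inr hφ hx hg,
      brInner_swap g (X := frame N φ (.inr c)), brInner_inl_inr_inl hφ hx hg]
    change along N φ (.inr c) (hMet N g φ j r) x + _ - _ + _ - _ - _ + _ = _
    ring
  · intro φ hφ x hx b c
    refine eq_sum_inr hφ hx hg (hver hφ hx b _) (fun r => hD _ _ _ x (hfd hφ hx _) (hfd hφ hx _)
      (hfd hφ hx _)) (fun r => ?_)
    rw [koszulHat_ver _ (eventually_proj_inr hφ hx _) (eventually_proj_inr hφ hx _)]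
    simp only [koszulLC, brInner_inr_inr hφ hx hg, add_zero, sub_zero, Cv, mul_assoc (1 / 2 : ℝ),
      ← Finset.mul_sum]
    rw [vInv_mul hφ hx hg, s1 (frame N φ (.inr r))]
    change _ = along N φ (.inr c) (vMet N g φ b r) x + along N φ (.inr b) (vMet N g φ c r) x -
      along N φ (.inr r) (vMet N g φ b c) x
    ring

theorem difference_apply (D D' : Conn n m V) {Y : Field n m V} {x : V}
    (hY : DiffAt n m (Model n m) Y x) : D.difference D' x (Y x) = D Y x - D' Y x :=
  IsCovariantDerivativeOn.difference_apply D.isCovariantDerivativeOnUniv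
    D'.isCovariantDerivativeOnUniv (Set.mem_univ x) hY

/-- The difference of two connections is a tensor, so it suffices that it vanishes on the N-adapted
frame of one adapted chart around each point. -/
theorem Conn.IsCanonical.agree {D D' : Conn n m V} (h : D.IsCanonical N g)
    (h' : D'.IsCanonical N g) : D.Agree D' := by
  intro Y x hY
  obtain ⟨φ, hφ, hx, hv⟩ := N.fibred x
  have hA : N.IsAdapted φ := ⟨hφ, hv⟩
  rw [eq_comm, ← sub_eq_zero, ← difference_apply D D' hY]
  have key : ∀ α, D.difference D' x (frame N φ α x) = 0 := by
    intro α
    rw [difference_apply D D' (frame_smooth hA hx α).diffAt, sub_eq_zero]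
    ext w
    have hw : w ∈ Submodule.span ℝ (Set.range fun α => frame N φ α x) := by
      rw [frame_span hA hx]
      trivial
    induction hw using Submodule.span_induction with
    | mem w hw =>
      obtain ⟨β, rfl⟩ := hw
      rcases α with j | b <;> rcases β with k | c
      · exact (h.hh φ hA x hx j k).trans (h'.hh φ hA x hx j k).symm
      · exact (h.vh φ hA x hx j c).trans (h'.vh φ hA x hx j c).symm
      · exact (h.hv φ hA x hx b k).trans (h'.hv φ hA x hx b k).symm
      · exact (h.vv φ hA x hx b c).trans (h'.vv φ hA x hx b c).symm
    | zero => simp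
    | add z z' _ _ h h' => rw [map_add, map_add, h, h']
    | smul a z _ h => rw [map_smul, map_smul, h]
  generalize Y x = w
  have hw : w ∈ Submodule.span ℝ (Set.range fun α => frame N φ α x) := by
    rw [frame_span hA hx]
    trivial
  induction hw using Submodule.span_induction with
  | mem w hw => obtain ⟨β, rfl⟩ := hw; exact key β
  | zero => simp
  | add z z' _ _ h h' => rw [map_add, h, h', add_zero]
  | smul a z _ h => rw [map_smul, h, smul_zero]

end

/-! ### Products of anticommuting involutions -/

section

variable {R ι : Type*} [Ring R] {γ : ι → R} (h1 : ∀ α, γ α * γ α = 1)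
  (h2 : ∀ α β, α ≠ β → γ α * γ β = - (γ β * γ α))

include h2 in
theorem mul_prod_of_notMem (β : ι) (l : List ι) (hl : β ∉ l) :
    γ β * (l.map γ).prod = (-1) ^ l.length * ((l.map γ).prod * γ β) := by
  induction l with
  | nil => simp
  | cons a t ih =>
    rw [List.mem_cons, not_or] at hl
    have h3 := ih hl.2
    have h4 : ∀ k : ℕ, γ a * (-1 : R) ^ k = (-1) ^ k * γ a := fun k =>
      (((Commute.neg_one_right (γ a)).pow_right k)).eq
    simp only [List.map_cons, List.prod_cons, List.length_cons]
    rw [← mul_assoc, h2 β a hl.1, neg_mul, mul_assoc, h3, ← mul_assoc, h4, pow_succ]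
    noncomm_ring

include h1 h2 in
-- γ_β anticommutes with every factor except the single one equal to itself, which costs one sign
-- less than for β outside the list.
theorem mul_prod_of_mem (β : ι) (l : List ι) (hl : β ∈ l) (hn : l.Nodup) :
    γ β * (l.map γ).prod = - ((-1) ^ l.length * ((l.map γ).prod * γ β)) := by
  induction l with
  | nil => simp at hl
  | cons a t ih =>
    rw [List.nodup_cons] at hn
    have h4 : ∀ k : ℕ, γ a * (-1 : R) ^ k = (-1) ^ k * γ a := fun k =>
      (((Commute.neg_one_right (γ a)).pow_right k)).eq
    simp only [List.map_cons, List.prod_cons, List.length_cons]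
    by_cases hb : β = a
    · subst hb
      have h6 : (-1 : R) ^ t.length * (-1) ^ t.length = 1 := by
        rw [← pow_add, ← two_mul, pow_mul]; simp
      rw [← mul_assoc, h1, one_mul, mul_prod_of_notMem h2 β t hn.1, mul_assoc _ _ (γ β),
        mul_assoc _ (γ β) (γ β), h1, mul_one, pow_succ, mul_neg_one, neg_mul, neg_neg, ← mul_assoc,
        h6, one_mul]
    · have hm : β ∈ t := by simpa [hb] using hl
      rw [← mul_assoc, h2 β a hb, neg_mul, mul_assoc, ih hm hn.2, mul_neg, ← mul_assoc (γ a) _ _,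
        h4, pow_succ]
      noncomm_ring

include h1 in
theorem prod_mul_prod_reverse (l : List ι) : (l.map γ).prod * (l.reverse.map γ).prod = 1 := by
  induction l with
  | nil => simp
  | cons a t ih =>
    simp only [List.map_cons, List.prod_cons, List.reverse_cons, List.map_append,
      List.prod_append, List.map_nil, List.prod_nil, mul_one]
    rw [mul_assoc, ← mul_assoc _ _ (γ a), ih, one_mul, h1]

/-- The factors are taken in pairs. The two parities are proved together: removing the head of the
list turns each statement into the other. -/
theorem commute_prod_of_even {A : R} (hA : ∀ α β, Commute A (γ α * γ β)) (l : List ι) :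
    (Even l.length → Commute A (l.map γ).prod) ∧
      ∀ a, Odd l.length → Commute A (γ a * (l.map γ).prod) := by
  induction l with
  | nil => simp
  | cons a t ih =>
    simp only [List.map_cons, List.prod_cons, List.length_cons]
    refine ⟨fun h => ih.2 a (by grind), fun b h => ?_⟩
    rw [← mul_assoc]
    exact (hA b a).mul_right (ih.1 (by grind))

end

section

variable {n m : ℕ} {V : Type*} [TopologicalSpace V] [ChartedSpace (Model n m) V]
  [IsManifold 𝓘(ℝ, Model n m) ∞ V] {N : NConnection n m V} {g : Metric n m V}

/-- `P` is self-adjoint for a d-metric. -/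
theorem inner_toPart (hg : N.IsDMetric g) (p : Part) (x : V)
    (u w : TangentSpace 𝓘(ℝ, Model n m) x) :
    g.inner x (N.toPart p x u) w = g.inner x u (N.toPart p x w) := by
  cases p
  · rfl
  · simp [NConnection.toPart, inner_proj hg]
  · exact inner_proj hg x u w

/-! ### Orthonormal frames of `TV`, `hV`, `vV` at a point -/

variable (N g) in
/-- An orthonormal basis of the fibre at `x` of `TV`, `hV` or `vV`. -/
structure IsOrthoBasis (p : Part) (x : V) {ι : Type*} [Fintype ι] [DecidableEq ι]
    (e : ι → TangentSpace 𝓘(ℝ, Model n m) x) : Prop where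
  ortho (i j : ι) : g.inner x (e i) (e j) = if i = j then 1 else 0
  span : Submodule.span ℝ (Set.range e) = N.sub p x

namespace IsOrthoBasis

variable {p : Part} {x : V} {ι : Type*} [Fintype ι] [DecidableEq ι]
  {e : ι → TangentSpace 𝓘(ℝ, Model n m) x} (he : IsOrthoBasis N g p x e)

include he

theorem mem (i : ι) : e i ∈ N.sub p x := he.span ▸ Submodule.subset_span ⟨i, rfl⟩

theorem toPart_eq (i : ι) : N.toPart p x (e i) = e i := (N.mem_sub_iff p x _).1 (he.mem i)

theorem expand {u : TangentSpace 𝓘(ℝ, Model n m) x} (hu : u ∈ N.sub p x) :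
    u = ∑ i, g.inner x (e i) u • e i :=
  sum_smul_of_mem_span (bilin g x) he.ortho (he.span ▸ hu)

theorem toPart_expand (hg : N.IsDMetric g) (u : TangentSpace 𝓘(ℝ, Model n m) x) :
    N.toPart p x u = ∑ i, g.inner x (e i) u • e i := by
  refine (he.expand ((N.mem_sub_iff p x _).2 (N.toPart_idem p x u))).trans ?_
  simp only [← inner_toPart hg, he.toPart_eq]

theorem finrank_eq : Module.finrank ℝ (N.sub p x) = Fintype.card ι := by
  rw [← he.span]
  exact finrank_span_eq_card (linearIndependent_of_orthonormal (bilin g x) he.ortho)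

end IsOrthoBasis

/-- A contraction is a sum over an orthonormal family. -/
theorem contraction_eq_sum {W : Type*} [AddCommGroup W] [Module ℝ W] (q : Part) (x : V)
    {B : N.sub q x → N.sub q x → W} (L : N.sub q x →ₗ[ℝ] N.sub q x →ₗ[ℝ] W)
    (hL : ∀ u w, B u w = L u w) {ι : Type*} [Fintype ι] (b : ι → N.sub q x)
    (hb : ∀ u : N.sub q x, u = ∑ i, g.inner x (b i : _) (u : _) • b i) :
    contraction N g q x B = ∑ i, B (b i) (b i) := by
  set f := Module.finBasis ℝ (N.sub q x) with hf
  set B' : N.sub q x →ₗ[ℝ] N.sub q x →ₗ[ℝ] ℝ :=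
    (bilin g x).compl₁₂ (N.sub q x).subtype (N.sub q x).subtype with hB'
  have hB'' : ∀ u w : N.sub q x, g.inner x (u : _) (w : _) = B' u w := fun _ _ => rfl
  set G : Matrix _ _ ℝ := Matrix.of fun k l => g.inner x (f k : _) (f l : _) with hG
  have hu : IsUnit G.det := by
    refine isUnit_gram B' (fun v hv => g.pos x v ?_) f.linearIndependent
    simpa using hv
  have h1 : G⁻¹ * G = 1 := Matrix.nonsing_inv_mul G hu
  have hGs : ∀ k l, G k l = G l k := fun k l => g.symm x _ _
  -- Raising the index of the covector g(·, u) recovers u. In the contraction, f_l is expanded over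
  -- b in the second slot; this identity for u = b_i then collapses the first slot.
  have hinv : ∀ u : N.sub q x, ∑ k, ∑ l, (G⁻¹ k l * g.inner x (f l : _) (u : _)) • f k = u := by
    intro u
    have h2 : (∑ k, (LinearMap.smulRight (∑ l, G⁻¹ k l • B' (f l)) (f k))) = LinearMap.id := by
      refine f.ext fun j => ?_
      have h3 : ∀ k, ∑ l, G⁻¹ k l * B' (f l) (f j) = (1 : Matrix _ _ ℝ) k j := by
        intro k
        rw [← h1, Matrix.mul_apply]
        rfl
      simp [LinearMap.sum_apply, h3, Matrix.one_apply]
    have h4 := congrArg (fun T : N.sub q x →ₗ[ℝ] N.sub q x => T u) h2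
    simpa [LinearMap.sum_apply, Finset.sum_smul, hB''] using h4
  calc contraction N g q x B = ∑ k, ∑ l, G⁻¹ k l • L (f k) (f l) := by
        simp only [contraction, hL]
        rfl
    _ = ∑ k, ∑ l, ∑ i, (G⁻¹ k l * g.inner x (f l : _) (b i : _)) • L (f k) (b i) := by
        refine Finset.sum_congr rfl fun k _ => Finset.sum_congr rfl fun l _ => ?_
        conv_lhs => rw [hb (f l)]
        simp only [map_sum, map_smul, Finset.smul_sum, smul_smul]
        exact Finset.sum_congr rfl fun i _ => by rw [g.symm]
    _ = ∑ i, L (∑ k, ∑ l, (G⁻¹ k l * g.inner x (f l : _) (b i : _)) • f k) (b i) := by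
        simp only [map_sum, map_smul, LinearMap.sum_apply, LinearMap.smul_apply]
        exact (Finset.sum_congr rfl fun k _ => Finset.sum_comm).trans Finset.sum_comm
    _ = ∑ i, B (b i) (b i) := by simp only [hinv, hL]

end

/-! ### Clifford multiplication on spinors and Schur's lemma -/

section

variable {n m : ℕ} {V : Type*} [TopologicalSpace V] [ChartedSpace (Model n m) V]
  [IsManifold 𝓘(ℝ, Model n m) ∞ V]
  {N : NConnection n m V} {g : Metric n m V} {p : Part}
  {F : Type*} [NormedAddCommGroup F] [NormedSpace ℂ F]
  {S : V → Type*} [TopologicalSpace (TotalSpace F S)]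
  [∀ x, AddCommGroup (S x)] [∀ x, Module ℂ (S x)] [∀ x, TopologicalSpace (S x)]
  [∀ x, IsTopologicalAddGroup (S x)] [∀ x, ContinuousSMul ℝ (S x)] [FiberBundle F S]

namespace SpinStructure

variable (𝒮 : SpinStructure N g p F S) (x : V)

/-- Clifford multiplication as a real-linear map. -/
def cLin : TangentSpace 𝓘(ℝ, Model n m) x →ₗ[ℝ] Module.End ℂ (S x) :=
  (𝒮.cliff x).toLinearMap.comp (clVec N g p x)

theorem c_add (u w : TangentSpace 𝓘(ℝ, Model n m) x) :
    𝒮.c x (u + w) = 𝒮.c x u + 𝒮.c x w := map_add (𝒮.cLin x) u w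

theorem c_smul (a : ℝ) (w : TangentSpace 𝓘(ℝ, Model n m) x) :
    𝒮.c x (a • w) = a • 𝒮.c x w := map_smul (𝒮.cLin x) a w

theorem c_sum {ι : Type*} (s : Finset ι) (w : ι → TangentSpace 𝓘(ℝ, Model n m) x) :
    𝒮.c x (∑ i ∈ s, w i) = ∑ i ∈ s, 𝒮.c x (w i) := map_sum (𝒮.cLin x) w s

theorem c_zero : 𝒮.c x 0 = 0 := map_zero (𝒮.cLin x)

theorem c_toPart (w : TangentSpace 𝓘(ℝ, Model n m) x) : 𝒮.c x (N.toPart p x w) = 𝒮.c x w := by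
  have : N.toSub p x (N.toPart p x w) = N.toSub p x w := Subtype.ext (N.toPart_idem p x w)
  simp [c, clVec, this]

theorem c_mul_add (u w : TangentSpace 𝓘(ℝ, Model n m) x) :
    𝒮.c x u * 𝒮.c x w + 𝒮.c x w * 𝒮.c x u =
      (2 * g.inner x (N.toPart p x u) (N.toPart p x w)) • (1 : Module.End ℂ (S x)) := by
  have h : clVec N g p x u * clVec N g p x w + clVec N g p x w * clVec N g p x u =
      algebraMap ℝ _ (2 * g.inner x (N.toPart p x u) (N.toPart p x w)) := by
    refine (CliffordAlgebra.ι_mul_ι_add_swap _ _).trans (congrArg _ ?_)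
    have hq : ∀ v : N.sub p x, quad N g p x v = g.inner x (v : _) (v : _) := fun v => rfl
    have hadd : ∀ a b : TangentSpace 𝓘(ℝ, Model n m) x, g.inner x (a + b) (a + b) =
        g.inner x a a + 2 * g.inner x a b + g.inner x b b := by
      intro a b
      simp only [map_add, add_apply, g.symm x b a]
      ring
    rw [QuadraticMap.polar, hq, hq, hq]
    have := hadd (N.toPart p x u) (N.toPart p x w)
    simp only [Submodule.coe_add, NConnection.toSub_coe, this]
    ring
  have h2 := congrArg (𝒮.cliff x) h
  rw [map_add, map_mul, map_mul, AlgHom.commutes, Algebra.algebraMap_eq_smul_one] at h2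
  exact h2

theorem c_c_add (u w : TangentSpace 𝓘(ℝ, Model n m) x) (ψ : S x) :
    𝒮.c x u (𝒮.c x w ψ) + 𝒮.c x w (𝒮.c x u ψ) =
      (2 * g.inner x (N.toPart p x u) (N.toPart p x w)) • ψ :=
  congrArg (fun T : Module.End ℂ (S x) => T ψ) (𝒮.c_mul_add x u w)

theorem herm_c (w : TangentSpace 𝓘(ℝ, Model n m) x) (φ ψ : S x) :
    𝒮.herm x (𝒮.c x w φ) ψ = 𝒮.herm x φ (𝒮.c x w ψ) := 𝒮.herm_cliff x w φ ψ

/-- A product of two vectors is even and fixed by the grading automorphism, so this holds whatever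
the parity of the rank. -/
theorem J_c_c (u w : TangentSpace 𝓘(ℝ, Model n m) x) (ψ : S x) :
    𝒮.J x (𝒮.c x u (𝒮.c x w ψ)) = 𝒮.c x u (𝒮.c x w (𝒮.J x ψ)) := by
  have h := 𝒮.J_cliff x (clVec N g p x u * clVec N g p x w) ψ
    (.inr (CliffordAlgebra.ι_mul_ι_mem_evenOdd_zero _ _ _))
  rw [map_mul, map_mul] at h
  simp only [clVec, LinearMap.comp_apply, CliffordAlgebra.involute_ι, neg_mul_neg, map_mul] at h
  exact h

theorem J_c (hp : Even (Module.finrank ℝ (N.sub p x))) (w : TangentSpace 𝓘(ℝ, Model n m) x)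
    (ψ : S x) : 𝒮.J x (𝒮.c x w ψ) = - 𝒮.c x w (𝒮.J x ψ) := by
  have h := 𝒮.J_cliff x (clVec N g p x w) ψ (.inl hp)
  simp only [clVec, LinearMap.comp_apply, CliffordAlgebra.involute_ι, map_neg] at h
  exact h

section

variable {x}

theorem commute_cliff {A : Module.End ℂ (S x)} (h : ∀ w, Commute A (𝒮.c x w)) (a : Cl N g p x) :
    Commute A (𝒮.cliff x a) := by
  induction a using CliffordAlgebra.induction with
  | algebraMap r =>
    rw [AlgHom.commutes]
    exact (Algebra.commutes r A).symm
  | ι v =>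
    have h1 := h (v : _)
    rw [c, clVec, LinearMap.comp_apply, N.toSub_self] at h1
    exact h1
  | mul a b ha hb => rw [map_mul]; exact ha.mul_right hb
  | add a b ha hb => rw [map_add]; exact ha.add_right hb

/-- Schur's lemma. -/
theorem exists_smul_of_commute [FiniteDimensional ℂ F] [VectorBundle ℂ F S]
    {A : Module.End ℂ (S x)} (h : ∀ w, Commute A (𝒮.c x w)) : ∃ a : ℂ, A = a • 1 := by
  have : FiniteDimensional ℂ (S x) := VectorBundle.finiteDimensional ℂ F S x
  have := 𝒮.nontrivial x
  obtain ⟨a, ha⟩ := Module.End.exists_eigenvalue A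
  refine ⟨a, ?_⟩
  have hinv : ∀ b : Cl N g p x, ∀ ψ ∈ A.eigenspace a, 𝒮.cliff x b ψ ∈ A.eigenspace a := by
    intro b ψ hψ
    rw [Module.End.mem_eigenspace_iff] at hψ ⊢
    have h1 := congrArg (fun T : Module.End ℂ (S x) => T ψ) (𝒮.commute_cliff h b).eq
    simp only [Module.End.mul_apply] at h1
    rw [h1, hψ, map_smul]
  rcases 𝒮.irreducible x (A.eigenspace a) hinv with h1 | h1
  · exact absurd h1 ha
  · ext ψ
    have : ψ ∈ A.eigenspace a := h1 ▸ Submodule.mem_top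
    exact Module.End.mem_eigenspace_iff.1 this

/-- In odd rank the volume element Ω = γ_1 ⋯ γ_r commutes with all vectors, so it is a scalar by
Schur's lemma, nonzero because Ω is invertible. Then γ_α Ω is both a product of an even number of
γ's and a nonzero multiple of γ_α. -/
theorem commute_of_commute_even [FiniteDimensional ℂ F] [VectorBundle ℂ F S]
    (hg : N.IsDMetric g) {r : ℕ} (hr : Odd r)
    {e : Fin r → TangentSpace 𝓘(ℝ, Model n m) x} (he : IsOrthoBasis N g p x e)
    {A : Module.End ℂ (S x)} (hA : ∀ α β, Commute A (𝒮.c x (e α) * 𝒮.c x (e β))) (α : Fin r) :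
    Commute A (𝒮.c x (e α)) := by
  have := 𝒮.nontrivial x
  set γ : Fin r → Module.End ℂ (S x) := fun α => 𝒮.c x (e α) with hγ
  have h0 : ∀ α β, γ α * γ β + γ β * γ α =
      (2 * if α = β then (1 : ℝ) else 0) • (1 : Module.End ℂ (S x)) := by
    intro α β
    rw [𝒮.c_mul_add, he.toPart_eq, he.toPart_eq, he.ortho]
  have h1 : ∀ α, γ α * γ α = 1 := by
    intro α
    have := h0 α α
    simp only [if_true, mul_one, ← two_smul ℝ (γ α * γ α)] at this
    exact smul_right_injective _ (two_ne_zero' ℝ) this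
  have h2 : ∀ α β, α ≠ β → γ α * γ β = - (γ β * γ α) := by
    intro α β hne
    have := h0 α β
    simp only [hne, if_false, mul_zero, zero_smul] at this
    exact eq_neg_of_add_eq_zero_left this
  set Ω := ((List.finRange r).map γ).prod with hΩ
  have h3 : ∀ w, Commute Ω (𝒮.c x w) := by
    intro w
    rw [← 𝒮.c_toPart, he.toPart_expand hg, c_sum]
    refine Commute.sum_right _ _ _ fun β _ => ?_
    rw [c_smul]
    refine Commute.smul_right ?_ _
    have h4 := mul_prod_of_mem h1 h2 β (List.finRange r) (List.mem_finRange β)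
      (List.nodup_finRange r)
    rw [List.length_finRange, hr.neg_one_pow, neg_mul, neg_neg, one_mul] at h4
    exact h4.symm
  obtain ⟨a, ha⟩ := 𝒮.exists_smul_of_commute h3
  have hne : a ≠ 0 := by
    rintro rfl
    have h5 := prod_mul_prod_reverse h1 (List.finRange r)
    rw [← hΩ, ha, zero_smul, zero_mul] at h5
    exact zero_ne_one h5
  have h6 := (commute_prod_of_even hA (List.finRange r)).2 α (by simpa using hr)
  have h7 : γ α * ((List.finRange r).map γ).prod = a • γ α := by
    rw [← hΩ, ha, mul_smul_comm, mul_one]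
  have h8 : Commute A (a • γ α) := h7 ▸ h6
  have h9 := h8.smul_right a⁻¹
  rwa [inv_smul_smul₀ hne] at h9

/-- A skew-Hermitian scalar is imaginary. -/
theorem conj_of_skew {a : ℂ} (h : ∀ φ ψ : S x, 𝒮.herm x (a • φ) ψ + 𝒮.herm x φ (a • ψ) = 0) :
    starRingEnd ℂ a = - a := by
  have := 𝒮.nontrivial x
  obtain ⟨ψ, hψ⟩ := exists_ne (0 : S x)
  have h1 := h ψ ψ
  rw [map_smulₛₗ, LinearMap.smul_apply, map_smul, smul_eq_mul, smul_eq_mul, ← add_mul] at h1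
  have h2 : 𝒮.herm x ψ ψ ≠ 0 := by
    intro h0
    have := 𝒮.herm_pos x ψ hψ
    rw [h0] at this
    exact lt_irrefl _ this
  exact eq_neg_of_add_eq_zero_left ((mul_eq_zero.1 h1).resolve_right h2)

/-- Schur's lemma leaves a scalar a. Skewness gives ā = −a, while commuting with the antilinear J
gives ā = a. -/
theorem eq_zero_of_commute [FiniteDimensional ℂ F] [VectorBundle ℂ F S]
    {A : Module.End ℂ (S x)} (hc : ∀ w, Commute A (𝒮.c x w))
    (hs : ∀ φ ψ : S x, 𝒮.herm x (A φ) ψ + 𝒮.herm x φ (A ψ) = 0)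
    (hJ : ∀ ψ : S x, A (𝒮.J x ψ) = 𝒮.J x (A ψ)) : A = 0 := by
  obtain ⟨a, rfl⟩ := 𝒮.exists_smul_of_commute hc
  have h1 := 𝒮.conj_of_skew hs
  have := 𝒮.nontrivial x
  obtain ⟨ψ, hψ⟩ := exists_ne (0 : S x)
  have h2 := hJ ψ
  simp only [LinearMap.smul_apply, Module.End.one_apply, map_smulₛₗ, h1] at h2
  have h3 : 𝒮.J x ψ ≠ 0 := by simpa using hψ
  have h4 : (a + a) • 𝒮.J x ψ = 0 := by
    rw [add_smul]
    nth_rewrite 1 [h2]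
    simp
  have h5 := (smul_eq_zero.1 h4).resolve_right h3
  rw [← two_mul] at h5
  rw [(mul_eq_zero.1 h5).resolve_left two_ne_zero, zero_smul]

end

/-! ### The action of endomorphisms of the tangent spaces on spinors -/

section

variable {x} (hg : N.IsDMetric g) {ι : Type*} [Fintype ι] [DecidableEq ι]
  {e : ι → TangentSpace 𝓘(ℝ, Model n m) x} (he : IsOrthoBasis N g p x e)
  (A : TangentSpace 𝓘(ℝ, Model n m) x →ₗ[ℝ] TangentSpace 𝓘(ℝ, Model n m) x)

/-- The bilinear expression `c(A u) c(w) ψ`. -/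
def liftForm (ψ : S x) : N.sub p x →ₗ[ℝ] N.sub p x →ₗ[ℝ] S x :=
  LinearMap.mk₂ ℝ (fun u w => 𝒮.c x (A u) (𝒮.c x w ψ))
    (fun u u' w => by simp [c_add]) (fun a u w => by simp [c_smul])
    (fun u w w' => by simp [c_add]) (fun a u w => by
      rw [Submodule.coe_smul, c_smul]
      exact map_smul ((𝒮.c x (A u)).restrictScalars ℝ) a _)

include he

theorem lift_eq_sum (ψ : S x) :
    𝒮.lift x A ψ = (1 / 4 : ℝ) • ∑ i, 𝒮.c x (A (e i)) (𝒮.c x (e i) ψ) := by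
  refine congrArg ((1 / 4 : ℝ) • ·) (contraction_eq_sum (g := g) p x (𝒮.liftForm A ψ)
    (fun _ _ => rfl) (fun i => (⟨e i, he.mem i⟩ : N.sub p x)) fun u => ?_)
  refine Subtype.ext ((he.expand u.2).trans ?_)
  simp

/-- The operator `¼ A^α_β γ_α γ^β`. -/
def liftEnd (e : ι → TangentSpace 𝓘(ℝ, Model n m) x) : Module.End ℂ (S x) :=
  (1 / 4 : ℝ) • ∑ i, 𝒮.c x (A (e i)) * 𝒮.c x (e i)

theorem lift_eq (ψ : S x) : 𝒮.lift x A ψ = 𝒮.liftEnd A e ψ := by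
  rw [𝒮.lift_eq_sum he, liftEnd, LinearMap.smul_apply, LinearMap.sum_apply]
  rfl

theorem lift_J (ψ : S x) : 𝒮.lift x A (𝒮.J x ψ) = 𝒮.J x (𝒮.lift x A ψ) := by
  have h : ∀ (a : ℝ) (φ : S x), 𝒮.J x (a • φ) = a • 𝒮.J x φ := fun a φ => by
    rw [← Complex.coe_smul, map_smulₛₗ, Complex.conj_ofReal, Complex.coe_smul]
  rw [𝒮.lift_eq_sum he, 𝒮.lift_eq_sum he, h, map_sum]
  simp only [J_c_c]

variable (hA : ∀ u ∈ N.sub p x, ∀ w ∈ N.sub p x, g.inner x (A u) w = - g.inner x u (A w))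

include hg hA

/-- Skewness of A gives g(e_i, A e_i) = 0, so c(A e_i) and c(e_i) anticommute. As both are
self-adjoint, their product is skew. -/
theorem lift_skew (φ ψ : S x) :
    𝒮.herm x (𝒮.lift x A φ) ψ + 𝒮.herm x φ (𝒮.lift x A ψ) = 0 := by
  have h1 : ∀ i, 𝒮.c x (e i) (𝒮.c x (A (e i)) ψ) = - 𝒮.c x (A (e i)) (𝒮.c x (e i) ψ) := by
    intro i
    refine eq_neg_of_add_eq_zero_left ?_
    have h := hA _ (he.mem i) _ (he.mem i)
    rw [g.symm] at h
    have h2 : g.inner x (e i) (A (e i)) = 0 := by linarith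
    rw [𝒮.c_c_add, ← inner_toPart hg, he.toPart_eq, he.toPart_eq, h2, mul_zero, zero_smul]
  have hr : ∀ (a : ℝ) (φ ψ : S x), 𝒮.herm x (a • φ) ψ = (a : ℂ) * 𝒮.herm x φ ψ := by
    intro a φ ψ
    rw [← Complex.coe_smul, map_smulₛₗ, Complex.conj_ofReal]
    rfl
  have hr' : ∀ (a : ℝ) (φ ψ : S x), 𝒮.herm x φ (a • ψ) = (a : ℂ) * 𝒮.herm x φ ψ := by
    intro a φ ψ
    rw [← Complex.coe_smul, map_smul]
    rfl
  rw [𝒮.lift_eq_sum he, 𝒮.lift_eq_sum he, hr, hr', map_sum, LinearMap.sum_apply, map_sum,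
    ← mul_add, ← Finset.sum_add_distrib]
  simp only [herm_c, h1, map_neg]
  simp

/-- Moving c(u) to the left past c(e_i) and then past c(A e_i) leaves two contractions, with factors
2 g(e_i, u) and −2 g(A e_i, Pu) = 2 g(e_i, A P u), where P is the projection to E. Each sums to 2
c(A P u), which accounts for the constant ¼. -/
theorem lift_c (u : TangentSpace 𝓘(ℝ, Model n m) x) (ψ : S x) :
    𝒮.lift x A (𝒮.c x u ψ) = 𝒮.c x (A (N.toPart p x u)) ψ + 𝒮.c x u (𝒮.lift x A ψ) := by
  have h1 : ∀ i, 𝒮.c x (A (e i)) (𝒮.c x (e i) (𝒮.c x u ψ)) =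
      (2 * g.inner x (e i) u) • 𝒮.c x (A (e i)) ψ
        + (2 * g.inner x (e i) (A (N.toPart p x u))) • 𝒮.c x (e i) ψ
        + 𝒮.c x u (𝒮.c x (A (e i)) (𝒮.c x (e i) ψ)) := by
    intro i
    have h2 := 𝒮.c_c_add x (e i) u ψ
    rw [inner_toPart hg, N.toPart_idem, ← inner_toPart hg, he.toPart_eq] at h2
    have h3 := 𝒮.c_c_add x (A (e i)) u (𝒮.c x (e i) ψ)
    rw [inner_toPart hg, N.toPart_idem, hA _ (he.mem i) _ ⟨u, rfl⟩] at h3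
    have h4 := congrArg (𝒮.c x (A (e i))) h2
    rw [map_add] at h4
    have h5 : 𝒮.c x (A (e i)) ((2 * g.inner x (e i) u) • ψ) =
        (2 * g.inner x (e i) u) • 𝒮.c x (A (e i)) ψ :=
      map_smul ((𝒮.c x (A (e i))).restrictScalars ℝ) _ ψ
    rw [h5] at h4
    rw [eq_sub_of_add_eq h4, eq_sub_of_add_eq h3]
    module
  have h6 : ∀ T : TangentSpace 𝓘(ℝ, Model n m) x →ₗ[ℝ] TangentSpace 𝓘(ℝ, Model n m) x,
      ∑ i, g.inner x (e i) u • 𝒮.c x (T (e i)) ψ = 𝒮.c x (T (N.toPart p x u)) ψ := by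
    intro T
    rw [he.toPart_expand hg, map_sum, c_sum, LinearMap.sum_apply]
    simp [c_smul]
  have h7 : ∑ i, g.inner x (e i) (A (N.toPart p x u)) • 𝒮.c x (e i) ψ =
      𝒮.c x (A (N.toPart p x u)) ψ := by
    rw [← 𝒮.c_toPart x (A _), he.toPart_expand hg (A _), c_sum, LinearMap.sum_apply]
    simp [c_smul]
  have h8 : 𝒮.c x u ((1 / 4 : ℝ) • ∑ i, 𝒮.c x (A (e i)) (𝒮.c x (e i) ψ)) =
      (1 / 4 : ℝ) • 𝒮.c x u (∑ i, 𝒮.c x (A (e i)) (𝒮.c x (e i) ψ)) :=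
    map_smul ((𝒮.c x u).restrictScalars ℝ) _ _
  rw [𝒮.lift_eq_sum he, 𝒮.lift_eq_sum he, h8, map_sum]
  simp only [h1, Finset.sum_add_distrib, mul_smul, ← Finset.smul_sum]
  rw [h6 A, h7]
  module

end

end SpinStructure

end

/-! ### Complex scalars and real smoothness -/

section

variable {n m : ℕ} {V : Type*} [TopologicalSpace V] [ChartedSpace (Model n m) V]
  [IsManifold 𝓘(ℝ, Model n m) ∞ V]
  {F : Type*} [NormedAddCommGroup F] [NormedSpace ℂ F] [FiniteDimensional ℂ F]
  {S : V → Type*} [TopologicalSpace (TotalSpace F S)]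
  [∀ x, AddCommGroup (S x)] [∀ x, Module ℂ (S x)] [∀ x, TopologicalSpace (S x)]
  [∀ x, IsTopologicalAddGroup (S x)] [∀ x, ContinuousSMul ℝ (S x)]
  [FiberBundle F S] [VectorBundle ℂ F S] [VectorBundle ℝ F S]
  [ContMDiffVectorBundle ∞ F S 𝓘(ℝ, Model n m)]

/-- Smoothness refers to the real structure, but the trivialisations are complex linear, so i acts
in them as a constant linear map. -/
theorem SmoothAt.smul_I {ψ : Π x : V, S x} {x : V} (h : SmoothAt n m F ψ x) :
    SmoothAt n m F (fun y => Complex.I • ψ y) x := by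
  rw [SmoothAt, Bundle.contMDiffAt_section] at h ⊢
  have h1 : ContMDiffAt 𝓘(ℝ, Model n m) 𝓘(ℝ, F) ∞
      (fun y => Complex.I • (trivializationAt F S x (TotalSpace.mk' F y (ψ y))).2) x :=
    ((Complex.I • ContinuousLinearMap.id ℝ F).contMDiff.contMDiffAt).comp x h
  refine h1.congr_of_eventuallyEq ?_
  filter_upwards [(trivializationAt F S x).open_baseSet.mem_nhds
    (FiberBundle.mem_baseSet_trivializationAt F S x)] with y hy
  exact (Trivialization.linear ℂ (trivializationAt F S x) hy).map_smul Complex.I (ψ y)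

/-- Multiplication by `i` as a real-linear map. -/
def mulI (x : V) : S x →ₗ[ℝ] S x :=
  (Complex.I • (LinearMap.id : S x →ₗ[ℂ] S x)).restrictScalars ℝ

theorem DiffAt.smul_I {ψ : Π x : V, S x} {x : V} (h : DiffAt n m F ψ x) :
    DiffAt n m F (fun y => Complex.I • ψ y) x :=
  diffAt_linear (fun x => mulI (S := S) x) (fun _ _ h => SmoothAt.smul_I h) h

theorem DiffAt.complex_smul {f : V → ℂ} {ψ : Π x : V, S x} {x : V} (hf : FnDiffAt n m f x)
    (h : DiffAt n m F ψ x) : DiffAt n m F (fun y => f y • ψ y) x := by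
  have h1 : FnDiffAt n m (fun y => (f y).re) x :=
    (Complex.reCLM.mdifferentiableAt).comp x hf
  have h2 : FnDiffAt n m (fun y => (f y).im) x :=
    (Complex.imCLM.mdifferentiableAt).comp x hf
  refine ((DiffAt.smul h1 h).add (DiffAt.smul h2 h.smul_I)).congr
    (Filter.Eventually.of_forall fun y => ?_)
  nth_rewrite 1 [← Complex.re_add_im (f y)]
  rw [add_smul, mul_smul, Complex.coe_smul, Complex.coe_smul]

/-! ### Derivations of spinor fields at a point -/

/-- `δ` is a derivation of the sections of `S` at `x` along the tangent vector `w`. -/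
structure DerivAt (x : V) (w : TangentSpace 𝓘(ℝ, Model n m) x) (δ : (Π y : V, S y) → S x) :
    Prop where
  add {φ ψ : Π y : V, S y} : DiffAt n m F φ x → DiffAt n m F ψ x →
    δ (fun y => φ y + ψ y) = δ φ + δ ψ
  leibniz {f : V → ℝ} {ψ : Π y : V, S y} : FnDiffAt n m f x → DiffAt n m F ψ x →
    δ (fun y => f y • ψ y) = f x • δ ψ + mvfderiv 𝓘(ℝ, Model n m) f x w • ψ x

namespace DerivAt

variable {x : V} {w : TangentSpace 𝓘(ℝ, Model n m) x} {δ δ' : (Π y : V, S y) → S x}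
  (h : DerivAt (F := F) x w δ)

include h

/-- Locality follows from the Leibniz rule alone. -/
theorem congr {φ ψ : Π y : V, S y} (hφ : DiffAt n m F φ x) (hψ : ∀ᶠ y in 𝓝 x, ψ y = φ y) :
    δ ψ = δ φ := by
  classical
  -- No bump function is needed: f may be discontinuous far away, but it equals 1 near x, and f ψ =
  -- f φ everywhere.
  let f (y : V) : ℝ := if ψ y = φ y then 1 else 0
  have hf : ∀ᶠ y in 𝓝 x, f y = 1 := hψ.mono fun y hy => by simp [f, hy]
  have hfd : FnDiffAt n m f x := mdifferentiableAt_const.congr_of_eventuallyEq hf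
  have hd : mvfderiv 𝓘(ℝ, Model n m) f x = 0 := by
    rw [mvfderiv_congr hf, mvfderiv_const]
  have h1 : (fun y => f y • ψ y) = fun y => f y • φ y := by
    funext y
    by_cases hy : ψ y = φ y
    · rw [hy]
    · simp [f, hy]
  have h2 := h.leibniz hfd (hφ.congr hψ)
  rw [h1, h.leibniz hfd hφ, hf.self_of_nhds, hd] at h2
  simpa using h2.symm

theorem const_smul (a : ℝ) {ψ : Π y : V, S y} (hψ : DiffAt n m F ψ x) :
    δ (fun y => a • ψ y) = a • δ ψ := by
  rw [h.leibniz (f := fun _ => a) mdifferentiableAt_const hψ, mvfderiv_const]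
  simp

theorem zero : δ (fun _ => 0) = 0 := by
  have h0 : DiffAt n m F (fun y => (0 : S y)) x := mdifferentiableAt_zeroSection ..
  simpa using h.const_smul 0 h0

theorem sum {ι : Type*} (s : Finset ι) {ψ : ι → Π y : V, S y}
    (hψ : ∀ i, DiffAt n m F (ψ i) x) : δ (fun y => ∑ i ∈ s, ψ i y) = ∑ i ∈ s, δ (ψ i) := by
  classical
  induction s using Finset.induction_on with
  | empty => simpa using h.zero
  | insert i s hi ih =>
    simp only [Finset.sum_insert hi]
    rw [h.add (hψ i) (DiffAt.sum fun j _ => hψ j), ih]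

theorem exists_linear (h' : DerivAt (F := F) x w δ') :
    ∃ A : S x →ₗ[ℝ] S x, ∀ ψ : Π y : V, S y, DiffAt n m F ψ x → δ ψ - δ' ψ = A (ψ x) := by
  have : IsManifold 𝓘(ℝ, Model n m) 1 V := IsManifold.of_le (n := ∞) (by simp)
  have : ContMDiffVectorBundle 1 F S 𝓘(ℝ, Model n m) :=
    ContMDiffVectorBundle.of_le (n := ∞) (by simp)
  have : FiniteDimensional ℝ F := FiniteDimensional.complexToReal F
  have ht : TensorialAt 𝓘(ℝ, Model n m) F (fun ψ => δ ψ - δ' ψ) x := by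
    constructor
    · intro f ψ hf hψ
      have h1 := h.leibniz hf hψ
      have h2 := h'.leibniz hf hψ
      change δ (fun y => f y • ψ y) - δ' (fun y => f y • ψ y) = _
      rw [h1, h2]
      module
    · intro φ ψ hφ hψ
      have h1 := h.add hφ hψ
      have h2 := h'.add hφ hψ
      change δ (fun y => φ y + ψ y) - δ' (fun y => φ y + ψ y) = _
      rw [h1, h2]
      abel
  exact ⟨TensorialAt.mkHom _ x ht, fun ψ hψ => (TensorialAt.mkHom_apply ht hψ).symm⟩

end DerivAt

end

/-! ### The real inner product of spinors, Clifford multiplication and J as real operators -/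

section

variable {n m : ℕ} {V : Type*} [TopologicalSpace V] [ChartedSpace (Model n m) V]
  [IsManifold 𝓘(ℝ, Model n m) ∞ V]
  {N : NConnection n m V} {g : Metric n m V} {p : Part}
  {F : Type*} [NormedAddCommGroup F] [NormedSpace ℂ F] [FiniteDimensional ℂ F]
  {S : V → Type*} [TopologicalSpace (TotalSpace F S)]
  [∀ x, AddCommGroup (S x)] [∀ x, Module ℂ (S x)] [∀ x, TopologicalSpace (S x)]
  [∀ x, IsTopologicalAddGroup (S x)] [∀ x, ContinuousSMul ℝ (S x)]
  [FiberBundle F S] [VectorBundle ℂ F S] [VectorBundle ℝ F S]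
  [ContMDiffVectorBundle ∞ F S 𝓘(ℝ, Model n m)]

namespace SpinStructure

variable (𝒮 : SpinStructure N g p F S)

/-- The inner product of spinors as a real-bilinear map. -/
def hermBil (x : V) : S x →ₗ[ℝ] S x →ₗ[ℝ] ℂ :=
  LinearMap.mk₂ ℝ (fun φ ψ => 𝒮.herm x φ ψ) (fun φ φ' ψ => by simp)
    (fun a φ ψ => by
      rw [← Complex.coe_smul, map_smulₛₗ, Complex.conj_ofReal, LinearMap.smul_apply,
        Complex.coe_smul])
    (fun φ ψ ψ' => by simp)
    (fun a φ ψ => by rw [← Complex.coe_smul, map_smul, Complex.coe_smul])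

/-- The real part of the inner product of spinors. -/
def realHerm (x : V) : S x →ₗ[ℝ] S x →ₗ[ℝ] ℝ :=
  (𝒮.hermBil x).compr₂ Complex.reLm

theorem realHerm_apply (x : V) (φ ψ : S x) : 𝒮.realHerm x φ ψ = (𝒮.herm x φ ψ).re := rfl

theorem fiberMetric_realHerm : FiberMetric n m F 𝒮.realHerm where
  symm x φ ψ := by
    rw [realHerm_apply, realHerm_apply, 𝒮.herm_symm x ψ φ, Complex.conj_re]
  pos := 𝒮.herm_pos
  smooth φ ψ x hφ hψ :=
    (Complex.reCLM.contMDiff.contMDiffAt).comp x (𝒮.smooth_herm φ ψ x hφ hψ)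

theorem herm_diff {φ ψ : Π y : V, S y} {x : V} (hφ : DiffAt n m F φ x) (hψ : DiffAt n m F ψ x) :
    FnDiffAt n m (fun y => 𝒮.herm y (φ y) (ψ y)) x :=
  fnDiffAt_bilinear 𝒮.hermBil 𝒮.smooth_herm hφ hψ

theorem realHerm_diff {φ ψ : Π y : V, S y} {x : V} (hφ : DiffAt n m F φ x)
    (hψ : DiffAt n m F ψ x) : FnDiffAt n m (fun y => 𝒮.realHerm y (φ y) (ψ y)) x :=
  fnDiffAt_bilinear 𝒮.realHerm 𝒮.fiberMetric_realHerm.smooth hφ hψ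

theorem herm_eq (x : V) (φ ψ : S x) : 𝒮.herm x φ ψ =
    (𝒮.realHerm x φ ψ : ℂ) + (𝒮.realHerm x (Complex.I • φ) ψ : ℂ) * Complex.I := by
  rw [realHerm_apply, realHerm_apply, map_smulₛₗ, LinearMap.smul_apply]
  simp

theorem c_smooth {Y : Field n m V} {ψ : Π y : V, S y} {x : V} (hY : SmoothAt n m (Model n m) Y x)
    (hψ : SmoothAt n m F ψ x) : SmoothAt n m F (fun y => 𝒮.c y (Y y) (ψ y)) x :=
  𝒮.smooth_cliff Y ψ x hY hψ

/-- Clifford multiplication as a real-bilinear map. -/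
def cBil (x : V) : TangentSpace 𝓘(ℝ, Model n m) x →ₗ[ℝ] S x →ₗ[ℝ] S x :=
  LinearMap.mk₂ ℝ (fun w ψ => 𝒮.c x w ψ) (fun u w ψ => by simp [c_add])
    (fun a w ψ => by simp [c_smul]) (fun w φ ψ => map_add _ _ _)
    (fun a w ψ => map_smul ((𝒮.c x w).restrictScalars ℝ) a ψ)

theorem c_diff {Y : Field n m V} {ψ : Π y : V, S y} {x : V} (hY : DiffAt n m (Model n m) Y x)
    (hψ : DiffAt n m F ψ x) : DiffAt n m F (fun y => 𝒮.c y (Y y) (ψ y)) x :=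
  diffAt_bilinear 𝒮.cBil (fun _ _ _ hY hψ => 𝒮.c_smooth hY hψ) hY hψ

/-- `J` as a real-linear map. -/
def realJ (x : V) : S x ≃ₗ[ℝ] S x :=
  { (𝒮.J x).toAddEquiv with
    map_smul' := fun a ψ => by
      change 𝒮.J x (a • ψ) = a • 𝒮.J x ψ
      rw [← Complex.coe_smul, map_smulₛₗ, Complex.conj_ofReal, Complex.coe_smul] }

theorem realJ_apply (x : V) (ψ : S x) : 𝒮.realJ x ψ = 𝒮.J x ψ := rfl

theorem J_diff {ψ : Π y : V, S y} {x : V} (hψ : DiffAt n m F ψ x) :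
    DiffAt n m F (fun y => 𝒮.J y (ψ y)) x :=
  diffAt_linear (fun y => (𝒮.realJ y).toLinearMap) (fun ψ x h => 𝒮.smooth_J ψ x h) hψ

theorem realHerm_J (x : V) (φ ψ : S x) :
    𝒮.realHerm x (𝒮.J x φ) (𝒮.J x ψ) = 𝒮.realHerm x φ ψ := by
  rw [realHerm_apply, 𝒮.J_herm, ← realHerm_apply, 𝒮.fiberMetric_realHerm.symm]

/-- J² = ±1 is not assumed, so the inverse is treated directly: J is an isometry for the real inner
product, hence the components of J⁻¹ψ in an orthonormal frame s_i are ⟨J s_i, ψ⟩. -/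
theorem J_symm_smooth {ψ : Π y : V, S y} {x : V} (hψ : SmoothAt n m F ψ x) :
    SmoothAt n m F (fun y => (𝒮.realJ y).symm (ψ y)) x := by
  have : FiniteDimensional ℝ F := FiniteDimensional.complexToReal F
  obtain ⟨U, s, hU, hx, hs, ho, he⟩ := 𝒮.fiberMetric_realHerm.exists_frame x
  have h : SmoothAt n m F (fun y => ∑ i, 𝒮.realHerm y (𝒮.J y (s i y)) (ψ y) • s i y) x :=
    SmoothAt.sum fun i _ => SmoothAt.smul
      (𝒮.fiberMetric_realHerm.smooth _ _ x (𝒮.smooth_J _ x (hs i x hx)) hψ) (hs i x hx)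
  refine h.congr ?_
  filter_upwards [hU.mem_nhds hx] with y hy
  refine (he y hy _).trans (Finset.sum_congr rfl fun i _ => ?_)
  rw [← 𝒮.realHerm_J, ← 𝒮.realJ_apply y ((𝒮.realJ y).symm _), LinearEquiv.apply_symm_apply]

end SpinStructure

end

/-! ### Calculus of derivatives; orthonormal frames of the three bundles -/

section

variable {n m : ℕ} {V : Type*} [TopologicalSpace V] [ChartedSpace (Model n m) V]
  [IsManifold 𝓘(ℝ, Model n m) ∞ V]

theorem mvfderiv_sum {W : Type*} [NormedAddCommGroup W] [NormedSpace ℝ W] {ι : Type*}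
    (s : Finset ι) {f : ι → V → W} {x : V} (hf : ∀ i, FnDiffAt n m (f i) x)
    (w : TangentSpace 𝓘(ℝ, Model n m) x) :
    mvfderiv 𝓘(ℝ, Model n m) (fun y => ∑ i ∈ s, f i y) x w =
      ∑ i ∈ s, mvfderiv 𝓘(ℝ, Model n m) (f i) x w := by
  classical
  induction s using Finset.induction_on with
  | empty =>
    simp only [Finset.sum_empty]
    rw [mvfderiv_const]
    rfl
  | insert i s hi ih =>
    simp only [Finset.sum_insert hi]
    rw [← ih]
    exact congrArg (fun T => T w) (mvfderiv_add (hf i) (FnDiffAt.sum fun j _ => hf j))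

theorem mvfderiv_mul_apply {f h : V → ℝ} {x : V} (hf : FnDiffAt n m f x) (hh : FnDiffAt n m h x)
    (w : TangentSpace 𝓘(ℝ, Model n m) x) :
    mvfderiv 𝓘(ℝ, Model n m) (fun y => f y * h y) x w =
      f x * mvfderiv 𝓘(ℝ, Model n m) h x w + mvfderiv 𝓘(ℝ, Model n m) f x w * h x := by
  have h2 := congrArg (fun T => T w) (mvfderiv_mul hf hh)
  refine h2.trans ?_
  rw [mul_comm _ (h x)]
  rfl

theorem mvfderiv_clm {W W' : Type*} [NormedAddCommGroup W] [NormedSpace ℝ W]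
    [NormedAddCommGroup W'] [NormedSpace ℝ W'] (L : W →L[ℝ] W') {f : V → W} {x : V}
    (hf : FnDiffAt n m f x) (w : TangentSpace 𝓘(ℝ, Model n m) x) :
    mvfderiv 𝓘(ℝ, Model n m) (fun y => L (f y)) x w = L (mvfderiv 𝓘(ℝ, Model n m) f x w) := by
  have h := mfderiv_comp (I' := 𝓘(ℝ, W)) x (L.mdifferentiableAt (x := f x)) hf
  rw [L.mfderiv_eq] at h
  exact congrArg (fun T : TangentSpace 𝓘(ℝ, Model n m) x →L[ℝ] W' => T w) h

theorem mvfderiv_re_add_im {f h : V → ℝ} {x : V} (hf : FnDiffAt n m f x) (hh : FnDiffAt n m h x)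
    (w : TangentSpace 𝓘(ℝ, Model n m) x) :
    mvfderiv 𝓘(ℝ, Model n m) (fun y => (f y : ℂ) + (h y : ℂ) * Complex.I) x w =
      (mvfderiv 𝓘(ℝ, Model n m) f x w : ℂ) + (mvfderiv 𝓘(ℝ, Model n m) h x w : ℂ) * Complex.I := by
  let L : ℝ →L[ℝ] ℂ := ContinuousLinearMap.smulRight (1 : ℝ →L[ℝ] ℝ) Complex.I
  have hL : ∀ a : ℝ, L a = (a : ℂ) * Complex.I := fun a => by simp [L]
  have h1 := mvfderiv_clm Complex.ofRealCLM hf w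
  have h2 := mvfderiv_clm L hh w
  have h3 : FnDiffAt n m (fun y => Complex.ofRealCLM (f y)) x :=
    (Complex.ofRealCLM.mdifferentiableAt).comp x hf
  have h4 : FnDiffAt n m (fun y => L (h y)) x := (L.mdifferentiableAt).comp x hh
  have h5 := congrArg (fun T => T w) (mvfderiv_add h3 h4)
  simp only [hL] at h2 h4 h5
  refine Eq.trans h5 ?_
  exact congrArg₂ (· + ·) h1 h2

variable {N : NConnection n m V} {g : Metric n m V}

variable (N g) in
/-- A smooth local orthonormal frame of `TV`, `hV` or `vV`. -/
structure IsFrameOn (p : Part) (U : Set V) {r : ℕ} (e : Fin r → Field n m V) : Prop where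
  isOpen : IsOpen U
  smooth (α : Fin r) (y : V) : y ∈ U → SmoothAt n m (Model n m) (e α) y
  basis (y : V) : y ∈ U → IsOrthoBasis N g p y (fun α => e α y)

theorem IsFrameOn.mono {p : Part} {U U' : Set V} {r : ℕ} {e : Fin r → Field n m V}
    (h : IsFrameOn N g p U e) (hU : IsOpen U') (hs : U' ⊆ U) : IsFrameOn N g p U' e :=
  ⟨hU, fun α y hy => h.smooth α y (hs hy), fun y hy => h.basis y (hs hy)⟩

/-- The projection fixes the members of the frame selected by k and kills the others, so the
selected ones span its range. -/
theorem IsDFrame.isOrthoBasis {U : Set V} {E : Fin n ⊕ Fin m → Field n m V}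
    (hE : IsDFrame N g U E) {p : Part} {y : V} (hy : y ∈ U) {ι : Type*} [Fintype ι]
    [DecidableEq ι] {k : ι → Fin n ⊕ Fin m} (hk : Function.Injective k)
    (h1 : ∀ i, N.toPart p y (E (k i) y) = E (k i) y)
    (h2 : ∀ α, α ∉ Set.range k → N.toPart p y (E α y) = 0) :
    IsOrthoBasis N g p y (fun i => E (k i) y) where
  ortho i j := by
    rw [hE.ortho y hy]
    simp [hk.eq_iff]
  span := by
    refine le_antisymm (Submodule.span_le.2 ?_) ?_
    · rintro _ ⟨i, rfl⟩
      exact (N.mem_sub_iff p y _).2 (h1 i)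
    · rintro _ ⟨u, rfl⟩
      rw [hE.expand hy u, map_sum]
      refine Submodule.sum_mem _ fun α _ => ?_
      rw [map_smul]
      refine Submodule.smul_mem _ _ ?_
      by_cases hα : α ∈ Set.range k
      · obtain ⟨i, rfl⟩ := hα
        rw [h1]
        exact Submodule.subset_span ⟨i, rfl⟩
      · rw [h2 α hα]
        exact Submodule.zero_mem _

theorem exists_frame (hg : N.IsDMetric g) (p : Part) (x₀ : V) :
    ∃ (U : Set V) (r : ℕ) (e : Fin r → Field n m V), x₀ ∈ U ∧ IsFrameOn N g p U e := by
  obtain ⟨U, E, hx, hE⟩ := exists_dFrame hg x₀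
  cases p
  · refine ⟨U, n + m, fun i => E (finSumFinEquiv.symm i), hx, hE.isOpen,
      fun α y hy => hE.smooth _ y hy, fun y hy => hE.isOrthoBasis hy
        finSumFinEquiv.symm.injective (fun _ => rfl) fun α hα => ?_⟩
    exact absurd ⟨finSumFinEquiv α, by simp⟩ hα
  · refine ⟨U, n, fun i => E (.inl i), hx, hE.isOpen,
      fun α y hy => hE.smooth _ y hy, fun y hy => hE.isOrthoBasis hy
        Sum.inl_injective (fun i => ?_) fun α hα => ?_⟩
    · simp [NConnection.toPart, hE.proj_inl y hy i]
    · rcases α with i | a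
      · exact absurd ⟨i, rfl⟩ hα
      · simp [NConnection.toPart, hE.proj_inr y hy a]
  · refine ⟨U, m, fun i => E (.inr i), hx, hE.isOpen,
      fun α y hy => hE.smooth _ y hy, fun y hy => hE.isOrthoBasis hy
        Sum.inr_injective (fun i => hE.proj_inr y hy i) fun α hα => ?_⟩
    rcases α with i | a
    · exact hE.proj_inl y hy i
    · exact absurd ⟨a, rfl⟩ hα

end

/-! ### Local connections and averaging -/

section

variable {n m : ℕ} {V : Type*} [TopologicalSpace V] [ChartedSpace (Model n m) V]
  [IsManifold 𝓘(ℝ, Model n m) ∞ V]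
  {N : NConnection n m V} {g : Metric n m V} {p : Part}
  {F : Type*} [NormedAddCommGroup F] [NormedSpace ℂ F] [FiniteDimensional ℂ F]
  {S : V → Type*} [TopologicalSpace (TotalSpace F S)]
  [∀ x, AddCommGroup (S x)] [∀ x, Module ℂ (S x)] [∀ x, TopologicalSpace (S x)]
  [∀ x, IsTopologicalAddGroup (S x)] [∀ x, ContinuousSMul ℝ (S x)]
  [FiberBundle F S] [VectorBundle ℂ F S] [VectorBundle ℝ F S]
  [ContMDiffVectorBundle ∞ F S 𝓘(ℝ, Model n m)]

variable (n m S) in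
/-- Operators `Γ(S) → Γ(S) ⊗ Ω¹`. -/
abbrev SpinOp : Type _ :=
  (Π y : V, S y) → Π y : V, TangentSpace 𝓘(ℝ, Model n m) y →ₗ[ℝ] S y

/-- Two operators commute at all points of `U`. -/
def CommutesOn (F : Type*) [NormedAddCommGroup F] [NormedSpace ℂ F]
    {S : V → Type*} [TopologicalSpace (TotalSpace F S)]
    [∀ x, AddCommGroup (S x)] [∀ x, Module ℂ (S x)] [∀ x, TopologicalSpace (S x)]
    [FiberBundle F S] (U : Set V) (d : SpinOp n m S) (T : Π y : V, S y →ₗ[ℝ] S y) : Prop :=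
  ∀ y ∈ U, ∀ ψ : Π y : V, S y, DiffAt n m F ψ y → ∀ w : TangentSpace 𝓘(ℝ, Model n m) y,
    d (fun z => T z (ψ z)) y w = T y (d ψ y w)

namespace SpinStructure

variable (𝒮 : SpinStructure N g p F S)

/-- A smooth real connection on the restriction of `S` to `U` that is compatible with the real
part of the inner product. -/
structure IsLocalConn (U : Set V) (d : SpinOp n m S) : Prop where
  deriv (y : V) : y ∈ U → ∀ w, DerivAt (F := F) y w (fun ψ => d ψ y w)
  metric (y : V) : y ∈ U → ∀ φ ψ : Π y : V, S y, DiffAt n m F φ y → DiffAt n m F ψ y →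
    ∀ w : TangentSpace 𝓘(ℝ, Model n m) y,
    mvfderiv 𝓘(ℝ, Model n m) (fun z => 𝒮.realHerm z (φ z) (ψ z)) y w =
      𝒮.realHerm y (d φ y w) (ψ y) + 𝒮.realHerm y (φ y) (d ψ y w)
  smooth (y : V) : y ∈ U → ∀ (ψ : Π y : V, S y) (Y : Field n m V), SmoothAt n m F ψ y →
    SmoothAt n m (Model n m) Y y → SmoothAt n m F (fun z => d ψ z (Y z)) y

/-- `T` is a smooth field of isometries with inverse `T'` on `U`. -/
structure IsIsometryOn (U : Set V) (T T' : Π y : V, S y →ₗ[ℝ] S y) : Prop where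
  smooth (y : V) : y ∈ U → ∀ ψ : Π y : V, S y, SmoothAt n m F ψ y →
    SmoothAt n m F (fun z => T z (ψ z)) y
  smooth' (y : V) : y ∈ U → ∀ ψ : Π y : V, S y, SmoothAt n m F ψ y →
    SmoothAt n m F (fun z => T' z (ψ z)) y
  diff (y : V) : y ∈ U → ∀ ψ : Π y : V, S y, DiffAt n m F ψ y →
    DiffAt n m F (fun z => T z (ψ z)) y
  isometry (y : V) : y ∈ U → ∀ φ ψ, 𝒮.realHerm y (T y φ) (T y ψ) = 𝒮.realHerm y φ ψ
  left_inv (y : V) : y ∈ U → ∀ ψ, T' y (T y ψ) = ψ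
  right_inv (y : V) : y ∈ U → ∀ ψ, T y (T' y ψ) = ψ

/-- The average `½ (d + T⁻¹ d T)`. -/
def average (T T' : Π y : V, S y →ₗ[ℝ] S y) (d : SpinOp n m S) : SpinOp n m S :=
  fun ψ y => (1 / 2 : ℝ) • (d ψ y + (T' y).comp (d (fun z => T z (ψ z)) y))

omit [FiniteDimensional ℂ F] [∀ x, IsTopologicalAddGroup (S x)] [∀ x, ContinuousSMul ℝ (S x)]
  [VectorBundle ℂ F S] [VectorBundle ℝ F S] [ContMDiffVectorBundle ∞ F S 𝓘(ℝ, Model n m)]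
  [FiberBundle F S] [TopologicalSpace (TotalSpace F S)] [∀ x, TopologicalSpace (S x)] in
theorem average_apply (T T' : Π y : V, S y →ₗ[ℝ] S y) (d : SpinOp n m S) (ψ : Π y : V, S y) (y : V)
    (w : TangentSpace 𝓘(ℝ, Model n m) y) : average T T' d ψ y w =
      (1 / 2 : ℝ) • (d ψ y w + T' y (d (fun z => T z (ψ z)) y w)) := rfl

variable {𝒮} {U : Set V} {d : SpinOp n m S} {T T' : Π y : V, S y →ₗ[ℝ] S y}

theorem IsLocalConn.deriv_conj (hd : 𝒮.IsLocalConn U d) (hT : 𝒮.IsIsometryOn U T T') (y : V)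
    (hy : y ∈ U) (w : TangentSpace 𝓘(ℝ, Model n m) y) :
    DerivAt (F := F) y w (fun ψ => T' y (d (fun z => T z (ψ z)) y w)) where
  add {φ ψ} hφ hψ := by
    have h := (hd.deriv y hy w).add (hT.diff y hy φ hφ) (hT.diff y hy ψ hψ)
    simp only [map_add]
    rw [h, map_add]
  leibniz {f ψ} hf hψ := by
    have h := (hd.deriv y hy w).leibniz hf (hT.diff y hy ψ hψ)
    simp only [map_smul]
    rw [h, map_add, map_smul, map_smul, hT.left_inv y hy]

theorem IsLocalConn.metric_conj (hd : 𝒮.IsLocalConn U d) (hT : 𝒮.IsIsometryOn U T T')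
    (hU : IsOpen U) (y : V) (hy : y ∈ U) {φ ψ : Π y : V, S y} (hφ : DiffAt n m F φ y)
    (hψ : DiffAt n m F ψ y) (w : TangentSpace 𝓘(ℝ, Model n m) y) :
    mvfderiv 𝓘(ℝ, Model n m) (fun z => 𝒮.realHerm z (φ z) (ψ z)) y w =
      𝒮.realHerm y (T' y (d (fun z => T z (φ z)) y w)) (ψ y)
        + 𝒮.realHerm y (φ y) (T' y (d (fun z => T z (ψ z)) y w)) := by
  have h1 := hd.metric y hy _ _ (hT.diff y hy φ hφ) (hT.diff y hy ψ hψ) w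
  rw [mvfderiv_congr (f' := fun z => 𝒮.realHerm z (T z (φ z)) (T z (ψ z))), h1,
    ← hT.isometry y hy _ (ψ y), ← hT.isometry y hy (φ y), hT.right_inv y hy, hT.right_inv y hy]
  filter_upwards [hU.mem_nhds hy] with z hz
  rw [hT.isometry z hz]

theorem IsLocalConn.average (hd : 𝒮.IsLocalConn U d) (hT : 𝒮.IsIsometryOn U T T')
    (hU : IsOpen U) : 𝒮.IsLocalConn U (average T T' d) where
  deriv y hy w := by
    have h1 := hd.deriv y hy w
    have h2 := hd.deriv_conj hT y hy w
    constructor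
    · intro φ ψ hφ hψ
      have e1 := h1.add hφ hψ
      have e2 := h2.add hφ hψ
      simp only [average_apply] at e1 e2 ⊢
      rw [e1, e2]
      module
    · intro f ψ hf hψ
      have e1 := h1.leibniz hf hψ
      have e2 := h2.leibniz hf hψ
      simp only [average_apply] at e1 e2 ⊢
      rw [e1, e2]
      module
  metric y hy φ ψ hφ hψ w := by
    have h1 := hd.metric y hy φ ψ hφ hψ w
    have h2 := hd.metric_conj hT hU y hy hφ hψ w
    simp only [average_apply, map_smul, map_add, LinearMap.smul_apply, LinearMap.add_apply,
      smul_eq_mul]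
    linarith
  smooth y hy ψ Y hψ hY :=
    SmoothAt.const_smul _ ((hd.smooth y hy ψ Y hψ hY).add
      (hT.smooth' y hy _ (hd.smooth y hy _ Y (hT.smooth y hy ψ hψ) hY)))

/-- Since T² = ε, conjugating by T twice returns d; conjugation exchanges the two halves of the
average. The cases needed are T = i with ε = −1 and T = γ_α with ε = 1. -/
theorem IsLocalConn.average_commutes_self (hd : 𝒮.IsLocalConn U d) (hT : 𝒮.IsIsometryOn U T T')
    (hU : IsOpen U) {ε : ℝ} (hε : ε * ε = 1) (h : ∀ y ∈ U, ∀ ψ, T' y ψ = ε • T y ψ) :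
    CommutesOn F U (SpinStructure.average T T' d) T := by
  intro y hy ψ hψ w
  have h1 : ∀ z ∈ U, ∀ φ, T z (T z φ) = ε • φ := by
    intro z hz φ
    have h2 := hT.left_inv z hz φ
    rw [h z hz] at h2
    nth_rewrite 2 [← h2]
    rw [smul_smul, hε, one_smul]
  have h3 : d (fun z => T z (T z (ψ z))) y w = ε • d ψ y w := by
    rw [← (hd.deriv y hy w).const_smul ε hψ]
    refine (hd.deriv y hy w).congr (DiffAt.smul (f := fun _ => ε) mdifferentiableAt_const hψ) ?_
    filter_upwards [hU.mem_nhds hy] with z hz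
    exact h1 z hz _
  rw [average_apply, average_apply, h3, map_smul, map_smul, map_add, hT.right_inv y hy, h y hy,
    smul_smul ε, hε, one_smul, add_comm]

/-- If R and T commute up to a constant sign, averaging over T keeps R parallel: the sign occurs
twice in T⁻¹ d T and cancels. Hence the averages can be taken one after another. -/
theorem IsLocalConn.average_commutes (hd : 𝒮.IsLocalConn U d) (hT : 𝒮.IsIsometryOn U T T')
    (hU : IsOpen U) {R : Π y : V, S y →ₗ[ℝ] S y} (hR : CommutesOn F U d R)
    (hRd : ∀ y ∈ U, ∀ ψ : Π y : V, S y, DiffAt n m F ψ y → DiffAt n m F (fun z => R z (ψ z)) y)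
    {ε : ℝ} (hε : ε * ε = 1) (h : ∀ y ∈ U, ∀ ψ, R y (T y ψ) = ε • T y (R y ψ)) :
    CommutesOn F U (SpinStructure.average T T' d) R := by
  intro y hy ψ hψ w
  have h1 : ∀ z ∈ U, ∀ φ, T z (R z φ) = ε • R z (T z φ) := by
    intro z hz φ
    rw [h z hz, smul_smul, hε, one_smul]
  have hTd := hT.diff y hy ψ hψ
  have h3 : d (fun z => T z (R z (ψ z))) y w = ε • R y (d (fun z => T z (ψ z)) y w) := by
    rw [← hR y hy _ hTd, ← (hd.deriv y hy w).const_smul ε (hRd y hy _ hTd)]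
    refine (hd.deriv y hy w).congr
      (DiffAt.smul (f := fun _ => ε) mdifferentiableAt_const (hRd y hy _ hTd)) ?_
    filter_upwards [hU.mem_nhds hy] with z hz
    exact h1 z hz _
  have h4 : ∀ φ, T' y (R y φ) = ε • R y (T' y φ) := by
    intro φ
    nth_rewrite 1 [← hT.right_inv y hy φ]
    rw [h y hy, map_smul, hT.left_inv y hy]
  rw [average_apply, average_apply, h3, hR y hy ψ hψ, map_smul, map_smul, map_add, h4,
    smul_smul ε, hε, one_smul]

variable (𝒮) in
-- Differentiation of the components in a frame orthonormal for the real inner product; no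
-- compatibility with i, γ or J is asked for yet.
theorem exists_localConn (x₀ : V) :
    ∃ (U : Set V) (d : SpinOp n m S), IsOpen U ∧ x₀ ∈ U ∧ 𝒮.IsLocalConn U d := by
  have : FiniteDimensional ℝ F := FiniteDimensional.complexToReal F
  obtain ⟨U, s, hU, hx, hs, ho, he⟩ := 𝒮.fiberMetric_realHerm.exists_frame x₀
  let d : SpinOp n m S := fun ψ y => ∑ i,
    (mvfderiv 𝓘(ℝ, Model n m) (fun z => 𝒮.realHerm z (s i z) (ψ z)) y).toLinearMap.smulRight (s i y)
  have hd : ∀ ψ y w, d ψ y w = ∑ i,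
      mvfderiv 𝓘(ℝ, Model n m) (fun z => 𝒮.realHerm z (s i z) (ψ z)) y w • s i y := by
    intro ψ y w
    simp only [d, LinearMap.sum_apply]
    rfl
  have hc : ∀ {y}, y ∈ U → ∀ {ψ : Π y : V, S y}, DiffAt n m F ψ y → ∀ i,
      FnDiffAt n m (fun z => 𝒮.realHerm z (s i z) (ψ z)) y := fun hy ψ hψ i =>
    𝒮.realHerm_diff (hs i _ hy).diffAt hψ
  refine ⟨U, d, hU, hx, ?_, ?_, ?_⟩
  · intro y hy w
    constructor
    · intro φ ψ hφ hψ
      simp only [hd, map_add]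
      rw [← Finset.sum_add_distrib]
      refine Finset.sum_congr rfl fun i _ => ?_
      rw [← add_smul]
      exact congrArg (fun T => T w • s i y) (mvfderiv_add (hc hy hφ i) (hc hy hψ i))
    · intro f ψ hf hψ
      simp only [hd, map_smul]
      have h1 : mvfderiv 𝓘(ℝ, Model n m) f y w • ψ y =
          ∑ i, mvfderiv 𝓘(ℝ, Model n m) f y w • 𝒮.realHerm y (s i y) (ψ y) • s i y := by
        rw [← Finset.smul_sum, ← he y hy (ψ y)]
      rw [Finset.smul_sum, h1, ← Finset.sum_add_distrib]
      refine Finset.sum_congr rfl fun i _ => ?_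
      rw [smul_smul, smul_smul, ← add_smul]
      exact congrArg (· • s i y) (mvfderiv_mul_apply hf (hc hy hψ i) w)
  · intro y hy φ ψ hφ hψ w
    have h1 : ∀ z ∈ U, 𝒮.realHerm z (φ z) (ψ z) =
        ∑ i, 𝒮.realHerm z (s i z) (φ z) * 𝒮.realHerm z (s i z) (ψ z) := by
      intro z hz
      have h2 := 𝒮.fiberMetric_realHerm.symm z
      nth_rewrite 1 [he z hz (ψ z)]
      rw [map_sum]
      refine Finset.sum_congr rfl fun i _ => ?_
      rw [map_smul, h2 (φ z), smul_eq_mul, mul_comm]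
    rw [mvfderiv_congr (Filter.eventually_of_mem (hU.mem_nhds hy) h1),
      mvfderiv_sum (f := fun i z => 𝒮.realHerm z (s i z) (φ z) * 𝒮.realHerm z (s i z) (ψ z)) _
        (fun i => MDifferentiableAt.mul (hc hy hφ i) (hc hy hψ i))]
    rw [𝒮.fiberMetric_realHerm.symm y (d φ y w), hd, hd, map_sum, map_sum,
      ← Finset.sum_add_distrib]
    refine Finset.sum_congr rfl fun i _ => ?_
    rw [map_smul, map_smul, 𝒮.fiberMetric_realHerm.symm y (φ y),
      𝒮.fiberMetric_realHerm.symm y (ψ y)]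
    refine (mvfderiv_mul_apply (hc hy hφ i) (hc hy hψ i) w).trans ?_
    rw [smul_eq_mul, smul_eq_mul]
    ring
  · intro y hy ψ Y hψ hY
    simp only [hd]
    exact SmoothAt.sum fun i _ => SmoothAt.smul
      (FnSmoothAt.along (𝒮.fiberMetric_realHerm.smooth _ _ y (hs i y hy) hψ) hY) (hs i y hy)

theorem IsLocalConn.mono {U' : Set V} (hd : 𝒮.IsLocalConn U d) (h : U' ⊆ U) :
    𝒮.IsLocalConn U' d :=
  ⟨fun y hy => hd.deriv y (h hy), fun y hy => hd.metric y (h hy), fun y hy => hd.smooth y (h hy)⟩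

end SpinStructure

end

/-! ### Local connections for which i, the γ's and J are parallel -/

section

variable {n m : ℕ} {V : Type*} [TopologicalSpace V] [ChartedSpace (Model n m) V]
  [IsManifold 𝓘(ℝ, Model n m) ∞ V]
  {N : NConnection n m V} {g : Metric n m V} {p : Part}
  {F : Type*} [NormedAddCommGroup F] [NormedSpace ℂ F] [FiniteDimensional ℂ F]
  {S : V → Type*} [TopologicalSpace (TotalSpace F S)]
  [∀ x, AddCommGroup (S x)] [∀ x, Module ℂ (S x)] [∀ x, TopologicalSpace (S x)]
  [∀ x, IsTopologicalAddGroup (S x)] [∀ x, ContinuousSMul ℝ (S x)]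
  [FiberBundle F S] [VectorBundle ℂ F S] [VectorBundle ℝ F S]
  [ContMDiffVectorBundle ∞ F S 𝓘(ℝ, Model n m)]

namespace SpinStructure

variable (𝒮 : SpinStructure N g p F S)

/-- `δ` is a complex derivation at `x` along `w`, compatible with the inner product. -/
structure HermDerivAt (x : V) (w : TangentSpace 𝓘(ℝ, Model n m) x) (δ : (Π y : V, S y) → S x) :
    Prop extends DerivAt (F := F) x w δ where
  comm_I (ψ : Π y : V, S y) : DiffAt n m F ψ x → δ (fun y => Complex.I • ψ y) = Complex.I • δ ψ
  metric (φ ψ : Π y : V, S y) : DiffAt n m F φ x → DiffAt n m F ψ x →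
    mvfderiv 𝓘(ℝ, Model n m) (fun z => 𝒮.realHerm z (φ z) (ψ z)) x w =
      𝒮.realHerm x (δ φ) (ψ x) + 𝒮.realHerm x (φ x) (δ ψ)

variable {𝒮}

/-- The difference is tensorial, hence real linear; it is complex linear because both derivations
commute with i. Skewness for the real part, applied to φ and iφ, gives skewness for the Hermitian
product. -/
theorem HermDerivAt.exists_end {x : V} {w : TangentSpace 𝓘(ℝ, Model n m) x}
    {δ δ' : (Π y : V, S y) → S x} (h : 𝒮.HermDerivAt x w δ) (h' : 𝒮.HermDerivAt x w δ') :
    ∃ A : Module.End ℂ (S x), (∀ ψ : Π y : V, S y, DiffAt n m F ψ x → δ ψ = δ' ψ + A (ψ x)) ∧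
      ∀ φ ψ, 𝒮.herm x (A φ) ψ + 𝒮.herm x φ (A ψ) = 0 := by
  obtain ⟨A, hA⟩ := h.exists_linear h'.toDerivAt
  have hI : ∀ v, A (Complex.I • v) = Complex.I • A v := by
    intro v
    have hv := (smoothAt_extend (n := n) (m := m) (F := F) v).diffAt
    have h1 := hA _ hv
    have h2 := hA _ hv.smul_I
    simp only [FiberBundle.extend_apply_self] at h1 h2
    rw [← h1, ← h2, h.comm_I _ hv, h'.comm_I _ hv, smul_sub]
  let A' : Module.End ℂ (S x) :=
    { A with
      map_smul' := fun a v => by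
        change A (a • v) = a • A v
        nth_rewrite 1 [← Complex.re_add_im a]
        nth_rewrite 3 [← Complex.re_add_im a]
        rw [add_smul, add_smul, mul_smul, mul_smul, map_add, Complex.coe_smul, Complex.coe_smul,
          Complex.coe_smul, Complex.coe_smul, map_smul, map_smul, hI] }
  have hA' : ∀ v, A' v = A v := fun _ => rfl
  have hr : ∀ φ ψ, 𝒮.realHerm x (A φ) ψ + 𝒮.realHerm x φ (A ψ) = 0 := by
    intro u v
    have hu := (smoothAt_extend (n := n) (m := m) (F := F) u).diffAt
    have hv := (smoothAt_extend (n := n) (m := m) (F := F) v).diffAt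
    have h1 := h.metric _ _ hu hv
    have h2 := h'.metric _ _ hu hv
    have h3 := hA _ hu
    have h4 := hA _ hv
    simp only [FiberBundle.extend_apply_self] at h1 h2 h3 h4
    rw [← h3, ← h4]
    simp only [map_sub, LinearMap.sub_apply]
    linarith
  refine ⟨A', fun ψ hψ => ?_, fun φ ψ => ?_⟩
  · rw [hA', ← hA ψ hψ, add_sub_cancel]
  · have h1 := hr φ ψ
    have h2 := hr (Complex.I • φ) ψ
    rw [hI] at h2
    rw [hA', hA', 𝒮.herm_eq x (A φ), 𝒮.herm_eq x φ, add_add_add_comm, ← add_mul,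
      ← Complex.ofReal_add, ← Complex.ofReal_add, h1, h2]
    simp

variable (𝒮)

theorem realHerm_I (x : V) (φ ψ : S x) :
    𝒮.realHerm x (Complex.I • φ) (Complex.I • ψ) = 𝒮.realHerm x φ ψ := by
  rw [realHerm_apply, realHerm_apply, map_smul (𝒮.herm x (Complex.I • φ)), map_smulₛₗ,
    LinearMap.smul_apply, smul_eq_mul, smul_eq_mul, ← mul_assoc]
  simp

theorem isIsometryOn_mulI (U : Set V) :
    𝒮.IsIsometryOn U (fun y => mulI y) (fun y => - mulI y) where
  smooth _ _ _ hψ := hψ.smul_I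
  smooth' y _ ψ hψ := by
    have h := SmoothAt.const_smul (-1) hψ.smul_I
    refine h.congr (Filter.Eventually.of_forall fun z => ?_)
    simp [mulI]
  diff _ _ _ hψ := hψ.smul_I
  isometry y _ φ ψ := 𝒮.realHerm_I y φ ψ
  left_inv y _ ψ := by simp [mulI, smul_smul]
  right_inv y _ ψ := by simp [mulI, smul_smul]

theorem isIsometryOn_J (U : Set V) :
    𝒮.IsIsometryOn U (fun y => (𝒮.realJ y).toLinearMap) (fun y => (𝒮.realJ y).symm.toLinearMap) where
  smooth y _ ψ hψ := 𝒮.smooth_J ψ y hψ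
  smooth' _ _ _ hψ := 𝒮.J_symm_smooth hψ
  diff _ _ _ hψ := 𝒮.J_diff hψ
  isometry y _ φ ψ := 𝒮.realHerm_J y φ ψ
  left_inv y _ ψ := (𝒮.realJ y).symm_apply_apply ψ
  right_inv y _ ψ := (𝒮.realJ y).apply_symm_apply ψ

theorem cBil_apply (x : V) (w : TangentSpace 𝓘(ℝ, Model n m) x) (ψ : S x) :
    𝒮.cBil x w ψ = 𝒮.c x w ψ := rfl

variable {U : Set V} {r : ℕ} {e : Fin r → Field n m V}

theorem c_c_frame {y : V} {e : Fin r → TangentSpace 𝓘(ℝ, Model n m) y}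
    (he : IsOrthoBasis N g p y e) (α : Fin r) (ψ : S y) :
    𝒮.c y (e α) (𝒮.c y (e α) ψ) = ψ := by
  have h := 𝒮.c_c_add y (e α) (e α) ψ
  rw [he.toPart_eq, he.ortho, if_pos rfl, mul_one, ← two_smul ℝ] at h
  exact smul_right_injective _ (two_ne_zero' ℝ) h

theorem isIsometryOn_c (he : IsFrameOn N g p U e) (α : Fin r) :
    𝒮.IsIsometryOn U (fun y => 𝒮.cBil y (e α y)) (fun y => 𝒮.cBil y (e α y)) where
  smooth y hy ψ hψ := 𝒮.c_smooth (he.smooth α y hy) hψ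
  smooth' y hy ψ hψ := 𝒮.c_smooth (he.smooth α y hy) hψ
  diff y hy ψ hψ := 𝒮.c_diff (he.smooth α y hy).diffAt hψ
  isometry y hy φ ψ := by
    rw [realHerm_apply, realHerm_apply, cBil_apply, cBil_apply, herm_c,
      𝒮.c_c_frame (he.basis y hy)]
  left_inv y hy ψ := 𝒮.c_c_frame (he.basis y hy) α ψ
  right_inv y hy ψ := 𝒮.c_c_frame (he.basis y hy) α ψ

/-- In effect an average over the finite group generated by i and the γ_α, one generator at a time.
Each new generator commutes with i and anticommutes with the earlier γ's, so what has been achieved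
persists. -/
theorem exists_hermConn (hg : N.IsDMetric g) (x₀ : V) :
    ∃ (U : Set V) (r : ℕ) (e : Fin r → Field n m V) (d : SpinOp n m S), x₀ ∈ U ∧
      IsFrameOn N g p U e ∧ 𝒮.IsLocalConn U d ∧ CommutesOn F U d (fun y => mulI y) ∧
      ∀ α, CommutesOn F U d (fun y => 𝒮.cBil y (e α y)) := by
  obtain ⟨U₁, r, e, hx₁, he⟩ := exists_frame hg p x₀
  obtain ⟨U₂, d₀, hU₂, hx₂, hd₀⟩ := 𝒮.exists_localConn x₀
  have hU := he.isOpen.inter hU₂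
  replace he := he.mono hU Set.inter_subset_left
  replace hd₀ := hd₀.mono (U' := U₁ ∩ U₂) Set.inter_subset_right
  have key : ∀ s : Finset (Fin r), ∃ d : SpinOp n m S, 𝒮.IsLocalConn (U₁ ∩ U₂) d ∧
      CommutesOn F (U₁ ∩ U₂) d (fun y => mulI y) ∧
      ∀ α ∈ s, CommutesOn F (U₁ ∩ U₂) d (fun y => 𝒮.cBil y (e α y)) := by
    intro s
    induction s using Finset.induction_on with
    | empty =>
      have hT := 𝒮.isIsometryOn_mulI (U₁ ∩ U₂)
      refine ⟨_, hd₀.average hT hU, hd₀.average_commutes_self hT hU (ε := -1) (by norm_num)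
        fun y _ ψ => by simp, by simp⟩
    | insert β s hβ ih =>
      obtain ⟨d, hd, hI, hs⟩ := ih
      have hT := 𝒮.isIsometryOn_c he β
      refine ⟨average _ _ d, hd.average hT hU, hd.average_commutes hT hU hI (fun y _ ψ hψ => hψ.smul_I)
        (ε := 1) (by norm_num) fun y _ ψ => ?_, fun α hα => ?_⟩
      · rw [one_smul]
        exact (map_smul (𝒮.c y (e β y)) Complex.I ψ).symm
      · by_cases hαβ : α = β
        · subst hαβ
          exact hd.average_commutes_self hT hU (ε := 1) (by norm_num) fun y _ ψ => by simp
        · refine hd.average_commutes hT hU (hs α (Finset.mem_of_mem_insert_of_ne hα hαβ))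
            (𝒮.isIsometryOn_c he α).diff (ε := -1) (by norm_num) fun y hy ψ => ?_
          have h := 𝒮.c_c_add y (e α y) (e β y) ψ
          rw [(he.basis y hy).toPart_eq, (he.basis y hy).toPart_eq, (he.basis y hy).ortho,
            if_neg hαβ, mul_zero, zero_smul] at h
          rw [neg_one_smul]
          exact eq_neg_of_add_eq_zero_left h
  obtain ⟨d, hd, hI, hs⟩ := key Finset.univ
  exact ⟨U₁ ∩ U₂, r, e, d, ⟨hx₁, hx₂⟩, he, hd, hI, fun α => hs α (Finset.mem_univ α)⟩

/-- A local connection for which the spin gauge defined by the frame `e` is parallel. -/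
structure IsFlatConn (U : Set V) (e : Fin r → Field n m V) (d : SpinOp n m S) : Prop
    extends 𝒮.IsLocalConn U d where
  comm_I : CommutesOn F U d (fun y => mulI y)
  comm_c (α : Fin r) : CommutesOn F U d (fun y => 𝒮.cBil y (e α y))
  comm_J : CommutesOn F U d (fun y => (𝒮.realJ y).toLinearMap)

theorem commute_c_of_frame (hg : N.IsDMetric g) {x : V} {e : Fin r → TangentSpace 𝓘(ℝ, Model n m) x}
    (he : IsOrthoBasis N g p x e) {A : Module.End ℂ (S x)} (hA : ∀ α, Commute A (𝒮.c x (e α)))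
    (w : TangentSpace 𝓘(ℝ, Model n m) x) : Commute A (𝒮.c x w) := by
  rw [← 𝒮.c_toPart, he.toPart_expand hg, c_sum]
  refine Commute.sum_right _ _ _ fun α _ => ?_
  rw [c_smul]
  exact (hA α).smul_right _

/-- For J the argument with T² = ε is not available. Instead J⁻¹ d J − d commutes with all γ_α, so
it is a scalar a by Schur's lemma, imaginary by skewness. The average is then d + a/2: i and the γ_α
remain parallel, and J becomes parallel because the conjugate of a is −a. -/
theorem exists_flatConn (hg : N.IsDMetric g) (x₀ : V) :
    ∃ (U : Set V) (r : ℕ) (e : Fin r → Field n m V) (d : SpinOp n m S), x₀ ∈ U ∧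
      IsFrameOn N g p U e ∧ 𝒮.IsFlatConn U e d := by
  obtain ⟨U, r, e, d, hx, he, hd, hI, hc⟩ := 𝒮.exists_hermConn hg x₀
  have hT := 𝒮.isIsometryOn_J U
  have key : ∀ y ∈ U, ∀ w : TangentSpace 𝓘(ℝ, Model n m) y, ∃ a : ℂ, starRingEnd ℂ a = - a ∧
      ∀ ψ : Π y : V, S y, DiffAt n m F ψ y →
        d (fun z => 𝒮.J z (ψ z)) y w = 𝒮.J y (d ψ y w + a • ψ y) := by
    intro y hy w
    have h1 : 𝒮.HermDerivAt y w (fun ψ => d ψ y w) :=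
      { hd.deriv y hy w with
        comm_I := fun ψ hψ => hI y hy ψ hψ w
        metric := fun φ ψ hφ hψ => hd.metric y hy φ ψ hφ hψ w }
    have h2 : 𝒮.HermDerivAt y w (fun ψ => (𝒮.realJ y).symm (d (fun z => 𝒮.J z (ψ z)) y w)) :=
      { hd.deriv_conj hT y hy w with
        comm_I := fun ψ hψ => by
          -- J and J⁻¹ each conjugate i, so the conjugated derivation is again complex linear.
          have h3 : d (fun z => 𝒮.J z (Complex.I • ψ z)) y w =
              - Complex.I • d (fun z => 𝒮.J z (ψ z)) y w := by
            have hJ := 𝒮.J_diff hψ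
            rw [neg_smul, ← neg_one_smul ℝ]
            refine Eq.trans ?_ (congrArg ((-1 : ℝ) • ·) (hI y hy _ hJ w))
            refine Eq.trans ?_ ((hd.deriv y hy w).const_smul (-1) hJ.smul_I)
            refine congrArg (fun φ => d φ y w) (funext fun z => ?_)
            simp [map_smulₛₗ, mulI]
          rw [h3, LinearEquiv.symm_apply_eq, realJ_apply, map_smulₛₗ, ← realJ_apply,
            LinearEquiv.apply_symm_apply]
          simp
        metric := fun φ ψ hφ hψ => hd.metric_conj hT he.isOpen y hy hφ hψ w }
    obtain ⟨A, hA, hs⟩ := h2.exists_end h1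
    have hAJ : ∀ ψ : Π y : V, S y, DiffAt n m F ψ y →
        d (fun z => 𝒮.J z (ψ z)) y w = 𝒮.J y (d ψ y w + A (ψ y)) := by
      intro ψ hψ
      rw [← hA ψ hψ, ← realJ_apply, LinearEquiv.apply_symm_apply]
    have hcd : ∀ α {ψ : Π y : V, S y}, DiffAt n m F ψ y →
        DiffAt n m F (fun z => 𝒮.c z (e α z) (ψ z)) y := fun α ψ hψ =>
      (𝒮.isIsometryOn_c he α).diff y hy ψ hψ
    have hcc : ∀ α {ψ : Π y : V, S y}, DiffAt n m F ψ y →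
        d (fun z => 𝒮.c z (e α z) (ψ z)) y w = 𝒮.c y (e α y) (d ψ y w) := fun α ψ hψ =>
      hc α y hy ψ hψ w
    have heven : ∀ α β, Commute A (𝒮.c y (e α y) * 𝒮.c y (e β y)) := by
      intro α β
      refine LinearMap.ext fun v => ?_
      have hv := (smoothAt_extend (n := n) (m := m) (F := F) v).diffAt
      have h3 := hAJ _ (hcd α (hcd β hv))
      rw [hcc α (hcd β hv), hcc β hv] at h3
      simp only [J_c_c, FiberBundle.extend_apply_self] at h3
      rw [hcc α (hcd β (𝒮.J_diff hv)), hcc β (𝒮.J_diff hv), hAJ _ hv, ← J_c_c] at h3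
      have h4 := (𝒮.J y).injective h3
      simp only [map_add, FiberBundle.extend_apply_self] at h4
      exact (add_left_cancel h4).symm
    have hcomm : ∀ α, Commute A (𝒮.c y (e α y)) := by
      -- In even rank J anticommutes with vectors on all of U, so conjugation by J keeps each γ_α
      -- parallel. In odd rank only even products are controlled, and the volume element supplies
      -- the rest.
      rcases Nat.even_or_odd r with hr | hr
      · intro α
        refine LinearMap.ext fun v => ?_
        have hv := (smoothAt_extend (n := n) (m := m) (F := F) v).diffAt
        have hr' : ∀ z ∈ U, Even (Module.finrank ℝ (N.sub p z)) := fun z hz => by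
          rw [(he.basis z hz).finrank_eq, Fintype.card_fin]; exact hr
        have h3 := hAJ _ (hcd α hv)
        rw [hcc α hv] at h3
        have h5 : d (fun z => 𝒮.J z (𝒮.c z (e α z) (FiberBundle.extend F v z))) y w =
            - 𝒮.c y (e α y) (d (fun z => 𝒮.J z (FiberBundle.extend F v z)) y w) := by
          rw [← hcc α (𝒮.J_diff hv), ← neg_one_smul ℝ,
            ← (hd.deriv y hy w).const_smul (-1) (hcd α (𝒮.J_diff hv))]
          refine (hd.deriv y hy w).congr (DiffAt.smul (f := fun _ => -1) mdifferentiableAt_const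
            (hcd α (𝒮.J_diff hv))) ?_
          filter_upwards [he.isOpen.mem_nhds hy] with z hz
          rw [J_c _ _ (hr' z hz), neg_one_smul]
        rw [h5, hAJ _ hv, ← J_c _ _ (hr' y hy)] at h3
        have h4 := (𝒮.J y).injective h3
        simp only [map_add, FiberBundle.extend_apply_self] at h4
        exact (add_left_cancel h4).symm
      · exact 𝒮.commute_of_commute_even hg hr (he.basis y hy) heven
    obtain ⟨a, rfl⟩ := 𝒮.exists_smul_of_commute (𝒮.commute_c_of_frame hg (he.basis y hy) hcomm)
    exact ⟨a, 𝒮.conj_of_skew hs, fun ψ hψ => hAJ ψ hψ⟩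
  have havg : ∀ y ∈ U, ∀ w : TangentSpace 𝓘(ℝ, Model n m) y, ∃ a : ℂ, starRingEnd ℂ a = - a ∧
      (∀ ψ : Π y : V, S y, DiffAt n m F ψ y →
        d (fun z => 𝒮.J z (ψ z)) y w = 𝒮.J y (d ψ y w + a • ψ y)) ∧
      ∀ ψ : Π y : V, S y, DiffAt n m F ψ y →
        average (fun y => (𝒮.realJ y).toLinearMap) (fun y => (𝒮.realJ y).symm.toLinearMap) d ψ y w =
          d ψ y w + (a / 2) • ψ y := by
    intro y hy w
    obtain ⟨a, ha, h⟩ := key y hy w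
    refine ⟨a, ha, h, fun ψ hψ => ?_⟩
    rw [average_apply]
    have h1 : (𝒮.realJ y).symm.toLinearMap (d (fun z => (𝒮.realJ z).toLinearMap (ψ z)) y w) =
        d ψ y w + a • ψ y :=
      (LinearEquiv.symm_apply_eq _).2 (h ψ hψ)
    rw [h1, ← Complex.coe_smul]
    push_cast
    module
  refine ⟨U, r, e, average _ _ d, hx, he, { hd.average hT he.isOpen with comm_I := ?_, comm_c := ?_, comm_J := ?_ }⟩
  · intro y hy ψ hψ w
    obtain ⟨a, ha, -, h⟩ := havg y hy w
    have h1 : d (fun z => mulI z (ψ z)) y w = mulI y (d ψ y w) := hI y hy ψ hψ w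
    have h2 : ∀ {z} (v : S z), mulI z v = Complex.I • v := fun _ => rfl
    refine (h _ hψ.smul_I).trans ?_
    rw [h _ hψ]
    refine (congrArg (· + _) h1).trans ?_
    rw [h2, h2, smul_add, smul_comm]
  · intro α y hy ψ hψ w
    obtain ⟨a, ha, -, h⟩ := havg y hy w
    rw [h _ hψ, h _ ((𝒮.isIsometryOn_c he α).diff y hy ψ hψ), hc α y hy ψ hψ w]
    simp only [cBil_apply, map_add, map_smul]
  · intro y hy ψ hψ w
    obtain ⟨a, ha, h', h⟩ := havg y hy w
    have h1 : d (fun z => (𝒮.realJ z).toLinearMap (ψ z)) y w = 𝒮.J y (d ψ y w + a • ψ y) := h' ψ hψ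
    refine (h _ (𝒮.J_diff hψ)).trans ?_
    rw [h _ hψ]
    refine (congrArg (· + _) h1).trans ?_
    simp only [LinearEquiv.coe_coe, realJ_apply, map_add, map_smulₛₗ, map_div₀, ha]
    simp only [Complex.conj_ofNat]
    module

end SpinStructure

end

/-! ### The derivative of an orthonormal frame as an endomorphism -/

section

variable {n m : ℕ} {V : Type*} [TopologicalSpace V] [ChartedSpace (Model n m) V]
  [IsManifold 𝓘(ℝ, Model n m) ∞ V] {N : NConnection n m V} {g : Metric n m V}

theorem Conn.congr (D : Conn n m V) {Y Y' : Field n m V} {x : V} (hY : DiffAt n m (Model n m) Y x)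
    (h : ∀ᶠ y in 𝓝 x, Y y = Y' y) : D Y x = D Y' x :=
  D.isCovariantDerivativeOnUniv.congr_of_eventuallyEq hY (hY.congr (h.mono fun _ h => h.symm))
    Filter.univ_mem h

theorem Conn.sum_smul (D : Conn n m V) {ι : Type*} (s : Finset ι) {f : ι → V → ℝ}
    {Y : ι → Field n m V} {x : V} (hf : ∀ i, FnDiffAt n m (f i) x)
    (hY : ∀ i, DiffAt n m (Model n m) (Y i) x) (w : TangentSpace 𝓘(ℝ, Model n m) x) :
    D (fun y => ∑ i ∈ s, f i y • Y i y) x w =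
      ∑ i ∈ s, (f i x • D (Y i) x w + mvfderiv 𝓘(ℝ, Model n m) (f i) x w • Y i x) := by
  classical
  induction s using Finset.induction_on with
  | empty =>
    simp only [Finset.sum_empty]
    exact congrArg (fun T => T w) (D.isCovariantDerivativeOnUniv.zero (x := x))
  | insert i s hi ih =>
    simp only [Finset.sum_insert hi]
    have h1 := D.isCovariantDerivativeOnUniv.add (x := x) (DiffAt.smul (hf i) (hY i))
      (DiffAt.sum (s := s) fun j _ => DiffAt.smul (hf j) (hY j))
    have h2 := D.isCovariantDerivativeOnUniv.leibniz (x := x) (hY i) (hf i)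
    rw [← ih]
    refine (congrArg (fun T => T w) h1).trans ?_
    exact congrArg (fun T => T w + _) h2

/-- The endomorphism of a tangent space that maps the vectors of a frame to their derivatives. -/
def Conn.frameEnd (D : Conn n m V) (g : Metric n m V) {r : ℕ} (e : Fin r → Field n m V) (x : V)
    (w : TangentSpace 𝓘(ℝ, Model n m) x) :
    TangentSpace 𝓘(ℝ, Model n m) x →ₗ[ℝ] TangentSpace 𝓘(ℝ, Model n m) x :=
  ∑ α, (bilin g x (e α x)).smulRight (D (e α) x w)

theorem Conn.frameEnd_apply (D : Conn n m V) {r : ℕ} (e : Fin r → Field n m V) (x : V)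
    (w u : TangentSpace 𝓘(ℝ, Model n m) x) :
    D.frameEnd g e x w u = ∑ α, g.inner x (e α x) u • D (e α) x w := by
  simp only [frameEnd, LinearMap.sum_apply]
  rfl

theorem Conn.frameEnd_self (D : Conn n m V) {p : Part} {r : ℕ} {e : Fin r → Field n m V} {x : V}
    (he : IsOrthoBasis N g p x (fun α => e α x))
    (w : TangentSpace 𝓘(ℝ, Model n m) x) (α : Fin r) :
    D.frameEnd g e x w (e α x) = D (e α) x w := by
  rw [frameEnd_apply, Finset.sum_eq_single α]
  · rw [he.ortho, if_pos rfl, one_smul]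
  · intro β _ hβ
    rw [he.ortho, if_neg hβ, zero_smul]
  · simp

/-- Differentiate the constants g(e_α, e_β). Skewness is claimed only on E; D e_α itself may leave E
when D does not preserve the splitting. -/
theorem Conn.IsMetric.frameEnd_skew {D : Conn n m V} (hD : D.IsMetric g) {p : Part} {U : Set V}
    {r : ℕ} {e : Fin r → Field n m V} (he : IsFrameOn N g p U e) {x : V} (hx : x ∈ U)
    (w : TangentSpace 𝓘(ℝ, Model n m) x) :
    ∀ u ∈ N.sub p x, ∀ v ∈ N.sub p x,
      g.inner x (D.frameEnd g e x w u) v = - g.inner x u (D.frameEnd g e x w v) := by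
  have h1 : ∀ α β, g.inner x (D (e α) x w) (e β x) = - g.inner x (e α x) (D (e β) x w) := by
    intro α β
    have h2 := hD (e α) (e β) x (he.smooth α x hx).diffAt (he.smooth β x hx).diffAt w
    have h3 : ∀ᶠ y in 𝓝 x, g.inner y (e α y) (e β y) = if α = β then 1 else 0 :=
      Filter.eventually_of_mem (he.isOpen.mem_nhds hx) fun y hy => (he.basis y hy).ortho α β
    rw [mvfderiv_congr h3, mvfderiv_const] at h2
    exact eq_neg_of_add_eq_zero_left h2.symm
  intro u hu v hv
  have hb := he.basis x hx
  have h4 : ∀ a b : TangentSpace 𝓘(ℝ, Model n m) x, g.inner x a b = bilin g x a b :=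
    fun _ _ => rfl
  rw [D.frameEnd_apply, D.frameEnd_apply]
  nth_rewrite 2 [hb.expand hu]
  nth_rewrite 1 [hb.expand hv]
  simp only [h4] at h1 ⊢
  simp only [map_sum, map_smul, LinearMap.sum_apply, LinearMap.smul_apply, smul_eq_mul, h1]
  simp only [mul_neg, Finset.sum_neg_distrib]

end

/-! ### Spin derivations at a point: uniqueness and the local formula -/

section

variable {n m : ℕ} {V : Type*} [TopologicalSpace V] [ChartedSpace (Model n m) V]
  [IsManifold 𝓘(ℝ, Model n m) ∞ V]
  {N : NConnection n m V} {g : Metric n m V} {p : Part}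
  {F : Type*} [NormedAddCommGroup F] [NormedSpace ℂ F] [FiniteDimensional ℂ F]
  {S : V → Type*} [TopologicalSpace (TotalSpace F S)]
  [∀ x, AddCommGroup (S x)] [∀ x, Module ℂ (S x)] [∀ x, TopologicalSpace (S x)]
  [∀ x, IsTopologicalAddGroup (S x)] [∀ x, ContinuousSMul ℝ (S x)]
  [FiberBundle F S] [VectorBundle ℂ F S] [VectorBundle ℝ F S]
  [ContMDiffVectorBundle ∞ F S 𝓘(ℝ, Model n m)]

namespace SpinStructure

variable (𝒮 : SpinStructure N g p F S)

/-- `δ` is the derivation along `w` of a spin connection over `D`. -/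
structure SpinAt (D : Conn n m V) (x : V) (w : TangentSpace 𝓘(ℝ, Model n m) x)
    (δ : (Π y : V, S y) → S x) : Prop extends 𝒮.HermDerivAt x w δ where
  comm_J (ψ : Π y : V, S y) : DiffAt n m F ψ x → δ (fun y => 𝒮.J y (ψ y)) = 𝒮.J x (δ ψ)
  clifford (Y : Field n m V) (ψ : Π y : V, S y) : (∀ y, SmoothAt n m (Model n m) Y y) →
    DiffAt n m F ψ x → δ (fun y => 𝒮.c y (Y y) (ψ y)) =
      𝒮.c x (D (N.part p Y) x w) (ψ x) + 𝒮.c x (Y x) (δ ψ)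

/-- `δ` is a derivation at `x` along `w` for which the spin gauge of the frame `e` is parallel. -/
structure FlatAt {r : ℕ} (e : Fin r → Field n m V) (x : V) (w : TangentSpace 𝓘(ℝ, Model n m) x)
    (δ : (Π y : V, S y) → S x) : Prop extends 𝒮.HermDerivAt x w δ where
  comm_J (ψ : Π y : V, S y) : DiffAt n m F ψ x → δ (fun y => 𝒮.J y (ψ y)) = 𝒮.J x (δ ψ)
  comm_c (α : Fin r) (ψ : Π y : V, S y) : DiffAt n m F ψ x →
    δ (fun y => 𝒮.c y (e α y) (ψ y)) = 𝒮.c x (e α x) (δ ψ)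

variable {𝒮}

theorem IsFlatConn.flatAt {U : Set V} {r : ℕ} {e : Fin r → Field n m V} {d : SpinOp n m S}
    (hd : 𝒮.IsFlatConn U e d) {x : V} (hx : x ∈ U) (w : TangentSpace 𝓘(ℝ, Model n m) x) :
    𝒮.FlatAt e x w (fun ψ => d ψ x w) :=
  { hd.deriv x hx w with
    comm_I := fun ψ hψ => hd.comm_I x hx ψ hψ w
    metric := fun φ ψ hφ hψ => hd.metric x hx φ ψ hφ hψ w
    comm_J := fun ψ hψ => hd.comm_J x hx ψ hψ w
    comm_c := fun α ψ hψ => hd.comm_c α x hx ψ hψ w }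

/-- The terms c(D Y)ψ and the action of J are the same for both derivations, so their difference
commutes with Clifford multiplication and with J and is skew; hence it vanishes. -/
theorem SpinAt.agree [T2Space V] {D : Conn n m V} {x : V} {w : TangentSpace 𝓘(ℝ, Model n m) x}
    {δ δ' : (Π y : V, S y) → S x} (h : 𝒮.SpinAt D x w δ) (h' : 𝒮.SpinAt D x w δ')
    {ψ : Π y : V, S y} (hψ : DiffAt n m F ψ x) : δ ψ = δ' ψ := by
  obtain ⟨A, hA, hs⟩ := h.exists_end h'.toHermDerivAt
  suffices h0 : A = 0 by rw [hA ψ hψ, h0, LinearMap.zero_apply, add_zero]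
  refine 𝒮.eq_zero_of_commute (fun u => LinearMap.ext fun v => ?_) hs fun v => ?_
  · obtain ⟨Y, hY, rfl⟩ := exists_field (n := n) (m := m) u
    have hv := (smoothAt_extend (n := n) (m := m) (F := F) v).diffAt
    have h1 := hA _ (𝒮.c_diff (hY x).diffAt hv)
    rw [h.clifford Y _ hY hv, h'.clifford Y _ hY hv, hA _ hv, map_add, ← add_assoc] at h1
    simp only [FiberBundle.extend_apply_self] at h1
    exact (add_left_cancel h1).symm
  · have hv := (smoothAt_extend (n := n) (m := m) (F := F) v).diffAt
    have h1 := hA _ (𝒮.J_diff hv)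
    rw [h.comm_J _ hv, h'.comm_J _ hv, hA _ hv, map_add] at h1
    simp only [FiberBundle.extend_apply_self] at h1
    exact (add_left_cancel h1).symm

/-- Addition of a skew endomorphism that commutes with `J`. -/
theorem HermDerivAt.add_end {x : V} {w : TangentSpace 𝓘(ℝ, Model n m) x}
    {δ : (Π y : V, S y) → S x} (h : 𝒮.HermDerivAt x w δ) (T : Module.End ℂ (S x))
    (hT : ∀ φ ψ, 𝒮.herm x (T φ) ψ + 𝒮.herm x φ (T ψ) = 0) :
    𝒮.HermDerivAt x w (fun ψ => δ ψ + T (ψ x)) where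
  add hφ hψ := by rw [h.add hφ hψ, map_add]; abel
  leibniz {f ψ} hf hψ := by
    rw [h.leibniz hf hψ, T.map_smul_of_tower]
    module
  comm_I ψ hψ := by rw [h.comm_I ψ hψ, map_smul, smul_add]
  metric φ ψ hφ hψ := by
    have h1 := congrArg Complex.re (hT (φ x) (ψ x))
    rw [Complex.add_re, Complex.zero_re, ← realHerm_apply, ← realHerm_apply] at h1
    rw [h.metric φ ψ hφ hψ]
    simp only [map_add, LinearMap.add_apply]
    linarith

/-- For PY = Σ Y^α e_α, the derivative D(PY) is Σ dY^α e_α plus the frame endomorphism applied to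
PY. The flat derivation accounts for the first term in the Leibniz rule, since the γ_α are parallel,
and the commutator `lift_c` accounts for the second. -/
theorem FlatAt.spinAt (hg : N.IsDMetric g) {D : Conn n m V} (hD : D.IsMetric g) {U : Set V} {r : ℕ}
    {e : Fin r → Field n m V} (he : IsFrameOn N g p U e) {x : V} (hx : x ∈ U)
    {w : TangentSpace 𝓘(ℝ, Model n m) x} {δ : (Π y : V, S y) → S x} (h : 𝒮.FlatAt e x w δ) :
    𝒮.SpinAt D x w (fun ψ => δ ψ + 𝒮.lift x (D.frameEnd g e x w) (ψ x)) := by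
  have hb := he.basis x hx
  have hA := hD.frameEnd_skew he hx w
  have h1 : 𝒮.HermDerivAt x w (fun ψ => δ ψ + 𝒮.lift x (D.frameEnd g e x w) (ψ x)) := by
    have h2 := h.toHermDerivAt.add_end (𝒮.liftEnd (D.frameEnd g e x w) (fun α => e α x)) ?_
    · simpa only [← 𝒮.lift_eq hb] using h2
    · intro φ ψ
      rw [← 𝒮.lift_eq hb, ← 𝒮.lift_eq hb]
      exact 𝒮.lift_skew hg hb _ hA φ ψ
  refine { h1 with comm_J := fun ψ hψ => ?_, clifford := fun Y ψ hY hψ => ?_ }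
  · rw [h.comm_J ψ hψ, 𝒮.lift_J hb, map_add]
  · have hd : ∀ α, FnDiffAt n m (fun y => g.inner y (e α y) (Y y)) x := fun α =>
      metric_diff g (he.smooth α x hx).diffAt (hY x).diffAt
    have hed : ∀ α, DiffAt n m (Model n m) (e α) x := fun α => (he.smooth α x hx).diffAt
    have h3 : ∀ᶠ y in 𝓝 x, N.toPart p y (Y y) = ∑ α, g.inner y (e α y) (Y y) • e α y :=
      Filter.eventually_of_mem (he.isOpen.mem_nhds hx) fun y hy =>
        (he.basis y hy).toPart_expand hg (Y y)
    have h4 : D (N.part p Y) x w = D.frameEnd g e x w (N.toPart p x (Y x)) +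
        ∑ α, mvfderiv 𝓘(ℝ, Model n m) (fun y => g.inner y (e α y) (Y y)) x w • e α x := by
      rw [D.congr (N.part_diff p (hY x).diffAt) h3, D.sum_smul _ hd hed, Finset.sum_add_distrib,
        D.frameEnd_apply]
      congr 1
      refine Finset.sum_congr rfl fun α _ => ?_
      rw [← inner_toPart hg, hb.toPart_eq]
    have h5 : δ (fun y => 𝒮.c y (Y y) (ψ y)) = 𝒮.c x (Y x) (δ ψ) +
        𝒮.c x (∑ α, mvfderiv 𝓘(ℝ, Model n m) (fun y => g.inner y (e α y) (Y y)) x w • e α x)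
          (ψ x) := by
      have hcd : ∀ α, DiffAt n m F (fun y => 𝒮.c y (e α y) (ψ y)) x := fun α => 𝒮.c_diff (hed α) hψ
      rw [h.congr (φ := fun y => ∑ α, g.inner y (e α y) (Y y) • 𝒮.c y (e α y) (ψ y))
        (DiffAt.sum fun α _ => DiffAt.smul (hd α) (hcd α)),
        h.sum _ fun α => DiffAt.smul (hd α) (hcd α), ← 𝒮.c_toPart x (Y x), h3.self_of_nhds,
        c_sum, c_sum, LinearMap.sum_apply, LinearMap.sum_apply, ← Finset.sum_add_distrib]
      · refine Finset.sum_congr rfl fun α _ => ?_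
        rw [h.leibniz (hd α) (hcd α), h.comm_c α ψ hψ, c_smul, c_smul]
        rfl
      · filter_upwards [h3] with y hy
        rw [← 𝒮.c_toPart y (Y y), hy, c_sum, LinearMap.sum_apply]
        refine Finset.sum_congr rfl fun α _ => ?_
        rw [c_smul]
        rfl
    rw [h5, h4, 𝒮.lift_c hg hb _ hA, c_add, LinearMap.add_apply, map_add]
    abel

end SpinStructure

end

/-! ### Global spin connections -/

section

variable {n m : ℕ} {V : Type*} [TopologicalSpace V] [ChartedSpace (Model n m) V]
  [IsManifold 𝓘(ℝ, Model n m) ∞ V]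
  {N : NConnection n m V} {g : Metric n m V} {p : Part}
  {F : Type*} [NormedAddCommGroup F] [NormedSpace ℂ F] [FiniteDimensional ℂ F]
  {S : V → Type*} [TopologicalSpace (TotalSpace F S)]
  [∀ x, AddCommGroup (S x)] [∀ x, Module ℂ (S x)] [∀ x, TopologicalSpace (S x)]
  [∀ x, IsTopologicalAddGroup (S x)] [∀ x, ContinuousSMul ℝ (S x)]
  [FiberBundle F S] [VectorBundle ℂ F S] [VectorBundle ℝ F S]
  [ContMDiffVectorBundle ∞ F S 𝓘(ℝ, Model n m)]

namespace SpinStructure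

variable (𝒮 : SpinStructure N g p F S)

/-- The local formula `d + ¼ c(D e_α) γ^α` for a spin connection over `D`. -/
def frameOp (D : Conn n m V) {r : ℕ} (e : Fin r → Field n m V) (d : SpinOp n m S) : SpinOp n m S :=
  fun ψ y => d ψ y + (1 / 4 : ℝ) • ∑ α,
    ((𝒮.cBil y).flip (𝒮.c y (e α y) (ψ y))).comp (D (e α) y).toLinearMap

theorem frameOp_apply (D : Conn n m V) {r : ℕ} (e : Fin r → Field n m V) (d : SpinOp n m S)
    (ψ : Π y : V, S y) (y : V) (w : TangentSpace 𝓘(ℝ, Model n m) y) :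
    𝒮.frameOp D e d ψ y w = d ψ y w +
      (1 / 4 : ℝ) • ∑ α, 𝒮.c y (D (e α) y w) (𝒮.c y (e α y) (ψ y)) := by
  simp only [frameOp, LinearMap.add_apply, LinearMap.smul_apply, LinearMap.sum_apply]
  rfl

theorem lift_frameEnd (D : Conn n m V) {r : ℕ} {e : Fin r → Field n m V} {y : V}
    (he : IsOrthoBasis N g p y (fun α => e α y)) (w : TangentSpace 𝓘(ℝ, Model n m) y) (ψ : S y) :
    𝒮.lift y (D.frameEnd g e y w) ψ =
      (1 / 4 : ℝ) • ∑ α, 𝒮.c y (D (e α) y w) (𝒮.c y (e α y) ψ) := by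
  rw [𝒮.lift_eq_sum he]
  simp only [D.frameEnd_self he]

variable {𝒮}

theorem IsFlatConn.spinAt (hg : N.IsDMetric g) {D : Conn n m V} (hD : D.IsMetric g) {U : Set V}
    {r : ℕ} {e : Fin r → Field n m V} (he : IsFrameOn N g p U e) {d : SpinOp n m S}
    (hd : 𝒮.IsFlatConn U e d) {x : V} (hx : x ∈ U) (w : TangentSpace 𝓘(ℝ, Model n m) x) :
    𝒮.SpinAt D x w (fun ψ => 𝒮.frameOp D e d ψ x w) := by
  have h := (hd.flatAt hx w).spinAt hg hD he hx
  simpa only [frameOp_apply, 𝒮.lift_frameEnd D (he.basis x hx)] using h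

theorem IsFlatConn.frameOp_smooth {D : Conn n m V} (hD : D.IsSmooth) {U : Set V}
    {r : ℕ} {e : Fin r → Field n m V} (he : IsFrameOn N g p U e) {d : SpinOp n m S}
    (hd : 𝒮.IsFlatConn U e d) {x : V} (hx : x ∈ U) {ψ : Π y : V, S y} {Y : Field n m V}
    (hψ : SmoothAt n m F ψ x) (hY : SmoothAt n m (Model n m) Y x) :
    SmoothAt n m F (fun y => 𝒮.frameOp D e d ψ y (Y y)) x := by
  simp only [frameOp_apply]
  exact (hd.smooth x hx ψ Y hψ hY).add (SmoothAt.const_smul _ (SmoothAt.sum fun α _ =>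
    𝒮.c_smooth (hD Y (e α) x hY (he.smooth α x hx)) (𝒮.c_smooth (he.smooth α x hx) hψ)))

variable (𝒮)

/-- `nab` is a smooth connection on spinors over the linear connection `D`. -/
structure IsSpinConn (D : Conn n m V) (nab : CovariantDerivative 𝓘(ℝ, Model n m) F S) : Prop where
  spinAt (x : V) (w : TangentSpace 𝓘(ℝ, Model n m) x) : 𝒮.SpinAt D x w (fun ψ => nab ψ x w)
  smooth (ψ : Π x : V, S x) (Y : Field n m V) (x : V) : SmoothAt n m F ψ x →
    SmoothAt n m (Model n m) Y x → SmoothAt n m F (fun y => nab ψ y (Y y)) x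

/-- At each point the value is taken from an arbitrarily chosen local model around that point.
Smoothness near x holds because, by uniqueness, all these values coincide with those of the model
chosen at x. -/
theorem exists_isSpinConn [T2Space V] (hg : N.IsDMetric g) {D : Conn n m V} (hD : D.IsMetric g)
    (hD' : D.IsSmooth) : ∃ nab : CovariantDerivative 𝓘(ℝ, Model n m) F S, 𝒮.IsSpinConn D nab := by
  choose U r e d hx he hd using 𝒮.exists_flatConn hg
  have hs : ∀ x w, 𝒮.SpinAt D x w (fun ψ => 𝒮.frameOp D (e x) (d x) ψ x w) := fun x w =>
    (hd x).spinAt hg hD (he x) (hx x) w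
  have : ∀ x : V, T2Space (TangentSpace 𝓘(ℝ, Model n m) x) := fun _ =>
    inferInstanceAs (T2Space (Model n m))
  let A : (Π y : V, S y) → Π x : V, TangentSpace 𝓘(ℝ, Model n m) x →L[ℝ] S x :=
    fun ψ x => LinearMap.toContinuousLinearMap (𝒮.frameOp D (e x) (d x) ψ x)
  refine ⟨⟨A, ?_, ?_⟩, hs, fun ψ Y x hψ hY => ?_⟩
  · intro φ ψ x hφ hψ _
    ext w
    exact (hs x w).add hφ hψ
  · intro ψ f x hψ hf _
    ext w
    exact (hs x w).leibniz hf hψ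
  · refine ((hd x).frameOp_smooth hD' (he x) (hx x) hψ hY).congr ?_
    filter_upwards [hψ.eventually_diffAt, (he x).isOpen.mem_nhds (hx x)] with y hy hyU
    exact (hs y (Y y)).agree ((hd x).spinAt hg hD (he x) hyU (Y y)) hy

variable {𝒮}

theorem mvfderiv_complex {f : V → ℂ} {x : V} (hf : FnDiffAt n m f x)
    (w : TangentSpace 𝓘(ℝ, Model n m) x) :
    mvfderiv 𝓘(ℝ, Model n m) f x w =
      (mvfderiv 𝓘(ℝ, Model n m) (fun y => (f y).re) x w : ℂ) +
        (mvfderiv 𝓘(ℝ, Model n m) (fun y => (f y).im) x w : ℂ) * Complex.I := by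
  have h := mvfderiv_re_add_im (f := fun y => (f y).re) (h := fun y => (f y).im)
    ((Complex.reCLM.mdifferentiableAt).comp x hf) ((Complex.imCLM.mdifferentiableAt).comp x hf) w
  simpa only [Complex.re_add_im] using h

theorem HermDerivAt.complex_leibniz {x : V} {w : TangentSpace 𝓘(ℝ, Model n m) x}
    {δ : (Π y : V, S y) → S x} (h : 𝒮.HermDerivAt x w δ) {f : V → ℂ} {ψ : Π y : V, S y}
    (hf : FnDiffAt n m f x) (hψ : DiffAt n m F ψ x) :
    δ (fun y => f y • ψ y) = f x • δ ψ + mvfderiv 𝓘(ℝ, Model n m) f x w • ψ x := by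
  have h1 : FnDiffAt n m (fun y => (f y).re) x := (Complex.reCLM.mdifferentiableAt).comp x hf
  have h2 : FnDiffAt n m (fun y => (f y).im) x := (Complex.imCLM.mdifferentiableAt).comp x hf
  have h3 : (fun y => f y • ψ y) = fun y => (f y).re • ψ y + (f y).im • Complex.I • ψ y := by
    funext y
    nth_rewrite 1 [← Complex.re_add_im (f y)]
    rw [add_smul, mul_smul, Complex.coe_smul, Complex.coe_smul]
  rw [h3, h.add (DiffAt.smul h1 hψ) (DiffAt.smul h2 hψ.smul_I), h.leibniz h1 hψ,
    h.leibniz h2 hψ.smul_I, h.comm_I ψ hψ, mvfderiv_complex hf]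
  nth_rewrite 3 [← Complex.re_add_im (f x)]
  rw [add_smul, add_smul, mul_smul, mul_smul, Complex.coe_smul, Complex.coe_smul,
    Complex.coe_smul, Complex.coe_smul]
  abel

theorem HermDerivAt.herm_metric {x : V} {w : TangentSpace 𝓘(ℝ, Model n m) x}
    {δ : (Π y : V, S y) → S x} (h : 𝒮.HermDerivAt x w δ) {φ ψ : Π y : V, S y}
    (hφ : DiffAt n m F φ x) (hψ : DiffAt n m F ψ x) :
    𝒮.herm x (δ φ) (ψ x) + 𝒮.herm x (φ x) (δ ψ) =
      mvfderiv 𝓘(ℝ, Model n m) (fun y => 𝒮.herm y (φ y) (ψ y)) x w := by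
  have h1 := mvfderiv_re_add_im (𝒮.realHerm_diff hφ hψ) (𝒮.realHerm_diff hφ.smul_I hψ) w
  simp only [← herm_eq] at h1
  rw [h1, h.metric _ _ hφ hψ, h.metric _ _ hφ.smul_I hψ, h.comm_I φ hφ, 𝒮.herm_eq x (δ φ),
    𝒮.herm_eq x (φ x)]
  push_cast
  ring

/-- The Leibniz rule for vector fields extends to all Clifford sections by induction on their
construction. Differentiability is carried along, for arbitrary ψ, because in a product the rule for
a is applied to the section b ψ. -/
theorem SpinAt.cliffDeriv {D : Conn n m V} {a : Π x : V, Cl N g p x}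
    {ε : Π x : V, TangentSpace 𝓘(ℝ, Model n m) x → Cl N g p x} (ha : CliffDeriv N g p D a ε)
    {x : V} (ψ : Π y : V, S y) (hψ : DiffAt n m F ψ x) :
    DiffAt n m F (fun y => 𝒮.cliff y (a y) (ψ y)) x ∧
      ∀ (w : TangentSpace 𝓘(ℝ, Model n m) x) (δ : (Π y : V, S y) → S x), 𝒮.SpinAt D x w δ →
        δ (fun y => 𝒮.cliff y (a y) (ψ y)) =
          𝒮.cliff x (ε x w) (ψ x) + 𝒮.cliff x (a x) (δ ψ) := by
  induction ha generalizing ψ with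
  | scalar f hf =>
    have hfx : FnDiffAt n m f x := (hf x).mdifferentiableAt (by simp)
    have h1 : ∀ y (b : ℝ) (φ : S y), 𝒮.cliff y (algebraMap ℝ (Cl N g p y) b) φ = b • φ := by
      intro y b φ
      rw [AlgHom.commutes, Algebra.algebraMap_eq_smul_one]
      rfl
    simp only [h1]
    refine ⟨DiffAt.smul hfx hψ, fun w δ h => ?_⟩
    rw [h.leibniz hfx hψ, add_comm]
  | vector Y hY => exact ⟨𝒮.c_diff (hY x).diffAt hψ, fun w δ h => h.clifford Y ψ hY hψ⟩
  | add a b ε ε' _ _ iha ihb =>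
    obtain ⟨h1, h2⟩ := iha ψ hψ
    obtain ⟨h3, h4⟩ := ihb ψ hψ
    simp only [map_add, LinearMap.add_apply]
    refine ⟨h1.add h3, fun w δ h => ?_⟩
    rw [h.add h1 h3, h2 w δ h, h4 w δ h]
    abel
  | mul a b ε ε' _ _ iha ihb =>
    obtain ⟨h3, h4⟩ := ihb ψ hψ
    obtain ⟨h1, h2⟩ := iha _ h3
    simp only [map_add, map_mul, LinearMap.add_apply, Module.End.mul_apply]
    refine ⟨h1, fun w δ h => ?_⟩
    rw [h2 w δ h, h4 w δ h, map_add]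
    abel

theorem IsSpinConn.isSpin {D : Conn n m V} {nab : CovariantDerivative 𝓘(ℝ, Model n m) F S}
    (h : 𝒮.IsSpinConn D nab) (q : Part) : 𝒮.IsSpin D q (restrict N q nab) where
  add _ _ x hφ hψ := LinearMap.ext fun w => (h.spinAt x w).add hφ hψ
  leibniz _ _ x hf hψ w := (h.spinAt x w).complex_leibniz hf hψ
  smooth ψ _ x hψ hY := h.smooth ψ _ x hψ (N.toPart_smooth q hY)
  comm_J ψ x hψ w := (h.spinAt x w).comm_J ψ hψ
  metric _ _ x hψ hφ w := (h.spinAt x w).herm_metric hψ hφ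
  clifford _ _ ha ψ x hψ w := (SpinAt.cliffDeriv ha ψ hψ).2 w _ (h.spinAt x w)

theorem IsSpin.spinAt {D : Conn n m V} {q : Part} {nab : PartOp N S q}
    (h : 𝒮.IsSpin D q nab) (x : V) (w : N.sub q x) :
    𝒮.SpinAt D x (w : TangentSpace 𝓘(ℝ, Model n m) x) (fun ψ => nab ψ x w) where
  add hφ hψ := congrArg (fun T => T w) (h.add _ _ x hφ hψ)
  leibniz {f ψ} hf hψ := by
    have hf' : FnDiffAt n m (fun y => Complex.ofRealCLM (f y)) x :=
      (Complex.ofRealCLM.mdifferentiableAt).comp x hf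
    have h1 := h.leibniz _ ψ x hf' hψ w
    rw [mvfderiv_clm Complex.ofRealCLM hf] at h1
    simpa only [Complex.ofRealCLM_apply, Complex.coe_smul] using h1
  comm_I ψ hψ := by
    have h1 := h.leibniz (fun _ => Complex.I) ψ x mdifferentiableAt_const hψ w
    rw [mvfderiv_const] at h1
    simpa using h1
  metric φ ψ hφ hψ := by
    have h1 := congrArg Complex.re (h.metric φ ψ x hφ hψ w)
    rw [Complex.add_re] at h1
    exact (mvfderiv_clm Complex.reCLM (𝒮.herm_diff hφ hψ) (w : _)).trans h1.symm
  comm_J ψ hψ := h.comm_J ψ x hψ w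
  clifford Y ψ hY hψ := h.clifford _ _ (CliffDeriv.vector Y hY) ψ x hψ w

theorem IsSpinConn.unique [T2Space V] {D : Conn n m V}
    {nab : CovariantDerivative 𝓘(ℝ, Model n m) F S}
    (h : 𝒮.IsSpinConn D nab) {q : Part} {nab' : PartOp N S q} (h' : 𝒮.IsSpin D q nab')
    (ψ : Π x : V, S x) (x : V) (hψ : DiffAt n m F ψ x) : nab' ψ x = restrict N q nab ψ x :=
  LinearMap.ext fun w => (h'.spinAt x w).agree (h.spinAt x w) hψ

/-- The distortion of two metric connections is skew, so adding its lift turns a spin derivation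
over D into one over D'; uniqueness does the rest. On E the commutator of the lift contributes
exactly D'(PY) − D(PY). -/
theorem IsSpinConn.eq_add_lift [T2Space V] (hg : N.IsDMetric g) {D D' : Conn n m V}
    (hD : D.IsMetric g) (hD' : D'.IsMetric g) {nab nab' : CovariantDerivative 𝓘(ℝ, Model n m) F S}
    (h : 𝒮.IsSpinConn D nab) (h' : 𝒮.IsSpinConn D' nab') (ψ : Π x : V, S x) (x : V)
    (hψ : DiffAt n m F ψ x) (w : TangentSpace 𝓘(ℝ, Model n m) x) :
    nab' ψ x w = nab ψ x w + 𝒮.lift x (D'.distortion D x w) (ψ x) := by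
  obtain ⟨U, r, e, hx, he⟩ := exists_frame hg p x
  have hb := he.basis x hx
  have hZ : ∀ {Y : Field n m V}, DiffAt n m (Model n m) Y x →
      D'.distortion D x w (Y x) = D' Y x w - D Y x w := fun hY =>
    congrArg (fun T => T w) (difference_apply D' D hY)
  have hA : ∀ u ∈ N.sub p x, ∀ v ∈ N.sub p x,
      g.inner x (D'.distortion D x w u) v = - g.inner x u (D'.distortion D x w v) := by
    intro u _ v _
    have hu := diffAt_extend u
    have hv := diffAt_extend v
    have h1 := hD _ _ x hu hv w
    have h2 := hD' _ _ x hu hv w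
    have h3 := hZ hu
    have h4 := hZ hv
    simp only [FiberBundle.extend_apply_self] at h1 h2 h3 h4
    rw [h3, h4, map_sub, map_sub]
    have h5 : ∀ a b c : TangentSpace 𝓘(ℝ, Model n m) x,
        (g.inner x a - g.inner x b) c = g.inner x a c - g.inner x b c := fun _ _ _ => rfl
    rw [h5]
    linarith
  have h1 : 𝒮.SpinAt D' x w (fun ψ => nab ψ x w + 𝒮.lift x (D'.distortion D x w) (ψ x)) := by
    have h2 := (h.spinAt x w).toHermDerivAt.add_end
      (𝒮.liftEnd (D'.distortion D x w) (fun α => e α x)) ?_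
    · simp only [← 𝒮.lift_eq hb] at h2
      refine { h2 with comm_J := fun ψ hψ => ?_, clifford := fun Y ψ hY hψ => ?_ }
      · rw [(h.spinAt x w).comm_J ψ hψ, 𝒮.lift_J hb, map_add]
      · have h3 := hZ (N.part_diff p (hY x).diffAt)
        have h4 : D' (N.part p Y) x w = D (N.part p Y) x w +
            D'.distortion D x w (N.toPart p x (Y x)) := by
          rw [eq_comm, ← eq_sub_iff_add_eq']
          exact h3
        rw [(h.spinAt x w).clifford Y ψ hY hψ, 𝒮.lift_c hg hb _ hA, h4, c_add,
          LinearMap.add_apply, map_add]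
        abel
    · intro φ ψ
      rw [← 𝒮.lift_eq hb, ← 𝒮.lift_eq hb]
      exact 𝒮.lift_skew hg hb _ hA φ ψ
  exact (h'.spinAt x w).agree h1 hψ

end SpinStructure

end

section

variable {n m : ℕ} {V : Type*} [TopologicalSpace V] [ChartedSpace (Model n m) V]
  [IsManifold 𝓘(ℝ, Model n m) ∞ V]
  {N : NConnection n m V} {g : Metric n m V} {p : Part}
  {F : Type*} [NormedAddCommGroup F] [NormedSpace ℂ F] [FiniteDimensional ℂ F]
  {S : V → Type*} [TopologicalSpace (TotalSpace F S)]
  [∀ x, AddCommGroup (S x)] [∀ x, Module ℂ (S x)] [∀ x, TopologicalSpace (S x)]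
  [∀ x, IsTopologicalAddGroup (S x)] [∀ x, ContinuousSMul ℝ (S x)]
  [FiberBundle F S] [VectorBundle ℂ F S] [VectorBundle ℝ F S]
  [ContMDiffVectorBundle ∞ F S 𝓘(ℝ, Model n m)]

namespace SpinStructure

variable (𝒮 : SpinStructure N g p F S)

/-! ### Local spin gauges -/

theorem sum_herm_smul {x : V} {k : ℕ} {s : Fin k → S x}
    (ho : ∀ A B, 𝒮.herm x (s A) (s B) = if A = B then 1 else 0)
    (hs : Submodule.span ℂ (Set.range s) = ⊤) (φ : S x) : φ = ∑ A, 𝒮.herm x (s A) φ • s A := by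
  have hφ : φ ∈ Submodule.span ℂ (Set.range s) := hs ▸ Submodule.mem_top
  induction hφ using Submodule.span_induction with
  | mem x hx => obtain ⟨j, rfl⟩ := hx; simp [ho]
  | zero => simp
  | add x y _ _ h h' =>
    simp only [map_add, add_smul, Finset.sum_add_distrib]
    rw [← h, ← h']
  | smul a x _ h =>
    simp only [map_smul, smul_assoc]
    rw [← Finset.smul_sum, ← h]

theorem herm_eq_sum {x : V} {k : ℕ} {s : Fin k → S x}
    (ho : ∀ A B, 𝒮.herm x (s A) (s B) = if A = B then 1 else 0)
    (hs : Submodule.span ℂ (Set.range s) = ⊤) (φ ψ : S x) : 𝒮.herm x φ ψ =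
      ∑ A, starRingEnd ℂ (𝒮.herm x (s A) φ) * 𝒮.herm x (s A) ψ := by
  nth_rewrite 1 [𝒮.sum_herm_smul ho hs ψ]
  rw [map_sum]
  refine Finset.sum_congr rfl fun A _ => ?_
  rw [map_smul, smul_eq_mul, mul_comm, 𝒮.herm_symm x (s A) φ]

omit [FiniteDimensional ℂ F] in
theorem mvfderiv_re_conj_mul {f h : V → ℂ} {x : V} (hf : FnDiffAt n m f x) (hh : FnDiffAt n m h x)
    (w : TangentSpace 𝓘(ℝ, Model n m) x) :
    mvfderiv 𝓘(ℝ, Model n m) (fun y => (starRingEnd ℂ (f y) * h y).re) x w =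
      (starRingEnd ℂ (mvfderiv 𝓘(ℝ, Model n m) f x w) * h x
        + starRingEnd ℂ (f x) * mvfderiv 𝓘(ℝ, Model n m) h x w).re := by
  have hre : ∀ {u : V → ℂ}, FnDiffAt n m u x → FnDiffAt n m (fun y => (u y).re) x := fun hu =>
    (Complex.reCLM.mdifferentiableAt).comp x hu
  have him : ∀ {u : V → ℂ}, FnDiffAt n m u x → FnDiffAt n m (fun y => (u y).im) x := fun hu =>
    (Complex.imCLM.mdifferentiableAt).comp x hu
  have hre' : ∀ {u : V → ℂ}, FnDiffAt n m u x →
      mvfderiv 𝓘(ℝ, Model n m) (fun y => (u y).re) x w = (mvfderiv 𝓘(ℝ, Model n m) u x w).re :=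
    fun hu => mvfderiv_clm Complex.reCLM hu w
  have him' : ∀ {u : V → ℂ}, FnDiffAt n m u x →
      mvfderiv 𝓘(ℝ, Model n m) (fun y => (u y).im) x w = (mvfderiv 𝓘(ℝ, Model n m) u x w).im :=
    fun hu => mvfderiv_clm Complex.imCLM hu w
  have h1 : (fun y => (starRingEnd ℂ (f y) * h y).re) =
      fun y => (f y).re * (h y).re + (f y).im * (h y).im := by
    funext y
    simp
  have h2 := congrArg (fun T => T w) (mvfderiv_add
    (MDifferentiableAt.mul (hre hf) (hre hh)) (MDifferentiableAt.mul (him hf) (him hh)))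
  rw [h1]
  refine h2.trans ?_
  refine (congrArg₂ (· + ·) (mvfderiv_mul_apply (hre hf) (hre hh) w)
    (mvfderiv_mul_apply (him hf) (him hh) w)).trans ?_
  simp only [hre' hf, hre' hh, him' hf, him' hh, Complex.add_re, Complex.mul_re, Complex.conj_re,
    Complex.conj_im]
  ring

/-- The derivative of the components of a spinor field with respect to a frame. -/
def gaugeDeriv {k : ℕ} (s : Fin k → Π y : V, S y) (x : V) (w : TangentSpace 𝓘(ℝ, Model n m) x)
    (φ : Π y : V, S y) : S x :=
  ∑ A, mvfderiv 𝓘(ℝ, Model n m) (fun y => 𝒮.herm y (s A y) (φ y)) x w • s A x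

namespace IsGauge

variable {𝒮} {U : Set V} {r k : ℕ} {e : Fin r → Field n m V} {s : Fin k → Π x : V, S x}
  (h : 𝒮.IsGauge U e s)

include h

theorem isFrameOn : IsFrameOn N g p U e :=
  ⟨h.isOpen, h.smooth_e, fun y hy => ⟨h.orthonormal_e y hy, h.span_e y hy⟩⟩

variable {x : V} (hx : x ∈ U) (w : TangentSpace 𝓘(ℝ, Model n m) x)

include hx

theorem coeff_diff {φ : Π y : V, S y} (hφ : DiffAt n m F φ x) (A : Fin k) :
    FnDiffAt n m (fun y => 𝒮.herm y (s A y) (φ y)) x :=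
  𝒮.herm_diff (h.smooth_s A x hx).diffAt hφ

theorem gaugeDeriv_eq {φ : Π y : V, S y} {f : Fin k → V → ℂ}
    (hφ : ∀ᶠ y in 𝓝 x, φ y = ∑ A, f A y • s A y) :
    𝒮.gaugeDeriv s x w φ = ∑ A, mvfderiv 𝓘(ℝ, Model n m) (f A) x w • s A x := by
  refine Finset.sum_congr rfl fun A _ => ?_
  rw [mvfderiv_congr (f' := f A)]
  filter_upwards [hφ, h.isOpen.mem_nhds hx] with y hy hyU
  rw [hy, map_sum, Finset.sum_eq_single A]
  · rw [map_smul, h.orthonormal_s y hyU, if_pos rfl, smul_eq_mul, mul_one]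
  · intro B _ hB
    rw [map_smul, h.orthonormal_s y hyU, if_neg hB.symm, smul_zero]
  · simp

/-- An operator with constant matrix commutes with differentiating components. The map σ is the
identity for i and the γ_α, and complex conjugation for the antilinear J. -/
theorem gaugeDeriv_map (T : Π y : V, S y → S y) (σ : ℂ →L[ℝ] ℂ)
    (M : Matrix (Fin k) (Fin k) ℂ) (hT : ∀ y ∈ U, ∀ a : Fin k → ℂ,
      T y (∑ A, a A • s A y) = ∑ A, σ (a A) • ∑ B, M B A • s B y)
    {φ : Π y : V, S y} (hφ : DiffAt n m F φ x) :
    𝒮.gaugeDeriv s x w (fun y => T y (φ y)) = T x (𝒮.gaugeDeriv s x w φ) := by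
  have hM : ∀ y (a : Fin k → ℂ), ∑ A, σ (a A) • ∑ B, M B A • s B y =
      ∑ B, (∑ A, M B A * σ (a A)) • s B y := by
    intro y a
    simp only [Finset.smul_sum, Finset.sum_smul, smul_smul]
    rw [Finset.sum_comm]
    simp only [mul_comm]
  have hd : ∀ B A, FnDiffAt n m (fun y => M B A * σ (𝒮.herm y (s A y) (φ y))) x := fun B A =>
    (((M B A) • σ).mdifferentiableAt).comp x (h.coeff_diff hx hφ A)
  rw [h.gaugeDeriv_eq hx w (f := fun B y => ∑ A, M B A * σ (𝒮.herm y (s A y) (φ y))),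
    gaugeDeriv, hT x hx, hM]
  · refine Finset.sum_congr rfl fun B _ => ?_
    rw [mvfderiv_sum (f := fun A y => M B A * σ (𝒮.herm y (s A y) (φ y))) _ (hd B)]
    refine congrArg (· • s B x) (Finset.sum_congr rfl fun A _ => ?_)
    exact mvfderiv_clm ((M B A) • σ) (h.coeff_diff hx hφ A) w
  · filter_upwards [h.isOpen.mem_nhds hx] with y hy
    nth_rewrite 1 [𝒮.sum_herm_smul (h.orthonormal_s y hy) (h.span_s y hy) (φ y)]
    rw [hT y hy, hM]

theorem flatAt : 𝒮.FlatAt e x w (𝒮.gaugeDeriv s x w) where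
  add {φ ψ} hφ hψ := by
    simp only [gaugeDeriv]
    rw [← Finset.sum_add_distrib]
    refine Finset.sum_congr rfl fun A _ => ?_
    simp only [map_add]
    rw [← add_smul]
    exact congrArg (fun T => T w • s A x)
      (mvfderiv_add (h.coeff_diff hx hφ A) (h.coeff_diff hx hψ A))
  leibniz {f ψ} hf hψ := by
    have h1 : ψ x = _ := 𝒮.sum_herm_smul (h.orthonormal_s x hx) (h.span_s x hx) (ψ x)
    have h2 : ∀ y A, 𝒮.herm y (s A y) (f y • ψ y) = f y • 𝒮.herm y (s A y) (ψ y) := fun y A =>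
      (𝒮.herm y (s A y)).map_smul_of_tower (f y) (ψ y)
    simp only [gaugeDeriv, h2]
    nth_rewrite 1 [h1]
    rw [Finset.smul_sum, Finset.smul_sum, ← Finset.sum_add_distrib]
    refine Finset.sum_congr rfl fun A _ => ?_
    refine (congrArg (fun T => T w • s A x)
      (mvfderiv_fun_smul hf (h.coeff_diff hx hψ A))).trans ?_
    rw [← smul_assoc, ← smul_assoc, ← add_smul]
    rfl
  comm_I ψ hψ := by
    refine h.gaugeDeriv_map hx w (fun y φ => Complex.I • φ) (ContinuousLinearMap.id ℝ ℂ)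
      (Complex.I • 1) (fun y hy a => ?_) hψ
    simp [Matrix.one_apply, Finset.smul_sum, smul_smul, mul_comm]
  metric φ ψ hφ hψ := by
    have ho := h.orthonormal_s x hx
    have h1 : ∀ᶠ y in 𝓝 x, 𝒮.realHerm y (φ y) (ψ y) =
        ∑ A, (starRingEnd ℂ (𝒮.herm y (s A y) (φ y)) * 𝒮.herm y (s A y) (ψ y)).re := by
      filter_upwards [h.isOpen.mem_nhds hx] with y hy
      rw [realHerm_apply, 𝒮.herm_eq_sum (h.orthonormal_s y hy) (h.span_s y hy), Complex.re_sum]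
    have h2 : ∀ A, FnDiffAt n m (fun y =>
        (starRingEnd ℂ (𝒮.herm y (s A y) (φ y)) * 𝒮.herm y (s A y) (ψ y)).re) x := by
      intro A
      have h3 := h.coeff_diff hx hφ A
      have h4 := h.coeff_diff hx hψ A
      have h5 : FnDiffAt n m (fun y => starRingEnd ℂ (𝒮.herm y (s A y) (φ y))) x :=
        (Complex.conjCLE.toContinuousLinearMap.mdifferentiableAt).comp x h3
      exact (Complex.reCLM.mdifferentiableAt).comp x (MDifferentiableAt.mul h5 h4)
    have h6 : ∀ (φ : Π y : V, S y) A, 𝒮.herm x (s A x) (𝒮.gaugeDeriv s x w φ) =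
        mvfderiv 𝓘(ℝ, Model n m) (fun y => 𝒮.herm y (s A y) (φ y)) x w := by
      intro φ A
      rw [gaugeDeriv, map_sum, Finset.sum_eq_single A]
      · rw [map_smul, ho, if_pos rfl, smul_eq_mul, mul_one]
      · intro B _ hB
        rw [map_smul, ho, if_neg hB.symm, smul_zero]
      · simp
    rw [mvfderiv_congr h1, mvfderiv_sum (f := fun A y =>
        (starRingEnd ℂ (𝒮.herm y (s A y) (φ y)) * 𝒮.herm y (s A y) (ψ y)).re) _ h2,
      realHerm_apply, realHerm_apply, 𝒮.herm_eq_sum ho (h.span_s x hx),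
      𝒮.herm_eq_sum ho (h.span_s x hx) (φ x), ← Complex.add_re, ← Finset.sum_add_distrib,
      Complex.re_sum]
    refine Finset.sum_congr rfl fun A _ => ?_
    rw [h6, h6]
    exact mvfderiv_re_conj_mul (h.coeff_diff hx hφ A) (h.coeff_diff hx hψ A) w
  comm_J ψ hψ := by
    obtain ⟨K, hK⟩ := h.J_const
    refine h.gaugeDeriv_map hx w (fun y φ => 𝒮.J y φ) Complex.conjCLE.toContinuousLinearMap
      K (fun y hy a => ?_) hψ
    rw [map_sum]
    refine Finset.sum_congr rfl fun A _ => ?_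
    rw [map_smulₛₗ, hK y hy]
    rfl
  comm_c α ψ hψ := by
    obtain ⟨γ, hγ⟩ := h.gamma_const
    refine h.gaugeDeriv_map hx w (fun y φ => 𝒮.c y (e α y) φ) (ContinuousLinearMap.id ℝ ℂ)
      (γ α) (fun y hy a => ?_) hψ
    rw [map_sum]
    refine Finset.sum_congr rfl fun A _ => ?_
    rw [map_smul, hγ y hy]
    rfl

end IsGauge

variable {𝒮} in
-- In a gauge the derivative of components is a flat derivation, so with the lifted frame
-- endomorphism it is a spin derivation, equal to the given one by uniqueness. Expanding c(D e_β)
-- over the e_α, which sees only the part of D e_β in E, gives the double sum.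
theorem IsSpinConn.hasGaugeFormula [T2Space V] (hg : N.IsDMetric g) {D : Conn n m V}
    (hD : D.IsMetric g) {nab : CovariantDerivative 𝓘(ℝ, Model n m) F S}
    (h : 𝒮.IsSpinConn D nab) : 𝒮.HasGaugeFormula D nab := by
  intro U r k e s hG ψ f hψ x hx hf w
  have hev : ∀ᶠ y in 𝓝 x, ψ y = ∑ A, f A y • s A y :=
    Filter.eventually_of_mem (hG.isOpen.mem_nhds hx) hψ
  have hψd : DiffAt n m F ψ x :=
    (DiffAt.sum fun A _ => DiffAt.complex_smul (hf A) (hG.smooth_s A x hx).diffAt).congr hev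
  have hb := hG.isFrameOn.basis x hx
  have h1 := (h.spinAt x w).agree ((hG.flatAt hx w).spinAt hg hD hG.isFrameOn hx) hψd
  refine h1.trans ?_
  rw [hG.gaugeDeriv_eq hx w hev, 𝒮.lift_frameEnd D hb]
  congr 2
  rw [Finset.sum_comm]
  refine Finset.sum_congr rfl fun β _ => ?_
  rw [← 𝒮.c_toPart x (D (e β) x w), hb.toPart_expand hg, c_sum, LinearMap.sum_apply]
  refine Finset.sum_congr rfl fun α _ => ?_
  rw [c_smul, g.symm x (D (e β) x w)]
  rfl

/-! ### Dirac operators -/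

theorem contraction_add {W : Type*} [AddCommGroup W] [Module ℝ W] (q : Part) (x : V)
    (B B' : N.sub q x → N.sub q x → W) : contraction N g q x (fun u w => B u w + B' u w) =
      contraction N g q x B + contraction N g q x B' := by
  simp only [contraction, smul_add, Finset.sum_add_distrib]

variable (nab : CovariantDerivative 𝓘(ℝ, Model n m) F S)

/-- Only the reproducing identity is asked of b, not independence, so projections of a frame of TV,
some of which may vanish, are admitted. -/
theorem dirac_eq_sum (q : Part) (ψ : Π x : V, S x) (x : V) {ι : Type*} [Fintype ι]
    (b : ι → N.sub q x)
    (hb : ∀ u : N.sub q x, u = ∑ i, g.inner x (b i : TangentSpace 𝓘(ℝ, Model n m) x)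
      (u : TangentSpace 𝓘(ℝ, Model n m) x) • b i) :
    𝒮.dirac q (restrict N q nab) ψ x =
      (-Complex.I) • ∑ i, 𝒮.c x (b i) (nab ψ x (b i)) :=
  congrArg ((-Complex.I) • ·) (contraction_eq_sum (g := g) q x
    ((𝒮.cBil x).compl₁₂ (N.sub q x).subtype (restrict N q nab ψ x)) (fun _ _ => rfl) b hb)

theorem dirac_eq_sum_orthonormal (q : Part) (ψ : Π x : V, S x) (x : V) {ι : Type*} [Fintype ι]
    [DecidableEq ι] (b : Module.Basis ι ℝ (N.sub q x))
    (hb : ∀ i j, g.inner x (b i : TangentSpace 𝓘(ℝ, Model n m) x)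
      (b j : TangentSpace 𝓘(ℝ, Model n m) x) = if i = j then 1 else 0) :
    𝒮.dirac q (restrict N q nab) ψ x = (-Complex.I) • ∑ i, 𝒮.c x (b i) (nab ψ x (b i)) :=
  𝒮.dirac_eq_sum nab q ψ x b fun _ => sum_smul_of_mem_span
    ((bilin g x).compl₁₂ (N.sub q x).subtype (N.sub q x).subtype) hb (b.span_eq ▸ Submodule.mem_top)

theorem dirac_eq_sum_frame (hg : N.IsDMetric g) {U : Set V} {E : Fin n ⊕ Fin m → Field n m V}
    (hE : IsDFrame N g U E) (q : Part) (ψ : Π x : V, S x) {x : V} (hx : x ∈ U) :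
    𝒮.dirac q (restrict N q nab) ψ x = (-Complex.I) • ∑ α,
      𝒮.c x (N.toPart q x (E α x)) (nab ψ x (N.toPart q x (E α x))) := by
  refine 𝒮.dirac_eq_sum nab q ψ x (fun α => N.toSub q x (E α x)) fun u => Subtype.ext ?_
  have hu := (N.mem_sub_iff q x _).1 u.2
  rw [← hu]
  nth_rewrite 1 [hE.expand hx (u : TangentSpace 𝓘(ℝ, Model n m) x)]
  rw [map_sum, Submodule.coe_sum]
  refine Finset.sum_congr rfl fun α _ => ?_
  rw [map_smul, Submodule.coe_smul, N.toSub_coe, inner_toPart hg, hu, hu]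

/-- In an orthonormal frame adapted to the splitting each vector survives exactly one of the
projections to hV and vV, so the total sum separates. -/
theorem dirac_total (hg : N.IsDMetric g) (ψ : Π x : V, S x) (x : V) :
    𝒮.dirac .total (restrict N .total nab) ψ x =
      𝒮.dirac .hor (restrict N .hor nab) ψ x + 𝒮.dirac .ver (restrict N .ver nab) ψ x := by
  obtain ⟨U, E, hx, hE⟩ := exists_dFrame hg x
  rw [𝒮.dirac_eq_sum_frame nab hg hE _ _ hx, 𝒮.dirac_eq_sum_frame nab hg hE _ _ hx,
    𝒮.dirac_eq_sum_frame nab hg hE _ _ hx, ← smul_add]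
  simp only [Fintype.sum_sum_type, NConnection.toPart, LinearMap.id_coe, id_eq,
    LinearMap.sub_apply, ContinuousLinearMap.coe_coe, hE.proj_inl x hx, hE.proj_inr x hx, sub_zero,
    sub_self, c_zero, LinearMap.zero_apply, Finset.sum_const_zero, add_zero, zero_add]

variable {𝒮 nab}

theorem IsSpinConn.dirac_smooth (hg : N.IsDMetric g) {D : Conn n m V} (h : 𝒮.IsSpinConn D nab)
    (q : Part) (ψ : Π x : V, S x) (x : V) (hψ : SmoothAt n m F ψ x) :
    SmoothAt n m F (𝒮.dirac q (restrict N q nab) ψ) x := by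
  obtain ⟨U, E, hx, hE⟩ := exists_dFrame hg x
  have hP := fun α => N.toPart_smooth q (hE.smooth α x hx)
  have h1 : SmoothAt n m F (fun y => ∑ α,
      𝒮.c y (N.toPart q y (E α y)) (nab ψ y (N.toPart q y (E α y)))) x :=
    SmoothAt.sum fun α _ => 𝒮.c_smooth (hP α) (h.smooth ψ _ x hψ (hP α))
  refine (SmoothAt.const_smul (-1) h1.smul_I).congr ?_
  filter_upwards [hE.mem_nhds hx] with y hy
  rw [𝒮.dirac_eq_sum_frame nab hg hE q ψ hy]
  module

end SpinStructure

end

end NSpin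

end

/-! ### Assembly of the connections and the Dirac operators -/

open NSpin in
theorem theorem3p1 {n m : ℕ} (hn : 2 ≤ n) (hm : 1 ≤ m)
    {V : Type*} [TopologicalSpace V] [T2Space V] [SigmaCompactSpace V]
    [ChartedSpace (Model n m) V] [IsManifold 𝓘(ℝ, Model n m) ∞ V]
    (N : NConnection n m V) (g : Metric n m V) (hg : N.IsDMetric g)
    (p : Part)
    {F : Type*} [NormedAddCommGroup F] [NormedSpace ℂ F] [FiniteDimensional ℂ F]
    {S : V → Type*} [TopologicalSpace (TotalSpace F S)]
    [∀ x, AddCommGroup (S x)] [∀ x, Module ℂ (S x)] [∀ x, TopologicalSpace (S x)]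
    [∀ x, IsTopologicalAddGroup (S x)] [∀ x, ContinuousSMul ℝ (S x)]
    [FiberBundle F S] [VectorBundle ℂ F S] [VectorBundle ℝ F S]
    [ContMDiffVectorBundle ∞ F S 𝓘(ℝ, Model n m)]
    (𝒮 : SpinStructure N g p F S) :
    ∃ Dhat LC : Conn n m V,
      (Dhat.IsCanonical N g ∧ Dhat.IsDConnection N ∧ Dhat.IsMetric g ∧
        ∀ D' : Conn n m V, D'.IsCanonical N g → Dhat.Agree D') ∧
      (LC.IsLeviCivita g ∧ ∀ D' : Conn n m V, D'.IsLeviCivita g → LC.Agree D') ∧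
      ∃ nabHat nabLC : CovariantDerivative 𝓘(ℝ, Model n m) F S,
        𝒮.HasGaugeFormula Dhat nabHat ∧
        (∀ q : Part, 𝒮.IsSpin Dhat q (restrict N q nabHat) ∧
          ∀ nab' : PartOp N S q, 𝒮.IsSpin Dhat q nab' →
            ∀ (ψ : Π x : V, S x) (x : V), DiffAt n m F ψ x →
              nab' ψ x = restrict N q nabHat ψ x) ∧
        𝒮.HasGaugeFormula LC nabLC ∧
        (∀ q : Part, 𝒮.IsSpin LC q (restrict N q nabLC) ∧
          ∀ nab' : PartOp N S q, 𝒮.IsSpin LC q nab' →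
            ∀ (ψ : Π x : V, S x) (x : V), DiffAt n m F ψ x →
              nab' ψ x = restrict N q nabLC ψ x) ∧
        (∀ (ψ : Π x : V, S x) (x : V), DiffAt n m F ψ x →
          ∀ w : TangentSpace 𝓘(ℝ, Model n m) x,
            nabLC ψ x w = nabHat ψ x w + 𝒮.lift x (LC.distortion Dhat x w) (ψ x)) ∧
        (∀ (q : Part) (ψ : Π x : V, S x),
          (∀ x : V, SmoothAt n m F ψ x →
            SmoothAt n m F (𝒮.dirac q (restrict N q nabHat) ψ) x) ∧
          (∀ (x : V) (b : Module.Basis (Fin (Module.finrank ℝ (N.sub q x))) ℝ (N.sub q x)),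
            (∀ i j, g.inner x (b i : N.sub q x) (b j : N.sub q x) = if i = j then 1 else 0) →
            𝒮.dirac q (restrict N q nabHat) ψ x =
              (-Complex.I) • ∑ i, 𝒮.c x (b i) (nabHat ψ x (b i)))) ∧
        (∀ (ψ : Π x : V, S x) (x : V),
          𝒮.dirac .total (restrict N .total nabHat) ψ x =
            𝒮.dirac .hor (restrict N .hor nabHat) ψ x
              + 𝒮.dirac .ver (restrict N .ver nabHat) ψ x) ∧
        (∀ (q : Part) (ψ : Π x : V, S x) (x : V), DiffAt n m F ψ x →
          𝒮.dirac q (restrict N q nabLC) ψ x =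
            𝒮.dirac q (restrict N q nabHat) ψ x
              + (-Complex.I) • contraction N g q x
                  (fun u w => 𝒮.c x u (𝒮.lift x (LC.distortion Dhat x w) (ψ x)))) := by
  obtain ⟨Dhat, hDhat⟩ := (isKoszul_koszulHat (N := N) hg).exists_conn
  obtain ⟨LC, hLC⟩ := (isKoszul_koszulLC g).exists_conn
  have hDs : Dhat.IsSmooth := hDhat.isSmooth hg (isKoszul_koszulHat hg)
  have hLs : LC.IsSmooth := hLC.isSmooth hg (isKoszul_koszulLC g)
  have hDm : Dhat.IsMetric g := hDhat.isMetric fun X Y Z x _ hY hZ => koszulHat_add_swap hg hY hZ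
  have hL : LC.IsLeviCivita g := hLC.isLeviCivita
  have hDc : Dhat.IsCanonical N g := hDhat.isCanonical hg
  obtain ⟨nabHat, hHat⟩ := 𝒮.exists_isSpinConn hg hDm hDs
  obtain ⟨nabLC, hnLC⟩ := 𝒮.exists_isSpinConn hg hL.1 hLs
  have hlift := hHat.eq_add_lift hg hDm hL.1 hnLC
  refine ⟨Dhat, LC, ⟨hDc, hDhat.isDConnection hg, hDm, fun D' hD' => hDc.agree hD'⟩,
    ⟨hL, fun D' hD' => hLC.agree hD'.hasKoszul⟩, nabHat, nabLC, hHat.hasGaugeFormula hg hDm,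
    fun q => ⟨hHat.isSpin q, fun _ h' => hHat.unique h'⟩, hnLC.hasGaugeFormula hg hL.1,
    fun q => ⟨hnLC.isSpin q, fun _ h' => hnLC.unique h'⟩, hlift,
    fun q ψ => ⟨hHat.dirac_smooth hg q ψ, fun x b => 𝒮.dirac_eq_sum_orthonormal nabHat q ψ x b⟩,
    𝒮.dirac_total nabHat hg, fun q ψ x hψ => ?_⟩
  -- Contraction is additive in the bilinear expression, so the relation of the Dirac operators is
  -- the contracted relation of the spin connections.
  rw [SpinStructure.dirac, SpinStructure.dirac, ← smul_add, ← SpinStructure.contraction_add]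
  refine congrArg (fun B => (-Complex.I) • contraction N g q x B) (funext fun u => funext fun w => ?_)
  rw [← map_add]
  exact congrArg _ (hlift ψ x hψ w)
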